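/- **Setting.** Let $I$ be the vertex set of a simply-laced Dynkin diagram of finite type, with positive definite Cartan matrix $C_{ij}=\langle i,j\rangle$ ($C_{ii}=2$, $C_{ij}=-1$ if $i,j$ are joined, $0$ otherwise). Let $K$ be a field of characteristic $0$, let $q\in K^\times$ not be a root of unity, and put $[n]=\frac{q^n-q^{-n}}{q-q^{-1}}$. Fix an integer $c>0$. Let $\widehat X=X\oplus\mathbb Z\Lambda_0\oplus\mathbb Z\delta$ be the affine weight lattice, with $X$ the weight lattice, and $\langle\lambda,i\rangle$ the coordinate of $\lambda$ at the $i$-th fundamental weight. For a Laurent polynomial $f=\sum_d n_d q^d$ with $n_d\in\mathbb N$, let $\mathrm{Sym}^k(f)$ and $\Lambda^k(f)$ be the graded dimensions of $\mathrm{Sym}^k(V)$ and $\Lambda^k(V)$, where $V$ has graded dimension $f$. **Generators.** $1_\lambda$, $E_{i,r}1_\lambda$, $F_{i,r}1_\lambda$, $P_i^{(n)}1_\lambda$, $P_i^{(1^n)}1_\lambda$, $Q_i^{(n)}1_\lambda$, $Q_i^{(1^n)}1_\lambda$ for $i\in I$, $\lambda\in\widehat X$, $r\in\mathbb Z$, $n\in\mathbb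 N$. Write $E_i=E_{i,0}$, $F_i=F_{i,0}$, and $$Q_i^{[1^n]}=\sum_{m=0}^n(-q)^m[m]Q_i^{(1^{n-m})}Q_i^{(m)},\qquad P_i^{[1^n]}=\sum_{m=0}^n(-q)^{-m}[m]P_i^{(1^{n-m})}P_i^{(m)}.$$ **Reduced relations** (each is imposed on every $1_\lambda$). (R1) The $1_\lambda$ are mutually orthogonal idempotents. The generators satisfy $X1_\lambda=1_{\lambda+\mathrm{wt}X}X1_\lambda=1_{\lambda+\mathrm{wt}X}X$, where $E_{i,r},F_{i,r}$ have weights $\pm\alpha_i+rc\delta$, where $Q_i^{(n)},Q_i^{(1^n)}$ have weight $nc\delta$, and where $P_i^{(n)},P_i^{(1^n)}$ have weight $-nc\delta$. (R2) $Q_i^{(0)}=Q_i^{(1^0)}=P_i^{(0)}=P_i^{(1^0)}=1$, and $\sum_{k=0}^n(-1)^kQ_i^{(1^k)}Q_i^{(n-k)}=0=\sum_{k=0}^n(-1)^kP_i^{(1^k)}P_i^{(n-k)}$ for $n>0$. Moreover $$Q_j^{(n)}P_i^{(m)}=\sum_{k\ge0}a_k\,P_i^{(m-k)}Q_j^{(n-k)},\qquad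 Q_j^{(1^n)}P_i^{(m)}=\sum_{k\ge0}b_k\,P_i^{(m-k)}Q_j^{(1^{n-k})},$$ and the same with $(a)$ and $(1^a)$ exchanged everywhere. Here $(a_k,b_k)$ is $(\mathrm{Sym}^k([2][c]),\Lambda^k([2][c]))$ if $i=j$, it is $((-1)^k\Lambda^k([c]),(-1)^k\mathrm{Sym}^k([c]))$ if $\langle i,j\rangle=-1$, and it is $(\delta_{k0},\delta_{k0})$ if $\langle i,j\rangle=0$. (R3) $[E_{i,a},F_{j,b}]=0$ if $i\neq j$, and $$[E_{i,a},F_{i,b}]1_\lambda=\begin{cases}q^{ac}q^{\langle\lambda,i\rangle}Q_i^{[1^{a+b}]}1_\lambda&a+b>0\\ q^{bc}q^{-\langle\lambda,i\rangle}P_i^{[1^{-a-b}]}1_\lambda&a+b<0\\ [\langle\lambda,i\rangle+ac]1_\lambda&a+b=0.\end{cases}$$ (R4) $E_{i,n}E_{i,n-1}=q^2E_{i,n-1}E_{i,n}$ and $F_{i,n-1}F_{i,n}=q^2F_{i,n}F_{i,n-1}$ for all $n\in\mathbb Z$. (R5) If $\langle i,j\rangle=-1$ then $E_{i,1}E_j+E_{j,1}E_i=q^{-1}(E_jE_{i,1}+E_iE_{j,1})$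 and $F_{i,-1}F_j+F_{j,-1}F_i=q^{-1}(F_jF_{i,-1}+F_iF_{j,-1})$. If $\langle i,j\rangle=0$ then $E_{i,m}E_{j,n}=E_{j,n}E_{i,m}$ and $F_{i,m}F_{j,n}=F_{j,n}F_{i,m}$ for all $m,n\in\mathbb Z$. (R6) If $\langle i,j\rangle=-1$ then $E_{j,n}E_{i,m}^2+E_{i,m}^2E_{j,n}=[2]E_{i,m}E_{j,n}E_{i,m}$ for all $m,n\in\mathbb Z$, and likewise with $F$ in place of $E$. **Full relations of $\dot U_q(\widehat{\mathfrak g})$.** These are (R1), (R2), (R3) and the following. (U3) The $P_i^{(n)},P_i^{(1^n)}$ ($i\in I$) commute among each other, and so do the $Q_i^{(n)},Q_i^{(1^n)}$. (U6) Let $C=\langle i,j\rangle$. If $C\in\{2,-1\}$ then for all $a>0$ and $b\in\mathbb Z$ $$\begin{aligned}q^c[Q_j^{[1^{a+1}]},E_{i,b}]&=q^{C}Q_j^{[1^a]}E_{i,b+1}-q^{-C}E_{i,b+1}Q_j^{[1^a]},&q^c[Q_j^{[1]},E_{i,b}]&=[C]E_{i,b+1},\\ [Q_j^{[1^{a+1}]},F_{i,b}]&=q^{-C}Q_j^{[1^a]}F_{i,b+1}-q^{C}F_{i,b+1}Q_j^{[1^a]},&[Q_j^{[1]},F_{i,b}]&=-[C]F_{i,b+1},\\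 [P_j^{[1^{a+1}]},E_{i,b+1}]&=q^{-C}P_j^{[1^a]}E_{i,b}-q^{C}E_{i,b}P_j^{[1^a]},&[P_j^{[1]},E_{i,b+1}]&=[C]E_{i,b},\\ q^{-c}[P_j^{[1^{a+1}]},F_{i,b+1}]&=q^{C}P_j^{[1^a]}F_{i,b}-q^{-C}F_{i,b}P_j^{[1^a]},&q^{-c}[P_j^{[1]},F_{i,b+1}]&=-[C]F_{i,b}.\end{aligned}$$ If $C=0$ then $P_j^{[1^a]}$ and $Q_j^{[1^a]}$ ($a>0$) commute with $E_{i,b}$ and $F_{i,b}$. (U8) $E_{i,m}E_{i,n-1}+E_{i,n}E_{i,m-1}=q^2(E_{i,m-1}E_{i,n}+E_{i,n-1}E_{i,m})$ and $F_{i,n-1}F_{i,m}+F_{i,m-1}F_{i,n}=q^2(F_{i,n}F_{i,m-1}+F_{i,m}F_{i,n-1})$ for all $m,n\in\mathbb Z$. (U9) If $\langle i,j\rangle=-1$ then $E_{i,m}E_{j,n-1}+E_{j,n}E_{i,m-1}=q^{-1}(E_{j,n-1}E_{i,m}+E_{i,m-1}E_{j,n})$ and $F_{i,m-1}F_{j,n}+F_{j,n-1}F_{i,m}=q^{-1}(F_{j,n}F_{i,m-1}+F_{i,m}F_{j,n-1})$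 for all $m,n\in\mathbb Z$. If $\langle i,j\rangle=0$ then $E_{i,m}E_{j,n}=E_{j,n}E_{i,m}$ and $F_{i,m}F_{j,n}=F_{j,n}F_{i,m}$. (U10) If $\langle i,j\rangle=-1$ then $\sum_{\sigma\in S_2}\big(E_{j,n}E_{i,m_{\sigma(1)}}E_{i,m_{\sigma(2)}}+E_{i,m_{\sigma(1)}}E_{i,m_{\sigma(2)}}E_{j,n}\big)=\sum_{\sigma\in S_2}[2]E_{i,m_{\sigma(1)}}E_{j,n}E_{i,m_{\sigma(2)}}$, and likewise with $F$ in place of $E$. **Drinfeld's relations.** These concern elements $e_{i,r},f_{i,r}$ ($r\in\mathbb Z$), $h_{i,m}$ ($m\neq0$), $q^x$ ($x\in X^*$), $q^{\pm d}$, $q^{\pm c/2}$. Put $x_i^+(z)=\sum_n e_{i,n}z^{-n}$, $x_i^-(z)=\sum_n f_{i,n}z^{-n}$, $\psi_i^\pm(z)=q^{\pm h_i}\exp\big(\pm(q-q^{-1})\sum_{n>0}h_{i,\pm n}z^{\mp n}\big)$ with $h_i\in X^*$ the $i$-th simple coroot, and $\delta(z)=\sum_{n\in\mathbb Z}z^n$.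 The relations are: 1. $q^{\pm c/2}$ is central; $q^0=1$, $q^xq^{x'}=q^{x+x'}$, $[q^x,h_{i,m}]=0$, $q^dq^{-d}=1$, $q^{c/2}q^{-c/2}=1$; $[q^d,q^x]=0$, $q^dh_{i,m}q^{-d}=q^mh_{i,m}$, $q^de_{i,r}q^{-d}=q^re_{i,r}$, $q^df_{i,r}q^{-d}=q^rf_{i,r}$. 2. $\psi_i^\pm(z)\psi_j^\pm(w)=\psi_j^\pm(w)\psi_i^\pm(z)$ and, expanded in powers of $z/w$, $\psi_i^-(z)\psi_j^+(w)=\frac{(z-q^{-\langle i,j\rangle}q^cw)(z-q^{\langle i,j\rangle}q^{-c}w)}{(z-q^{\langle i,j\rangle}q^cw)(z-q^{-\langle i,j\rangle}q^{-c}w)}\psi_j^+(w)\psi_i^-(z)$. 3. $(q^{\pm sc/2}z-q^{\pm\langle i,j\rangle}w)\psi_j^s(z)x_i^\pm(w)=(q^{\pm\langle i,j\rangle}q^{\pm sc/2}z-w)x_i^\pm(w)\psi_j^s(z)$ for $s=\pm$. 4. $[x_i^+(z),x_j^-(w)]=\frac{\delta_{ij}}{q-q^{-1}}\big(\delta(q^cwz^{-1})\psi_i^+(q^{c/2}w)-\delta(q^czw^{-1})\psi_i^-(q^{c/2}z)\big)$.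 5. $(z-q^{\pm2}w)x_i^\pm(z)x_i^\pm(w)=(q^{\pm2}z-w)x_i^\pm(w)x_i^\pm(z)$, and $(z-q^{\mp1}w)x_i^\pm(z)x_j^\pm(w)=(q^{\mp1}z-w)x_j^\pm(w)x_i^\pm(z)$ if $\langle i,j\rangle=-1$. 6. If $\langle i,j\rangle\le0$ and $N=1-\langle i,j\rangle$, then $\sum_{\sigma\in S_N}\sum_{s=0}^N(-1)^s\begin{bmatrix}N\\s\end{bmatrix}x_i^\pm(z_{\sigma(1)})\cdots x_i^\pm(z_{\sigma(s)})x_j^\pm(w)x_i^\pm(z_{\sigma(s+1)})\cdots x_i^\pm(z_{\sigma(N)})=0$. A *weight module* is a representation on a vector space $V$ that is the direct sum of the weight spaces $V(\lambda)=1_\lambda V$. It is *integrable* if for every $\lambda\in\widehat X$ and every real root $\alpha$ of $\widehat{\mathfrak g}$ one has $V(\lambda+n\alpha)=0$ for $n\gg0$ and for $n\ll0$. **Theorem 2.1.** (a) In the algebra presented by the reduced relations (R1)–(R6), all the full relations hold. The identity on generators induces an isomorphism of this algebra with $\dot U_q(\widehat{\mathfrak g})$, the algebra presented by the full relations. (b)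 Let $q^{1/2}\in K$ be a square root of $q$, and let $V$ be any weight module over the algebra presented by (R1)–(R6). Then there are operators $e_{i,r},f_{i,r},h_{i,m},q^x,q^{\pm d},q^{\pm c/2}$ on $V$ that satisfy all of Drinfeld's relations and that correspond to the given operators as follows. On each $V(\lambda)$: $E_{i,r}=(-q)^rq^{rc/2}e_{i,r}$ and $F_{i,r}=(-q)^rq^{rc/2}f_{i,r}$; $$\sum_{n\ge0}Q_i^{(n)}z^n=\exp\Big(\sum_{n\ge1}\tfrac{h_{i,n}}{[n]}z^n\Big),\qquad\sum_{n\ge0}(-1)^nQ_i^{(1^n)}z^n=\exp\Big(-\sum_{n\ge1}\tfrac{h_{i,n}}{[n]}z^n\Big),$$ and the same for $P_i$ with $h_{i,-n}$ in place of $h_{i,n}$; $q^x$ acts by $q^{\langle x,\lambda\rangle}$; $q^d$ acts by $q^{\lfloor k/c\rfloor}$, where $k$ is the coefficient of $\delta$ in $\lambda$; and $q^{c/2}$ acts by $(q^{1/2})^c$. (c) On every integrable weight module over the algebra presented by (R1)–(R5) only, the Serre relations (R6) hold. -/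

import Mathlib

/-! Quantum affine algebras of simply-laced finite type: the idempotented presentation, its reduced
presentation, and the Drinfeld realization. -/

namespace QAff

universe u v w

/-! ### Dynkin data and affine weights -/

section Dynkin

variable {I : Type u} [DecidableEq I] (G : SimpleGraph I) [DecidableRel G.Adj]

/-- The Cartan matrix `⟨i, j⟩` of a simply-laced Dynkin diagram. -/
def cartan : Matrix I I ℤ :=
  fun i j => if i = j then 2 else if G.Adj i j then -1 else 0

/-- A simply-laced Dynkin diagram is of finite type if its Cartan matrix is positive definite. -/
def FiniteType [Fintype I] : Prop :=
  ((cartan G).map (fun n : ℤ => (n : ℝ))).PosDef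

/-- The affine weight lattice `X ⊕ ℤ Λ₀ ⊕ ℤ δ`. A weight is a triple: its finite part, in coordinates
with respect to the fundamental weights, its level, and its coefficient of `δ`. -/
abbrev AffWeight (I : Type u) : Type u := (I → ℤ) × ℤ × ℤ

/-- `⟨l, αᵢ⟩`. -/
def pair (l : AffWeight I) (i : I) : ℤ := l.1 i

/-- The simple root `αᵢ` as an affine weight (`⟨αᵢ, αⱼ⟩ = C i j`). -/
def simpleRoot (i : I) : AffWeight I := (fun j => cartan G i j, 0, 0)

/-- The weight `δ`. -/
def delta (I : Type u) : AffWeight I := (0, 0, 1)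

/-- Real roots of the affine Lie algebra: `β + k δ` with `β = ∑ bᵢ αᵢ` a root of the finite root
system, i.e. an element of the root lattice with `⟨β, β⟩ = 2`, and `k` an integer. -/
def IsRealRoot [Fintype I] (a : AffWeight I) : Prop :=
  ∃ (b : I → ℤ) (k : ℤ), (∑ i, ∑ j, b i * cartan G i j * b j = 2) ∧
    a = (∑ i, b i • simpleRoot G i) + k • delta I

end Dynkin

/-! ### Quantum integers and graded dimensions -/

section Quantum

variable {K : Type v} [Field K] (q : K)

/-- The quantum integer `[n]`. -/
def qint (n : ℤ) : K := (q ^ n - q ^ (-n)) / (q - q⁻¹)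

/-- The quantum factorial `[n]!`. -/
def qfact (n : ℕ) : K := ∏ k ∈ Finset.range n, qint q ((k : ℤ) + 1)

/-- The quantum binomial coefficient (used for `s ≤ n` only). -/
def qbinom (n s : ℕ) : K := qfact q n / (qfact q s * qfact q (n - s))

/-- Graded dimension of `Sym^k V`, where `V` has a basis indexed by `ι` with degrees `d`:
the sum over the monomials of degree `k` in the basis. -/
def symDim {ι : Type} [Fintype ι] [DecidableEq ι] (d : ι → ℤ) (k : ℕ) : K :=
  ∑ s : Sym ι k, ((s : Multiset ι).map (fun x => q ^ d x)).prod

/-- Graded dimension of `Λ^k V`, where `V` has a basis indexed by `ι` with degrees `d`: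
the sum over the `k`-element subsets of the basis. -/
def extDim {ι : Type} [Fintype ι] (d : ι → ℤ) (k : ℕ) : K :=
  ∑ s ∈ Finset.powersetCard k (Finset.univ : Finset ι), ∏ x ∈ s, q ^ d x

/-- Degrees of a graded vector space of graded dimension `[c] = q^(c-1) + q^(c-3) + ⋯ + q^(1-c)`. -/
def degC (c : ℕ) (b : Fin c) : ℤ := (c : ℤ) - 1 - 2 * (b : ℤ)

/-- Degrees of a graded vector space of graded dimension `[2][c]`. -/
def deg2C (c : ℕ) (x : Fin 2 × Fin c) : ℤ := degC 2 x.1 + degC c x.2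

variable {I : Type u} [DecidableEq I] (G : SimpleGraph I) [DecidableRel G.Adj]

/-- Structure constants for `Q⁽ⁿ⁾ P⁽ᵐ⁾` and for `Q^(1ⁿ) P^(1ᵐ)`. -/
def heisLike (c : ℕ) (i j : I) (k : ℕ) : K :=
  if i = j then symDim q (deg2C c) k
  else if G.Adj i j then (-1) ^ k * extDim q (degC c) k
  else if k = 0 then 1 else 0

/-- Structure constants for `Q^(1ⁿ) P⁽ᵐ⁾` and for `Q⁽ⁿ⁾ P^(1ᵐ)`. -/
def heisMixed (c : ℕ) (i j : I) (k : ℕ) : K :=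
  if i = j then extDim q (deg2C c) k
  else if G.Adj i j then (-1) ^ k * symDim q (degC c) k
  else if k = 0 then 1 else 0

end Quantum

/-! ### Generators of the idempotented algebra -/

/-- Symbols for the generators `1_l`, `E_{i,r} 1_l`, `F_{i,r} 1_l`, `P_i⁽ⁿ⁾ 1_l`, `P_i^(1ⁿ) 1_l`,
`Q_i⁽ⁿ⁾ 1_l`, `Q_i^(1ⁿ) 1_l`. -/
inductive Gen (I : Type u) : Type u
  | one (l : AffWeight I)
  | E (i : I) (r : ℤ) (l : AffWeight I)
  | F (i : I) (r : ℤ) (l : AffWeight I)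
  | P (i : I) (n : ℕ) (l : AffWeight I)
  | P1 (i : I) (n : ℕ) (l : AffWeight I)
  | Q (i : I) (n : ℕ) (l : AffWeight I)
  | Q1 (i : I) (n : ℕ) (l : AffWeight I)

/-- A homogeneous operator `X` with values in `A`: the family of the elements `X 1_l`, where `X 1_l`
maps the weight `l` to the weight `l + deg`. -/
structure WOp (I : Type u) (A : Type w) where
  /-- The weight of the operator. -/
  deg : AffWeight I
  /-- The element `X 1_l`. -/
  app : AffWeight I → A

instance (I : Type u) (A : Type w) : CoeFun (WOp I A) (fun _ => AffWeight I → A) := ⟨WOp.app⟩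

/-- Composition: `(X Y) 1_l = (X 1_{l + deg Y}) (Y 1_l)`. -/
instance (I : Type u) (A : Type w) [Mul A] : Mul (WOp I A) :=
  ⟨fun X Y => ⟨X.deg + Y.deg, fun l => X.app (l + Y.deg) * Y.app l⟩⟩

section Operators

variable {I : Type u} [DecidableEq I] (G : SimpleGraph I) [DecidableRel G.Adj]
variable {K : Type v} [Field K] (q : K) (c : ℕ)
variable {A : Type w} [Ring A] [Algebra K A] (g : Gen I → A)

/-- `E_{i,r}`, of weight `αᵢ + r c δ`. -/
def opE (i : I) (r : ℤ) : WOp I A :=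
  ⟨simpleRoot G i + (r * (c : ℤ)) • delta I, fun l => g (.E i r l)⟩

/-- `F_{i,r}`, of weight `-αᵢ + r c δ`. -/
def opF (i : I) (r : ℤ) : WOp I A :=
  ⟨-simpleRoot G i + (r * (c : ℤ)) • delta I, fun l => g (.F i r l)⟩

/-- `P_i⁽ⁿ⁾`, of weight `-n c δ`. -/
def opP (i : I) (n : ℕ) : WOp I A := ⟨-(((n : ℤ) * (c : ℤ)) • delta I), fun l => g (.P i n l)⟩

/-- `P_i^(1ⁿ)`, of weight `-n c δ`. -/
def opP1 (i : I) (n : ℕ) : WOp I A := ⟨-(((n : ℤ) * (c : ℤ)) • delta I), fun l => g (.P1 i n l)⟩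

/-- `Q_i⁽ⁿ⁾`, of weight `n c δ`. -/
def opQ (i : I) (n : ℕ) : WOp I A := ⟨((n : ℤ) * (c : ℤ)) • delta I, fun l => g (.Q i n l)⟩

/-- `Q_i^(1ⁿ)`, of weight `n c δ`. -/
def opQ1 (i : I) (n : ℕ) : WOp I A := ⟨((n : ℤ) * (c : ℤ)) • delta I, fun l => g (.Q1 i n l)⟩

/-- `Q_i^[1ⁿ] = ∑ₘ (-q)ᵐ [m] Q_i^(1ⁿ⁻ᵐ) Q_i⁽ᵐ⁾`. -/
def opQb (i : I) (n : ℕ) : WOp I A :=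
  ⟨((n : ℤ) * (c : ℤ)) • delta I, fun l =>
    ∑ m ∈ Finset.range (n + 1),
      ((-q) ^ m * qint q (m : ℤ)) • (opQ1 c g i (n - m) * opQ c g i m) l⟩

/-- `P_i^[1ⁿ] = ∑ₘ (-q)⁻ᵐ [m] P_i^(1ⁿ⁻ᵐ) P_i⁽ᵐ⁾`. -/
def opPb (i : I) (n : ℕ) : WOp I A :=
  ⟨-(((n : ℤ) * (c : ℤ)) • delta I), fun l =>
    ∑ m ∈ Finset.range (n + 1),
      ((-q) ^ (-(m : ℤ)) * qint q (m : ℤ)) • (opP1 c g i (n - m) * opP c g i m) l⟩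

/-! ### Relations

A set of relations is a binary relation on `A`: the pairs (left side, right side). -/

/-- The `1_l` are mutually orthogonal idempotents, and every generator shifts weights as it should. -/
inductive WeightRel : A → A → Prop
  | idem (l : AffWeight I) : WeightRel (g (.one l) * g (.one l)) (g (.one l))
  | orth (l m : AffWeight I) (h : l ≠ m) : WeightRel (g (.one l) * g (.one m)) 0
  | E_right (i : I) (r : ℤ) (l : AffWeight I) : WeightRel (opE G c g i r l * g (.one l)) (opE G c g i r l)
  | E_left (i : I) (r : ℤ) (l : AffWeight I) :
      WeightRel (g (.one (l + (opE G c g i r).deg)) * opE G c g i r l) (opE G c g i r l)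
  | F_right (i : I) (r : ℤ) (l : AffWeight I) : WeightRel (opF G c g i r l * g (.one l)) (opF G c g i r l)
  | F_left (i : I) (r : ℤ) (l : AffWeight I) :
      WeightRel (g (.one (l + (opF G c g i r).deg)) * opF G c g i r l) (opF G c g i r l)
  | P_right (i : I) (n : ℕ) (l : AffWeight I) : WeightRel (opP c g i n l * g (.one l)) (opP c g i n l)
  | P_left (i : I) (n : ℕ) (l : AffWeight I) :
      WeightRel (g (.one (l + (opP c g i n).deg)) * opP c g i n l) (opP c g i n l)
  | P1_right (i : I) (n : ℕ) (l : AffWeight I) : WeightRel (opP1 c g i n l * g (.one l)) (opP1 c g i n l)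
  | P1_left (i : I) (n : ℕ) (l : AffWeight I) :
      WeightRel (g (.one (l + (opP1 c g i n).deg)) * opP1 c g i n l) (opP1 c g i n l)
  | Q_right (i : I) (n : ℕ) (l : AffWeight I) : WeightRel (opQ c g i n l * g (.one l)) (opQ c g i n l)
  | Q_left (i : I) (n : ℕ) (l : AffWeight I) :
      WeightRel (g (.one (l + (opQ c g i n).deg)) * opQ c g i n l) (opQ c g i n l)
  | Q1_right (i : I) (n : ℕ) (l : AffWeight I) : WeightRel (opQ1 c g i n l * g (.one l)) (opQ1 c g i n l)
  | Q1_left (i : I) (n : ℕ) (l : AffWeight I) :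
      WeightRel (g (.one (l + (opQ1 c g i n).deg)) * opQ1 c g i n l) (opQ1 c g i n l)

/-- The Heisenberg relations. The first six say that the series `∑ Q⁽ⁿ⁾ zⁿ` and `∑ (-1)ⁿ Q^(1ⁿ) zⁿ`
have constant term `1` and are inverse to each other (they are `exp H` and `exp (-H)` for the same
`H`), and likewise for `P`. The others are the commutation relations between `Q` and `P`. -/
inductive HeisRel : A → A → Prop
  | Q_zero (i : I) (l : AffWeight I) : HeisRel (opQ c g i 0 l) (g (.one l))
  | Q1_zero (i : I) (l : AffWeight I) : HeisRel (opQ1 c g i 0 l) (g (.one l))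
  | P_zero (i : I) (l : AffWeight I) : HeisRel (opP c g i 0 l) (g (.one l))
  | P1_zero (i : I) (l : AffWeight I) : HeisRel (opP1 c g i 0 l) (g (.one l))
  | Q_inv (i : I) (n : ℕ) (hn : 0 < n) (l : AffWeight I) :
      HeisRel (∑ k ∈ Finset.range (n + 1), (-1 : K) ^ k • (opQ1 c g i k * opQ c g i (n - k)) l) 0
  | P_inv (i : I) (n : ℕ) (hn : 0 < n) (l : AffWeight I) :
      HeisRel (∑ k ∈ Finset.range (n + 1), (-1 : K) ^ k • (opP1 c g i k * opP c g i (n - k)) l) 0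
  | Q_P (i j : I) (n m : ℕ) (l : AffWeight I) :
      HeisRel ((opQ c g j n * opP c g i m) l)
        (∑ k ∈ Finset.range (min m n + 1),
          heisLike q G c i j k • (opP c g i (m - k) * opQ c g j (n - k)) l)
  | Q1_P1 (i j : I) (n m : ℕ) (l : AffWeight I) :
      HeisRel ((opQ1 c g j n * opP1 c g i m) l)
        (∑ k ∈ Finset.range (min m n + 1),
          heisLike q G c i j k • (opP1 c g i (m - k) * opQ1 c g j (n - k)) l)
  | Q1_P (i j : I) (n m : ℕ) (l : AffWeight I) :
      HeisRel ((opQ1 c g j n * opP c g i m) l)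
        (∑ k ∈ Finset.range (min m n + 1),
          heisMixed q G c i j k • (opP c g i (m - k) * opQ1 c g j (n - k)) l)
  | Q_P1 (i j : I) (n m : ℕ) (l : AffWeight I) :
      HeisRel ((opQ c g j n * opP1 c g i m) l)
        (∑ k ∈ Finset.range (min m n + 1),
          heisMixed q G c i j k • (opP1 c g i (m - k) * opQ c g j (n - k)) l)

/-- The relations between the `E`s and the `F`s. -/
inductive EFRel : A → A → Prop
  | pos (i : I) (a b : ℤ) (h : 0 < a + b) (l : AffWeight I) :
      EFRel ((opE G c g i a * opF G c g i b) l - (opF G c g i b * opE G c g i a) l)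
        ((q ^ (a * (c : ℤ)) * q ^ pair l i) • opQb q c g i (a + b).toNat l)
  | neg (i : I) (a b : ℤ) (h : a + b < 0) (l : AffWeight I) :
      EFRel ((opE G c g i a * opF G c g i b) l - (opF G c g i b * opE G c g i a) l)
        ((q ^ (b * (c : ℤ)) * q ^ (-pair l i)) • opPb q c g i (-a - b).toNat l)
  | zero (i : I) (a b : ℤ) (h : a + b = 0) (l : AffWeight I) :
      EFRel ((opE G c g i a * opF G c g i b) l - (opF G c g i b * opE G c g i a) l)
        (qint q (pair l i + a * (c : ℤ)) • g (.one l))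
  | ne (i j : I) (h : i ≠ j) (a b : ℤ) (l : AffWeight I) :
      EFRel ((opE G c g i a * opF G c g j b) l - (opF G c g j b * opE G c g i a) l) 0

/-- `E`s, respectively `F`s, at distinct vertices that are not joined commute. -/
inductive FarRel : A → A → Prop
  | E (i j : I) (hne : i ≠ j) (h : ¬ G.Adj i j) (m n : ℤ) (l : AffWeight I) :
      FarRel ((opE G c g i m * opE G c g j n) l) ((opE G c g j n * opE G c g i m) l)
  | F (i j : I) (hne : i ≠ j) (h : ¬ G.Adj i j) (m n : ℤ) (l : AffWeight I) :
      FarRel ((opF G c g i m * opF G c g j n) l) ((opF G c g j n * opF G c g i m) l)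

/-- The reduced set of relations, without the Serre relation. -/
inductive BaseRel : A → A → Prop
  | weight (x y : A) (h : WeightRel G c g x y) : BaseRel x y
  | heis (x y : A) (h : HeisRel G q c g x y) : BaseRel x y
  | ef (x y : A) (h : EFRel G q c g x y) : BaseRel x y
  | far (x y : A) (h : FarRel G c g x y) : BaseRel x y
  | EE (i : I) (n : ℤ) (l : AffWeight I) :
      BaseRel ((opE G c g i n * opE G c g i (n - 1)) l)
        (q ^ 2 • (opE G c g i (n - 1) * opE G c g i n) l)
  | FF (i : I) (n : ℤ) (l : AffWeight I) :
      BaseRel ((opF G c g i (n - 1) * opF G c g i n) l)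
        (q ^ 2 • (opF G c g i n * opF G c g i (n - 1)) l)
  | EE_adj (i j : I) (h : G.Adj i j) (l : AffWeight I) :
      BaseRel ((opE G c g i 1 * opE G c g j 0) l + (opE G c g j 1 * opE G c g i 0) l)
        (q⁻¹ • ((opE G c g j 0 * opE G c g i 1) l + (opE G c g i 0 * opE G c g j 1) l))
  | FF_adj (i j : I) (h : G.Adj i j) (l : AffWeight I) :
      BaseRel ((opF G c g i (-1) * opF G c g j 0) l + (opF G c g j (-1) * opF G c g i 0) l)
        (q⁻¹ • ((opF G c g j 0 * opF G c g i (-1)) l + (opF G c g i 0 * opF G c g j (-1)) l))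

/-- The Serre relation with equal indices. -/
inductive SerreEqRel : A → A → Prop
  | E (i j : I) (h : G.Adj i j) (m n : ℤ) (l : AffWeight I) :
      SerreEqRel
        ((opE G c g j n * opE G c g i m * opE G c g i m) l
          + (opE G c g i m * opE G c g i m * opE G c g j n) l)
        (qint q 2 • (opE G c g i m * opE G c g j n * opE G c g i m) l)
  | F (i j : I) (h : G.Adj i j) (m n : ℤ) (l : AffWeight I) :
      SerreEqRel
        ((opF G c g j n * opF G c g i m * opF G c g i m) l
          + (opF G c g i m * opF G c g i m * opF G c g j n) l)
        (qint q 2 • (opF G c g i m * opF G c g j n * opF G c g i m) l)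

/-- The reduced set of relations. -/
inductive ReducedRel : A → A → Prop
  | base (x y : A) (h : BaseRel G q c g x y) : ReducedRel x y
  | serre (x y : A) (h : SerreEqRel G q c g x y) : ReducedRel x y

/-- The `P`s commute among each other and the `Q`s commute among each other. -/
inductive PQCommRel : A → A → Prop
  | P_P (i j : I) (n m : ℕ) (l : AffWeight I) :
      PQCommRel ((opP c g i n * opP c g j m) l) ((opP c g j m * opP c g i n) l)
  | P_P1 (i j : I) (n m : ℕ) (l : AffWeight I) :
      PQCommRel ((opP c g i n * opP1 c g j m) l) ((opP1 c g j m * opP c g i n) l)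
  | P1_P1 (i j : I) (n m : ℕ) (l : AffWeight I) :
      PQCommRel ((opP1 c g i n * opP1 c g j m) l) ((opP1 c g j m * opP1 c g i n) l)
  | Q_Q (i j : I) (n m : ℕ) (l : AffWeight I) :
      PQCommRel ((opQ c g i n * opQ c g j m) l) ((opQ c g j m * opQ c g i n) l)
  | Q_Q1 (i j : I) (n m : ℕ) (l : AffWeight I) :
      PQCommRel ((opQ c g i n * opQ1 c g j m) l) ((opQ1 c g j m * opQ c g i n) l)
  | Q1_Q1 (i j : I) (n m : ℕ) (l : AffWeight I) :
      PQCommRel ((opQ1 c g i n * opQ1 c g j m) l) ((opQ1 c g j m * opQ1 c g i n) l)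

/-- The relations between `P`, `Q` and `E`, `F`. -/
inductive PQEFRel : A → A → Prop
  | QE_zero (i : I) (b : ℤ) (l : AffWeight I) :
      PQEFRel (q ^ c • ((opQb q c g i 1 * opE G c g i b) l - (opE G c g i b * opQb q c g i 1) l))
        (qint q 2 • opE G c g i (b + 1) l)
  | QE (i : I) (a : ℕ) (ha : 0 < a) (b : ℤ) (l : AffWeight I) :
      PQEFRel (q ^ c • ((opQb q c g i (a + 1) * opE G c g i b) l
          - (opE G c g i b * opQb q c g i (a + 1)) l))
        (q ^ 2 • (opQb q c g i a * opE G c g i (b + 1)) l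
          - (q ^ 2)⁻¹ • (opE G c g i (b + 1) * opQb q c g i a) l)
  | QF_zero (i : I) (b : ℤ) (l : AffWeight I) :
      PQEFRel ((opQb q c g i 1 * opF G c g i b) l - (opF G c g i b * opQb q c g i 1) l)
        (-(qint q 2 • opF G c g i (b + 1) l))
  | QF (i : I) (a : ℕ) (ha : 0 < a) (b : ℤ) (l : AffWeight I) :
      PQEFRel ((opQb q c g i (a + 1) * opF G c g i b) l - (opF G c g i b * opQb q c g i (a + 1)) l)
        ((q ^ 2)⁻¹ • (opQb q c g i a * opF G c g i (b + 1)) l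
          - q ^ 2 • (opF G c g i (b + 1) * opQb q c g i a) l)
  | PE_zero (i : I) (b : ℤ) (l : AffWeight I) :
      PQEFRel ((opPb q c g i 1 * opE G c g i (b + 1)) l - (opE G c g i (b + 1) * opPb q c g i 1) l)
        (qint q 2 • opE G c g i b l)
  | PE (i : I) (a : ℕ) (ha : 0 < a) (b : ℤ) (l : AffWeight I) :
      PQEFRel ((opPb q c g i (a + 1) * opE G c g i (b + 1)) l
          - (opE G c g i (b + 1) * opPb q c g i (a + 1)) l)
        ((q ^ 2)⁻¹ • (opPb q c g i a * opE G c g i b) l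
          - q ^ 2 • (opE G c g i b * opPb q c g i a) l)
  | PF_zero (i : I) (b : ℤ) (l : AffWeight I) :
      PQEFRel ((q ^ c)⁻¹ • ((opPb q c g i 1 * opF G c g i (b + 1)) l
          - (opF G c g i (b + 1) * opPb q c g i 1) l))
        (-(qint q 2 • opF G c g i b l))
  | PF (i : I) (a : ℕ) (ha : 0 < a) (b : ℤ) (l : AffWeight I) :
      PQEFRel ((q ^ c)⁻¹ • ((opPb q c g i (a + 1) * opF G c g i (b + 1)) l
          - (opF G c g i (b + 1) * opPb q c g i (a + 1)) l))
        (q ^ 2 • (opPb q c g i a * opF G c g i b) l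
          - (q ^ 2)⁻¹ • (opF G c g i b * opPb q c g i a) l)
  | adj_QE_zero (i j : I) (h : G.Adj i j) (b : ℤ) (l : AffWeight I) :
      PQEFRel (q ^ c • ((opQb q c g j 1 * opE G c g i b) l - (opE G c g i b * opQb q c g j 1) l))
        (-(opE G c g i (b + 1) l))
  | adj_QE (i j : I) (h : G.Adj i j) (a : ℕ) (ha : 0 < a) (b : ℤ) (l : AffWeight I) :
      PQEFRel (q ^ c • ((opQb q c g j (a + 1) * opE G c g i b) l
          - (opE G c g i b * opQb q c g j (a + 1)) l))
        (-(q • (opE G c g i (b + 1) * opQb q c g j a) l)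
          + q⁻¹ • (opQb q c g j a * opE G c g i (b + 1)) l)
  | adj_QF_zero (i j : I) (h : G.Adj i j) (b : ℤ) (l : AffWeight I) :
      PQEFRel ((opQb q c g j 1 * opF G c g i b) l - (opF G c g i b * opQb q c g j 1) l)
        (opF G c g i (b + 1) l)
  | adj_QF (i j : I) (h : G.Adj i j) (a : ℕ) (ha : 0 < a) (b : ℤ) (l : AffWeight I) :
      PQEFRel ((opQb q c g j (a + 1) * opF G c g i b) l - (opF G c g i b * opQb q c g j (a + 1)) l)
        (-(q⁻¹ • (opF G c g i (b + 1) * opQb q c g j a) l)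
          + q • (opQb q c g j a * opF G c g i (b + 1)) l)
  | adj_PE_zero (i j : I) (h : G.Adj i j) (b : ℤ) (l : AffWeight I) :
      PQEFRel ((opPb q c g j 1 * opE G c g i (b + 1)) l - (opE G c g i (b + 1) * opPb q c g j 1) l)
        (-(opE G c g i b l))
  | adj_PE (i j : I) (h : G.Adj i j) (a : ℕ) (ha : 0 < a) (b : ℤ) (l : AffWeight I) :
      PQEFRel ((opPb q c g j (a + 1) * opE G c g i (b + 1)) l
          - (opE G c g i (b + 1) * opPb q c g j (a + 1)) l)
        (-(q⁻¹ • (opE G c g i b * opPb q c g j a) l)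
          + q • (opPb q c g j a * opE G c g i b) l)
  | adj_PF_zero (i j : I) (h : G.Adj i j) (b : ℤ) (l : AffWeight I) :
      PQEFRel ((q ^ c)⁻¹ • ((opPb q c g j 1 * opF G c g i (b + 1)) l
          - (opF G c g i (b + 1) * opPb q c g j 1) l))
        (opF G c g i b l)
  | adj_PF (i j : I) (h : G.Adj i j) (a : ℕ) (ha : 0 < a) (b : ℤ) (l : AffWeight I) :
      PQEFRel ((q ^ c)⁻¹ • ((opPb q c g j (a + 1) * opF G c g i (b + 1)) l
          - (opF G c g i (b + 1) * opPb q c g j (a + 1)) l))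
        (-(q • (opF G c g i b * opPb q c g j a) l)
          + q⁻¹ • (opPb q c g j a * opF G c g i b) l)
  | far_QE (i j : I) (hne : i ≠ j) (h : ¬ G.Adj i j) (a : ℕ) (ha : 0 < a) (b : ℤ) (l : AffWeight I) :
      PQEFRel ((opQb q c g j a * opE G c g i b) l) ((opE G c g i b * opQb q c g j a) l)
  | far_QF (i j : I) (hne : i ≠ j) (h : ¬ G.Adj i j) (a : ℕ) (ha : 0 < a) (b : ℤ) (l : AffWeight I) :
      PQEFRel ((opQb q c g j a * opF G c g i b) l) ((opF G c g i b * opQb q c g j a) l)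
  | far_PE (i j : I) (hne : i ≠ j) (h : ¬ G.Adj i j) (a : ℕ) (ha : 0 < a) (b : ℤ) (l : AffWeight I) :
      PQEFRel ((opPb q c g j a * opE G c g i b) l) ((opE G c g i b * opPb q c g j a) l)
  | far_PF (i j : I) (hne : i ≠ j) (h : ¬ G.Adj i j) (a : ℕ) (ha : 0 < a) (b : ℤ) (l : AffWeight I) :
      PQEFRel ((opPb q c g j a * opF G c g i b) l) ((opF G c g i b * opPb q c g j a) l)

/-- The full set of relations of the idempotented algebra. -/
inductive FullRel : A → A → Prop
  | weight (x y : A) (h : WeightRel G c g x y) : FullRel x y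
  | pqComm (x y : A) (h : PQCommRel c g x y) : FullRel x y
  | heis (x y : A) (h : HeisRel G q c g x y) : FullRel x y
  | pqef (x y : A) (h : PQEFRel G q c g x y) : FullRel x y
  | ef (x y : A) (h : EFRel G q c g x y) : FullRel x y
  | EE (i : I) (m n : ℤ) (l : AffWeight I) :
      FullRel ((opE G c g i m * opE G c g i (n - 1)) l + (opE G c g i n * opE G c g i (m - 1)) l)
        (q ^ 2 • ((opE G c g i (m - 1) * opE G c g i n) l + (opE G c g i (n - 1) * opE G c g i m) l))
  | FF (i : I) (m n : ℤ) (l : AffWeight I) :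
      FullRel ((opF G c g i (n - 1) * opF G c g i m) l + (opF G c g i (m - 1) * opF G c g i n) l)
        (q ^ 2 • ((opF G c g i n * opF G c g i (m - 1)) l + (opF G c g i m * opF G c g i (n - 1)) l))
  | EE_adj (i j : I) (h : G.Adj i j) (m n : ℤ) (l : AffWeight I) :
      FullRel ((opE G c g i m * opE G c g j (n - 1)) l + (opE G c g j n * opE G c g i (m - 1)) l)
        (q⁻¹ • ((opE G c g j (n - 1) * opE G c g i m) l + (opE G c g i (m - 1) * opE G c g j n) l))
  | FF_adj (i j : I) (h : G.Adj i j) (m n : ℤ) (l : AffWeight I) :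
      FullRel ((opF G c g i (m - 1) * opF G c g j n) l + (opF G c g j (n - 1) * opF G c g i m) l)
        (q⁻¹ • ((opF G c g j n * opF G c g i (m - 1)) l + (opF G c g i m * opF G c g j (n - 1)) l))
  | far (x y : A) (h : FarRel G c g x y) : FullRel x y
  | serreE (i j : I) (h : G.Adj i j) (n : ℤ) (m : Fin 2 → ℤ) (l : AffWeight I) :
      FullRel
        (∑ s : Equiv.Perm (Fin 2),
          ((opE G c g j n * opE G c g i (m (s 0)) * opE G c g i (m (s 1))) l
            + (opE G c g i (m (s 0)) * opE G c g i (m (s 1)) * opE G c g j n) l))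
        (∑ s : Equiv.Perm (Fin 2),
          qint q 2 • (opE G c g i (m (s 0)) * opE G c g j n * opE G c g i (m (s 1))) l)
  | serreF (i j : I) (h : G.Adj i j) (n : ℤ) (m : Fin 2 → ℤ) (l : AffWeight I) :
      FullRel
        (∑ s : Equiv.Perm (Fin 2),
          ((opF G c g j n * opF G c g i (m (s 0)) * opF G c g i (m (s 1))) l
            + (opF G c g i (m (s 0)) * opF G c g i (m (s 1)) * opF G c g j n) l))
        (∑ s : Equiv.Perm (Fin 2),
          qint q 2 • (opF G c g i (m (s 0)) * opF G c g j n * opF G c g i (m (s 1))) l)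

end Operators

/-! ### The presented algebras

They are presented here as unital algebras: this is the idempotented (non-unital) algebra with a unit
adjoined, since no relation involves the unit. The idempotented algebra itself is the non-unital
subalgebra spanned by the nonempty products of generators. -/

section Presented

variable {I : Type u} [DecidableEq I] (G : SimpleGraph I) [DecidableRel G.Adj]
variable {K : Type v} [Field K] (q : K) (c : ℕ)

/-- The algebra with all generators and the relations `r`. -/
abbrev Presented (r : FreeAlgebra K (Gen I) → FreeAlgebra K (Gen I) → Prop) : Type (max u v) :=
  RingQuot r

/-- The generators of a presented algebra. -/
def Presented.gen (r : FreeAlgebra K (Gen I) → FreeAlgebra K (Gen I) → Prop) (x : Gen I) :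
    Presented r :=
  RingQuot.mkAlgHom K r (FreeAlgebra.ι K x)

/-- Relations of the full presentation, in the free algebra. -/
def fullRels : FreeAlgebra K (Gen I) → FreeAlgebra K (Gen I) → Prop :=
  FullRel G q c (FreeAlgebra.ι K)

/-- Relations of the reduced presentation, in the free algebra. -/
def reducedRels : FreeAlgebra K (Gen I) → FreeAlgebra K (Gen I) → Prop :=
  ReducedRel G q c (FreeAlgebra.ι K)

/-- Relations of the reduced presentation without the Serre relation, in the free algebra. -/
def baseRels : FreeAlgebra K (Gen I) → FreeAlgebra K (Gen I) → Prop :=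
  BaseRel G q c (FreeAlgebra.ι K)

end Presented

/-! ### Weight modules and integrable modules -/

section Modules

variable {I : Type u} [DecidableEq I] (G : SimpleGraph I) [DecidableRel G.Adj]
variable {K : Type v} [Field K]
variable {V : Type w} [AddCommGroup V] [Module K V] (g : Gen I → Module.End K V)

/-- The weight space `V(l)`: the image of `1_l`. -/
def weightSpace (l : AffWeight I) : Submodule K V := LinearMap.range (g (.one l))

/-- `V` is the direct sum of its weight spaces. -/
def IsWeightModule [Fintype I] : Prop := DirectSum.IsInternal (weightSpace g)

/-- Integrability: for every weight `l` and every real root `a`, the weight space `V(l + n a)` is zero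
for all sufficiently large and all sufficiently small integers `n`. -/
def IsIntegrable [Fintype I] : Prop :=
  ∀ l a : AffWeight I, IsRealRoot G a → ∃ N : ℤ, ∀ n : ℤ, N ≤ |n| → weightSpace g (l + n • a) = ⊥

end Modules

/-! ### Formal series and the Drinfeld realization -/

section Series

variable {A : Type w} [Ring A]

/-- `exp H` for a formal power series `H` without constant term. -/
noncomputable def expSeries (K : Type v) [Field K] [Algebra K A] (H : PowerSeries A) : PowerSeries A :=
  PowerSeries.mk fun n =>
    ∑ k ∈ Finset.range (n + 1), ((k.factorial : K)⁻¹) • PowerSeries.coeff n (H ^ k)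

/-- A formal distribution in `z` and `w`: `F m n` is the coefficient of `z^m w^n`. -/
abbrev Dist (A : Type w) : Type w := ℤ → ℤ → A

/-- `(a z + b w) F(z, w)`. -/
def lin (a b : A) (F : Dist A) : Dist A := fun m n => a * F (m - 1) n + b * F m (n - 1)

/-- `X(z) Y(w)`; a formal distribution in one variable is the family of its coefficients. -/
def zw (X Y : ℤ → A) : Dist A := fun m n => X m * Y n

/-- `Y(w) X(z)`. -/
def wz (Y X : ℤ → A) : Dist A := fun m n => Y n * X m

/-- `X(t z)`. -/
def dilate (t : Aˣ) (X : ℤ → A) : ℤ → A := fun n => ((t ^ n : Aˣ) : A) * X n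

/-- `δ(t w z⁻¹) X(w)`, where `δ(x) = ∑ xⁿ`. -/
def deltaWZ (t : Aˣ) (X : ℤ → A) : Dist A := fun m n => ((t ^ (-m) : Aˣ) : A) * X (m + n)

/-- `δ(t z w⁻¹) X(z)`, where `δ(x) = ∑ xⁿ`. -/
def deltaZW (t : Aˣ) (X : ℤ → A) : Dist A := fun m n => ((t ^ (-n) : Aˣ) : A) * X (m + n)

/-- The generators of the Drinfeld realization, as elements of an algebra: `e_{i,r}`, `f_{i,r}`,
`h_{i,m}` (only `m ≠ 0` is used), `q^x` for `x` in the dual `X*` of the weight lattice (in the basis of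
simple coroots, dual to the fundamental weights), `q^d` and `q^(c/2)`. The last two come with their
inverses. -/
structure DrinfeldGens (I : Type u) (A : Type w) [Ring A] where
  e : I → ℤ → A
  f : I → ℤ → A
  h : I → ℤ → A
  qh : (I → ℤ) → A
  qd : Aˣ
  qc2 : Aˣ

namespace DrinfeldGens

variable {I : Type u} [DecidableEq I] (G : SimpleGraph I) [DecidableRel G.Adj]
variable {K : Type v} [Field K] [Algebra K A] (q : K) (D : DrinfeldGens I A)

/-- The current `x_i^±(z)`: `x_i^+(z) = ∑ e_{i,n} z⁻ⁿ`, `x_i^-(z) = ∑ f_{i,n} z⁻ⁿ`. -/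
def x (ε : ℤˣ) (i : I) : ℤ → A := fun n => if ε = 1 then D.e i (-n) else D.f i (-n)

/-- The power series `s (q - q⁻¹) ∑_{n > 0} h_{i, s n} tⁿ`, for a sign `s`. -/
noncomputable def hSeries (s : ℤˣ) (i : I) : PowerSeries A :=
  PowerSeries.mk fun n =>
    if n = 0 then 0 else (((s : ℤ) : K) * (q - q⁻¹)) • D.h i ((s : ℤ) * (n : ℤ))

/-- The coefficients of `ψ_i^±(z) = q^{± h_i} exp(±(q - q⁻¹) ∑_{n > 0} h_{i, ± n} z^{∓ n})`. -/
noncomputable def psi (s : ℤˣ) (i : I) : ℤ → A := fun n =>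
  if 0 ≤ -((s : ℤ) * n) then
    D.qh (Pi.single i (s : ℤ)) *
      PowerSeries.coeff (-((s : ℤ) * n)).toNat (expSeries K (D.hSeries q s i))
  else 0

/-- A scalar as an element of `A`. -/
abbrev sc (A : Type w) [Ring A] [Algebra K A] (t : K) : A := algebraMap K A t

/-- `q^(n c)` as an element of `A`. -/
def qc (n : ℤ) : A := ((D.qc2 ^ (2 * n) : Aˣ) : A)

/-- `q^(n c / 2)` as an element of `A`. -/
def qcHalf (n : ℤ) : A := ((D.qc2 ^ n : Aˣ) : A)

/-- The defining relations of the Drinfeld realization. -/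
structure Relations : Prop where
  central_e : ∀ i r, Commute (D.qc2 : A) (D.e i r)
  central_f : ∀ i r, Commute (D.qc2 : A) (D.f i r)
  central_h : ∀ i m, m ≠ 0 → Commute (D.qc2 : A) (D.h i m)
  central_qh : ∀ y, Commute (D.qc2 : A) (D.qh y)
  central_qd : Commute (D.qc2 : A) (D.qd : A)
  qh_zero : D.qh 0 = 1
  qh_add : ∀ y y', D.qh y * D.qh y' = D.qh (y + y')
  qh_h : ∀ y i m, m ≠ 0 → Commute (D.qh y) (D.h i m)
  psi_psi : ∀ (s : ℤˣ) (i j : I),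
    zw (D.psi q s i) (D.psi q s j) = wz (D.psi q s j) (D.psi q s i)
  /-- The two sides are series in `z` and `w⁻¹`, on which the two denominators act injectively, so that
  the relation with the fraction expanded in powers of `z w⁻¹` is the one with cleared denominators. -/
  psi_minus_plus : ∀ i j : I,
    lin 1 (-(sc A (q ^ (cartan G i j)) * D.qc 1)) (lin 1 (-(sc A (q ^ (-cartan G i j)) * D.qc (-1)))
        (zw (D.psi q (-1) i) (D.psi q 1 j))) =
      lin 1 (-(sc A (q ^ (-cartan G i j)) * D.qc 1)) (lin 1 (-(sc A (q ^ (cartan G i j)) * D.qc (-1)))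
        (wz (D.psi q 1 j) (D.psi q (-1) i)))
  qd_qh : ∀ y, Commute (D.qd : A) (D.qh y)
  qd_h : ∀ i m, m ≠ 0 → (D.qd : A) * D.h i m * ((D.qd⁻¹ : Aˣ) : A) = q ^ m • D.h i m
  qd_e : ∀ i r, (D.qd : A) * D.e i r * ((D.qd⁻¹ : Aˣ) : A) = q ^ r • D.e i r
  qd_f : ∀ i r, (D.qd : A) * D.f i r * ((D.qd⁻¹ : Aˣ) : A) = q ^ r • D.f i r
  psi_x : ∀ (s ε : ℤˣ) (i j : I),
    lin (D.qcHalf ((ε * s : ℤˣ) : ℤ)) (-sc A (q ^ ((ε : ℤ) * cartan G i j)))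
        (zw (D.psi q s j) (D.x ε i)) =
      lin (sc A (q ^ ((ε : ℤ) * cartan G i j)) * D.qcHalf ((ε * s : ℤˣ) : ℤ)) (-1)
        (wz (D.x ε i) (D.psi q s j))
  x_plus_minus : ∀ i j : I,
    zw (D.x 1 i) (D.x (-1) j) - wz (D.x (-1) j) (D.x 1 i) =
      if i = j then
        (q - q⁻¹)⁻¹ • (deltaWZ (D.qc2 ^ 2) (dilate D.qc2 (D.psi q 1 i))
          - deltaZW (D.qc2 ^ 2) (dilate D.qc2 (D.psi q (-1) i)))
      else 0
  x_x_same : ∀ (ε : ℤˣ) (i : I),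
    lin 1 (-sc A (q ^ (2 * (ε : ℤ)))) (zw (D.x ε i) (D.x ε i)) =
      lin (sc A (q ^ (2 * (ε : ℤ)))) (-1) (wz (D.x ε i) (D.x ε i))
  x_x_adj : ∀ (ε : ℤˣ) (i j : I), cartan G i j = -1 →
    lin 1 (-sc A (q ^ (-(ε : ℤ)))) (zw (D.x ε i) (D.x ε j)) =
      lin (sc A (q ^ (-(ε : ℤ)))) (-1) (wz (D.x ε j) (D.x ε i))
  /-- The coefficient of `z_1^{m_1} ⋯ z_N^{m_N} w^n` in the Serre relation, `N = 1 - ⟨i, j⟩`. -/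
  serre : ∀ (ε : ℤˣ) (i j : I), cartan G i j ≤ 0 → ∀ (N : ℕ), (N : ℤ) = 1 - cartan G i j →
    ∀ (m : Fin N → ℤ) (n : ℤ),
    ∑ σ : Equiv.Perm (Fin N), ∑ s ∈ Finset.range (N + 1),
      ((-1) ^ s * qbinom q N s) •
        (((List.ofFn fun k => D.x ε i (m (σ k))).take s).prod * D.x ε j n *
          ((List.ofFn fun k => D.x ε i (m (σ k))).drop s).prod) = 0

end DrinfeldGens

end Series

section Correspondence

variable {I : Type u} [Fintype I]
variable {K : Type v} [Field K]
variable {V : Type w} [AddCommGroup V] [Module K V]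

/-- The power series `t ∑_{n > 0} (h_{i, s n} / [n]) zⁿ`, for signs `s` and `t`. -/
noncomputable def halfVertexSeries (q : K) (D : DrinfeldGens I (Module.End K V)) (s t : ℤˣ) (i : I) :
    PowerSeries (Module.End K V) :=
  PowerSeries.mk fun n =>
    if n = 0 then 0 else (((t : ℤ) : K) * (qint q (n : ℤ))⁻¹) • D.h i ((s : ℤ) * (n : ℤ))

/-- The correspondence, on a weight module, between the generators `g` of the idempotented algebra and
the generators `D` of the Drinfeld realization. Here `p = q^(1/2)`:
`E_{i,r} = (-q)^r q^(r c/2) e_{i,r}` and `F_{i,r} = (-q)^r q^(r c/2) f_{i,r}`; the `Q`s and `P`s are the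
coefficients of the halves of vertex operators; `q^x` acts on the weight space `V(l)` by `q^⟨x, l⟩`;
`q^d` acts on it by `q^⌊k/c⌋`, where `k` is the coefficient of `δ` in `l` (all weights
in question shift `k` by multiples of `c`); and `q^(c/2)` is a scalar. -/
structure Corresponds (q p : K) (c : ℕ) (g : Gen I → Module.End K V)
    (D : DrinfeldGens I (Module.End K V)) : Prop where
  e : ∀ i r l, g (.E i r l) = ((-q) ^ r * p ^ (r * (c : ℤ))) • (D.e i r * g (.one l))
  f : ∀ i r l, g (.F i r l) = ((-q) ^ r * p ^ (r * (c : ℤ))) • (D.f i r * g (.one l))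
  Q : ∀ i n l, g (.Q i n l) =
    PowerSeries.coeff n (expSeries K (halfVertexSeries q D 1 1 i)) * g (.one l)
  Q1 : ∀ i n l, (-1 : K) ^ n • g (.Q1 i n l) =
    PowerSeries.coeff n (expSeries K (halfVertexSeries q D 1 (-1) i)) * g (.one l)
  P : ∀ i n l, g (.P i n l) =
    PowerSeries.coeff n (expSeries K (halfVertexSeries q D (-1) 1 i)) * g (.one l)
  P1 : ∀ i n l, (-1 : K) ^ n • g (.P1 i n l) =
    PowerSeries.coeff n (expSeries K (halfVertexSeries q D (-1) (-1) i)) * g (.one l)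
  qh : ∀ (y : I → ℤ) (l : AffWeight I),
    D.qh y * g (.one l) = q ^ (∑ i, y i * pair l i) • g (.one l)
  qd : ∀ l : AffWeight I,
    (D.qd : Module.End K V) * g (.one l) = q ^ (l.2.2 / (c : ℤ)) • g (.one l)
  qc2 : (D.qc2 : Module.End K V) = p ^ c • (1 : Module.End K V)

end Correspondence

end QAff

set_option linter.unusedSectionVars false
set_option linter.unusedSimpArgs false

/-! All relations are first proved for an abstract system of operators, `Currents`: series E_i, F_i
and two Cartan series ψ_i, φ_i which satisfy the reduced relations, the central element acting by a
scalar t. A weight module over the reduced algebra is such a system with t = q^c (`realize`).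

The engine is a pair of shift operators. Stripped of their group-like factors, ψ_{j,1} and φ_{j,-1}
become `up j` and `down j`, and the bracket with them moves the index of E_i by +1 or -1, up to a
scalar (`upE`). For i = j this follows by bracketing E_{i,m+1}E_{i,m} = q²E_{i,m}E_{i,m+1} with
F_{i,-m}. For joined vertices the one quadratic relation that is given yields it at a single
position s. Bracketing with `down i`, whose bracket with `up j` is a scalar by the Heisenberg
relation, spreads it to all m ≤ s. For m > s let Z be the defect of the shift rule (`upE_of_gt`): it
commutes with F_{i,-m}, because the symmetric argument for F covers just these indices, and it
q²-commutes with E_{i,m}, because of the Serre relation. Bracketing the latter with F_{i,-m} gives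
(1 - q⁴)Z = 0.

Once shifts are available, relations spread from one position to all. Quadratic relations follow by
symmetry when i = j (`quadE_self`), and by inverting a 2 × 2 system when i and j are joined
(`quadE_adj`); the Serre relation is polarized in the same way (`serreE`). Bracketing the quadratic
relations with F gives the Cartan–E relations (`psiE`), and combining these with [E, F] gives the
relations between the Cartan series (`ψ_comm`, `φψ_two_step`). The symmetries `flip` and `swap`
produce the remaining versions. The Q's and P's are polynomials in the coefficients of ψ and φ
(`mem_subalgebra_of_convolution`), hence commute.

To return from modules to the algebra, let it act on the left ideal generated by the idempotents
1_λ. This is a weight module, and applying x to 1_λ recovers x1_λ. Each relation missing from the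
reduced list lives over one 1_λ, so it holds in the algebra (`holds_fullRel_reduced`).

For Drinfeld's generators, take h_{i,n}/[n] to be the coefficients of the logarithm of the series of
the Q's. Since (q - q⁻¹)[n] = qⁿ - q⁻ⁿ, the exponential in ψ_i is the Q-series at qz times its
inverse at q⁻¹z, whose coefficients are multiples of Q^[1ⁿ] (`exists_vertex_log`). Drinfeld's
relations are then the current relations, coefficient by coefficient.

On integrable modules, the difference S of the two sides of the Serre relation commutes with the
lowering operator F_{i,-m} of a copy of U_q(sl₂) and raises its weights by 3. On bounded strings
such an operator vanishes (`Sl2String.intertwiner_eq_zero`). -/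

namespace QAff

open MulOpposite

/-! ### Commutators as derivations -/

/-- The derivation `y ↦ y x - x y`. -/
def rder (K : Type*) [Field K] {R : Type*} [Ring R] [Algebra K R] (x : R) : R →ₗ[K] R :=
  LinearMap.mulRight K x - LinearMap.mulLeft K x

section rder

variable {K : Type*} [Field K] {R : Type*} [Ring R] [Algebra K R]

theorem rder_apply (x y : R) : rder K x y = y * x - x * y := rfl

theorem rder_mul (x y z : R) : rder K x (y * z) = y * rder K x z + rder K x y * z := by
  simp only [rder_apply]; noncomm_ring

theorem rder_jacobi (x y z : R) :
    rder K x (rder K y z) = rder K y (rder K x z) + rder K (rder K x y) z := by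
  simp only [rder_apply]; noncomm_ring

theorem rder_neg_swap (x y : R) : rder K x y = -rder K y x := by
  simp only [rder_apply, neg_sub]

theorem rder_smul_left (a : K) (x y : R) : rder K (a • x) y = a • rder K x y := by
  simp only [rder_apply, mul_smul_comm, smul_mul_assoc, smul_sub]

theorem rder_eq_zero {x y : R} : rder K x y = 0 ↔ y * x = x * y := by
  rw [rder_apply, sub_eq_zero]

end rder

/-! ### Systems of currents and their symmetries -/

/-- The currents of a quantum affine algebra, as operators: `E`, `F`, and the coefficients `ψ`, `φ` of
the two Cartan currents, with a reduced set of relations. Here `t` is the value of the central element,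
and the quadratic relations for adjacent vertices are required at one position `s` only. -/
structure Currents {I : Type*} [DecidableEq I] (G : SimpleGraph I) [DecidableRel G.Adj]
    {K : Type*} [Field K] (q t : K) (s : ℤ) (R : Type*) [Ring R] [Algebra K R] where
  E : I → ℤ → R
  F : I → ℤ → R
  ψ : I → ℤ → R
  φ : I → ℤ → R
  ψ_neg : ∀ i n, n < 0 → ψ i n = 0
  φ_pos : ∀ i n, 0 < n → φ i n = 0
  ψφ : ∀ i, ψ i 0 * φ i 0 = 1
  φψ : ∀ i, φ i 0 * ψ i 0 = 1
  kE : ∀ j i m, ψ j 0 * E i m = q ^ cartan G j i • (E i m * ψ j 0)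
  kF : ∀ j i m, ψ j 0 * F i m = q ^ (-cartan G j i) • (F i m * ψ j 0)
  kψ : ∀ j i m, ψ j 0 * ψ i m = ψ i m * ψ j 0
  kφ : ∀ j i m, ψ j 0 * φ i m = φ i m * ψ j 0
  EF : ∀ i a b, E i a * F i b - F i b * E i a =
    (q - q⁻¹)⁻¹ • (t ^ a • ψ i (a + b) - t ^ b • φ i (a + b))
  EF_ne : ∀ i j, i ≠ j → ∀ a b, E i a * F j b = F j b * E i a
  EE : ∀ i n, E i (n + 1) * E i n = q ^ 2 • (E i n * E i (n + 1))
  FF : ∀ i n, F i n * F i (n + 1) = q ^ 2 • (F i (n + 1) * F i n)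
  EE_adj : ∀ i j, G.Adj i j → E i (s + 1) * E j s + E j (s + 1) * E i s =
    q⁻¹ • (E j s * E i (s + 1) + E i s * E j (s + 1))
  FF_adj : ∀ i j, G.Adj i j → F j (-s) * F i (-s - 1) + F i (-s) * F j (-s - 1) =
    q • (F i (-s - 1) * F j (-s) + F j (-s - 1) * F i (-s))
  EE_far : ∀ i j, i ≠ j → ¬ G.Adj i j → ∀ m n, E i m * E j n = E j n * E i m
  FF_far : ∀ i j, i ≠ j → ¬ G.Adj i j → ∀ m n, F i m * F j n = F j n * F i m
  EEE : ∀ i j, G.Adj i j → ∀ m n, E j n * E i m * E i m + E i m * E i m * E j n =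
    (q + q⁻¹) • (E i m * E j n * E i m)
  FFF : ∀ i j, G.Adj i j → ∀ m n, F j n * F i m * F i m + F i m * F i m * F j n =
    (q + q⁻¹) • (F i m * F j n * F i m)
  -- Of the Heisenberg relations between ψ and φ only the first is kept, with an unspecified scalar:
  -- it is needed only to know that `up` and `down` have a central bracket.
  ψφ_heis : ∀ i j, ∃ x : K, ψ j 1 * φ i (-1) - φ i (-1) * ψ j 1 = x • (ψ j 0 * φ i 0)

section cartan

variable {I : Type*} [DecidableEq I] (G : SimpleGraph I) [DecidableRel G.Adj]

theorem cartan_self (i : I) : cartan G i i = 2 := by simp [cartan]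

theorem cartan_adj {i j : I} (h : G.Adj i j) : cartan G i j = -1 := by
  simp [cartan, h, h.ne]

theorem cartan_far {i j : I} (hne : i ≠ j) (h : ¬ G.Adj i j) : cartan G i j = 0 := by
  simp [cartan, h, hne]

theorem cartan_symm (i j : I) : cartan G i j = cartan G j i := by
  simp only [cartan, eq_comm (a := i), G.adj_comm i j]

end cartan

namespace Currents

variable {I : Type*} [DecidableEq I] {G : SimpleGraph I} [DecidableRel G.Adj]
variable {K : Type*} [Field K] {q t : K} {s : ℤ} {R : Type*} [Ring R] [Algebra K R]

theorem φk (X : Currents G q t s R) (j i : I) (m : ℤ) : X.φ j 0 * X.ψ i m = X.ψ i m * X.φ j 0 := by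
  calc X.φ j 0 * X.ψ i m = X.φ j 0 * (X.ψ i m * X.ψ j 0) * X.φ j 0 := by
        rw [mul_assoc, mul_assoc, X.ψφ, mul_one]
    _ = _ := by rw [← X.kψ, ← mul_assoc, X.φψ, one_mul]

theorem φkφ (X : Currents G q t s R) (j i : I) (m : ℤ) : X.φ j 0 * X.φ i m = X.φ i m * X.φ j 0 := by
  calc X.φ j 0 * X.φ i m = X.φ j 0 * (X.φ i m * X.ψ j 0) * X.φ j 0 := by
        rw [mul_assoc, mul_assoc, X.ψφ, mul_one]
    _ = _ := by rw [← X.kφ, ← mul_assoc, X.φψ, one_mul]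

theorem φE (X : Currents G q t s R) (j i : I) (m : ℤ) :
    X.E i m * X.φ j 0 = q ^ cartan G j i • (X.φ j 0 * X.E i m) := by
  calc X.E i m * X.φ j 0 = X.φ j 0 * (X.ψ j 0 * X.E i m) * X.φ j 0 := by
        rw [← mul_assoc, X.φψ, one_mul]
    _ = _ := by
      rw [X.kE, mul_smul_comm, smul_mul_assoc, ← mul_assoc, mul_assoc _ (X.ψ j 0), X.ψφ, mul_one]

theorem φF (X : Currents G q t s R) (j i : I) (m : ℤ) :
    X.F i m * X.φ j 0 = q ^ (-cartan G j i) • (X.φ j 0 * X.F i m) := by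
  calc X.F i m * X.φ j 0 = X.φ j 0 * (X.ψ j 0 * X.F i m) * X.φ j 0 := by
        rw [← mul_assoc, X.φψ, one_mul]
    _ = _ := by
      rw [X.kF, mul_smul_comm, smul_mul_assoc, ← mul_assoc, mul_assoc _ (X.ψ j 0), X.ψφ, mul_one]

theorem smul_inv_comm {a : K} (ha : a ≠ 0) {x y : R} (h : x = a • y) : y = a⁻¹ • x := by
  rw [h, smul_smul, inv_mul_cancel₀ ha, one_smul]

/-- The anti-automorphism `E_{i,r} ↦ E_{i,-r}`, `F_{i,r} ↦ F_{i,-r}`. -/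
def flip (ht : t ≠ 0) (X : Currents G q t s R) : Currents G q t (-s - 1) Rᵐᵒᵖ where
  E i r := op (X.E i (-r))
  F i r := op (X.F i (-r))
  -- Negating indices and reversing products turns the coefficients t^a, t^b of the E–F relation
  -- into t^(-b) for φ and t^(-a) for ψ; the common factor t^(-(a+b)) is absorbed here to restore
  -- the shape of that relation.
  ψ i n := op (t ^ (-n) • X.φ i (-n))
  φ i n := op (t ^ (-n) • X.ψ i (-n))
  ψ_neg i n h := by rw [X.φ_pos _ _ (by omega)]; simp
  φ_pos i n h := by rw [X.ψ_neg _ _ (by omega)]; simp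
  ψφ i := by simp [← op_mul, X.ψφ]
  φψ i := by simp [← op_mul, X.φψ]
  kE j i m := by simp [← op_mul, ← op_smul, X.φE]
  kF j i m := by
    have := X.φF j i (-m)
    simp [← op_mul, ← op_smul, this]
  kψ j i m := by simp [← op_mul, X.φkφ]
  kφ j i m := by simp [← op_mul, X.φk]
  EF i a b := by
    have := X.EF i (-a) (-b)
    rw [← op_mul, ← op_mul, ← op_sub, ← op_smul, ← op_smul, ← op_sub, ← op_smul, op_inj, ← neg_sub,
      this, smul_smul, smul_smul, ← zpow_add₀ ht, ← zpow_add₀ ht, ← neg_add]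
    rw [show a + -(a + b) = -b by ring, show b + -(a + b) = -a by ring, ← smul_neg, neg_sub]
  EF_ne i j h a b := by rw [← op_mul, ← op_mul, X.EF_ne i j h]
  EE i n := by
    have := X.EE i (-n - 1)
    rw [← op_mul, ← op_mul, ← op_smul]
    rw [show -n - 1 + 1 = -n by ring, show -n - 1 = -(n + 1) by ring] at this
    rw [this]
  FF i n := by
    have := X.FF i (-n - 1)
    rw [← op_mul, ← op_mul, ← op_smul]
    rw [show -n - 1 + 1 = -n by ring, show -n - 1 = -(n + 1) by ring] at this
    rw [this]
  EE_adj i j h := by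
    have := X.EE_adj j i h.symm
    simp only [← op_mul, ← op_smul, ← op_add, op_inj]
    rw [show -(-s - 1 + 1) = s by ring, show -(-s - 1) = s + 1 by ring, this]
  FF_adj i j h := by
    have := X.FF_adj j i h.symm
    simp only [← op_mul, ← op_smul, ← op_add, op_inj]
    rw [show -(-(-s - 1) - 1) = -s by ring, show -(-(-s - 1)) = -s - 1 by ring, this]
  EE_far i j hne h m n := by simp only [← op_mul]; rw [X.EE_far i j hne h]
  FF_far i j hne h m n := by simp only [← op_mul]; rw [X.FF_far i j hne h]
  EEE i j h m n := by
    have := X.EEE i j h (-m) (-n)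
    simp only [← op_mul, ← op_add, ← op_smul, op_inj, ← mul_assoc] at this ⊢
    rw [add_comm, this]
  FFF i j h m n := by
    have := X.FFF i j h (-m) (-n)
    simp only [← op_mul, ← op_add, ← op_smul, op_inj, ← mul_assoc] at this ⊢
    rw [add_comm, this]
  ψφ_heis i j := by
    obtain ⟨x, hx⟩ := X.ψφ_heis j i
    refine ⟨x, ?_⟩
    simp only [← op_mul, ← op_smul, ← op_sub, op_inj, neg_neg, neg_zero, zpow_zero, one_smul,
      smul_mul_assoc, mul_smul_comm, smul_smul, ← zpow_add₀ ht]
    norm_num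
    rw [hx]

/-- The automorphism `E_{i,r} ↦ F_{i,r}`, `F_{i,r} ↦ E_{i,r}`, which inverts the parameters. -/
def swap (hq0 : q ≠ 0) (ht : t ≠ 0) (X : Currents G q t s R) : Currents G q⁻¹ t⁻¹ (-s - 1) R where
  E i r := X.F i r
  F i r := X.E i r
  -- Replacing t by t⁻¹ exchanges t^a and t^b up to the common factor t^(a+b), which is absorbed
  -- here.
  ψ i n := t ^ n • X.ψ i n
  φ i n := t ^ n • X.φ i n
  ψ_neg i n h := by rw [X.ψ_neg _ _ h, smul_zero]
  φ_pos i n h := by rw [X.φ_pos _ _ h, smul_zero]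
  ψφ i := by simp [X.ψφ]
  φψ i := by simp [X.φψ]
  kE j i m := by simp [X.kF]
  kF j i m := by simp [X.kE]
  kψ j i m := by simp [X.kψ]
  kφ j i m := by simp [X.kφ]
  EF i a b := by
    have h := X.EF i b a
    rw [← neg_sub, h, smul_smul, smul_smul, inv_zpow', inv_zpow', ← zpow_add₀ ht, ← zpow_add₀ ht,
      show -a + (a + b) = b by ring, show -b + (a + b) = a by ring, inv_inv, ← neg_sub q, inv_neg,
      neg_smul, add_comm b a]
  EF_ne i j h a b := (X.EF_ne j i h.symm b a).symm
  EE i n := by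
    rw [X.FF, smul_smul, ← mul_pow, inv_mul_cancel₀ hq0, one_pow, one_smul]
  FF i n := by
    rw [X.EE, smul_smul, ← mul_pow, inv_mul_cancel₀ hq0, one_pow, one_smul]
  EE_adj i j h := by
    have := X.FF_adj j i h.symm
    rw [show -s - 1 + 1 = -s by ring, this, inv_inv]
  FF_adj i j h := by
    have := X.EE_adj j i h.symm
    rw [show -(-s - 1) = s + 1 by ring, show s + 1 - 1 = s by ring, this]
  EE_far i j hne h m n := X.FF_far i j hne h m n
  FF_far i j hne h m n := X.EE_far i j hne h m n
  EEE i j h m n := by rw [X.FFF i j h, inv_inv, add_comm q]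
  FFF i j h m n := by rw [X.EEE i j h, inv_inv, add_comm q]
  ψφ_heis i j := by
    obtain ⟨x, hx⟩ := X.ψφ_heis i j
    refine ⟨x, ?_⟩
    simp only [smul_mul_assoc, mul_smul_comm, smul_smul, ← zpow_add₀ ht]
    norm_num
    rw [hx]

end Currents
end QAff

namespace QAff

/-! ### Genericity and the degree-one Cartan modes -/

/-- The parameters are generic: `q` is not a root of unity, and `t ≠ ±1`. -/
structure Generic {K : Type*} [Field K] (q t : K) : Prop where
  q0 : q ≠ 0
  t0 : t ≠ 0
  q_pow : ∀ n : ℕ, 0 < n → q ^ n ≠ 1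
  t_sq : t ^ 2 ≠ 1

theorem Generic.inv {K : Type*} [Field K] {q t : K} (h : Generic q t) : Generic q⁻¹ t⁻¹ where
  q0 := inv_ne_zero h.q0
  t0 := inv_ne_zero h.t0
  q_pow n hn := by rw [inv_pow]; exact fun h' => h.q_pow n hn (inv_eq_one.1 h')
  t_sq := by rw [inv_pow]; exact fun h' => h.t_sq (inv_eq_one.1 h')

theorem Generic.sub_inv {K : Type*} [Field K] {q t : K} (h : Generic q t) : q - q⁻¹ ≠ 0 := by
  intro h'
  have : q * (q - q⁻¹) = 0 := by rw [h', mul_zero]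
  rw [mul_sub, mul_inv_cancel₀ h.q0, ← sq] at this
  exact h.q_pow 2 (by norm_num) (sub_eq_zero.1 this)

theorem Generic.t_sub_inv {K : Type*} [Field K] {q t : K} (h : Generic q t) : t - t⁻¹ ≠ 0 := by
  intro h'
  have : t * (t - t⁻¹) = 0 := by rw [h', mul_zero]
  rw [mul_sub, mul_inv_cancel₀ h.t0, ← sq] at this
  exact h.t_sq (sub_eq_zero.1 this)

namespace Currents

variable {I : Type*} [DecidableEq I] {G : SimpleGraph I} [DecidableRel G.Adj]
variable {K : Type*} [Field K] {q t : K} {s : ℤ} {R : Type*} [Ring R] [Algebra K R]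

/-- The commutation relation of `ψ_j` and `E_i`, at one coefficient. -/
def PsiE (X : Currents G q t s R) (j i : I) (N m : ℤ) : Prop :=
  X.ψ j (N + 1) * X.E i m - (t⁻¹ * q ^ cartan G j i) • (X.ψ j N * X.E i (m + 1)) =
    q ^ cartan G j i • (X.E i m * X.ψ j (N + 1)) - t⁻¹ • (X.E i (m + 1) * X.ψ j N)

/-- The first nontrivial mode of `ψ_j`, made to have weight a multiple of `δ`. -/
def up (X : Currents G q t s R) (j : I) : R := X.φ j 0 * X.ψ j 1

/-- The first nontrivial mode of `φ_j`, made to have weight a multiple of `δ`. -/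
def down (X : Currents G q t s R) (j : I) : R := X.ψ j 0 * X.φ j (-1)

theorem ψ_eq_up (X : Currents G q t s R) (j : I) : X.ψ j 1 = X.ψ j 0 * X.up j := by
  rw [up, ← mul_assoc, X.ψφ, one_mul]

theorem kE' (hq0 : q ≠ 0) (X : Currents G q t s R) (j i : I) (m : ℤ) :
    X.E i m * X.ψ j 0 = (q ^ cartan G j i)⁻¹ • (X.ψ j 0 * X.E i m) :=
  smul_inv_comm (zpow_ne_zero _ hq0) (X.kE j i m)

/-- At N = 0 only ψ_{j,0} and ψ_{j,1} occur. Cancelling the invertible ψ_{j,0}, which commutes with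
E_i up to a scalar, leaves a statement about an inner derivation, and such statements can be
propagated by the Jacobi identity. -/
theorem psiE_zero_iff (h : Generic q t) (X : Currents G q t s R) (j i : I) (m : ℤ) :
    X.PsiE j i 0 m ↔ rder K (X.E i m) (X.up j) =
      (t⁻¹ * (q ^ cartan G j i - (q ^ cartan G j i)⁻¹)) • X.E i (m + 1) := by
  have ha : q ^ cartan G j i ≠ 0 := zpow_ne_zero _ h.q0
  have key : ∀ x : R, x = 0 ↔ X.ψ j 0 * x = 0 := fun x => ⟨fun hx => by rw [hx, mul_zero],
    fun hx => by rw [← one_mul x, ← X.φψ j, mul_assoc, hx, mul_zero]⟩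
  rw [PsiE, zero_add, X.ψ_eq_up, ← sub_eq_zero, ← sub_eq_zero (a := rder K _ _), key (rder K _ _ - _)]
  refine iff_of_eq (congrArg (· = 0) ?_)
  rw [rder_apply, ← mul_assoc (X.E i m), X.kE' h.q0 j i m, X.kE' h.q0 j i (m + 1)]
  simp only [mul_sub, smul_mul_assoc, mul_smul_comm, smul_smul, mul_assoc]
  match_scalars <;> field_simp <;> ring

theorem rder_F_E (X : Currents G q t s R) (i : I) (a b : ℤ) : rder K (X.F i b) (X.E i a) =
    (q - q⁻¹)⁻¹ • (t ^ a • X.ψ i (a + b) - t ^ b • X.φ i (a + b)) := X.EF i a b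

theorem rder_F_E_ne (X : Currents G q t s R) {i j : I} (hij : i ≠ j) (a b : ℤ) :
    rder K (X.F j b) (X.E i a) = 0 := by
  rw [rder_apply, X.EF_ne i j hij, sub_self]

/-- Bracketing E_{i,m+1}E_{i,m} = q²E_{i,m}E_{i,m+1} with F_{i,-m} replaces one factor at a time by
a Cartan mode. The φ_{i,0} terms cancel by the weight relation and φ_{i,1} = 0, so only ψ_{i,0} and
ψ_{i,1} survive. -/
theorem psiE_self_zero (h : Generic q t) (X : Currents G q t s R) (i : I) (m : ℤ) :
    X.PsiE i i 0 m := by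
  have h1 := congrArg (rder K (X.F i (-m))) (X.EE i m)
  have ht := h.t0
  have hqq := h.sub_inv
  have hT : t ^ m ≠ 0 := zpow_ne_zero _ h.t0
  have hφ := X.φE i i (m + 1)
  rw [cartan_self, zpow_ofNat] at hφ
  rw [PsiE, cartan_self]
  simp only [map_smul, rder_mul, rder_F_E, add_neg_cancel, show m + 1 + -m = 1 by ring,
    X.φ_pos i 1 one_pos, smul_zero, sub_zero, zero_add, zpow_add₀ ht, zpow_neg, zpow_ofNat,
    mul_sub, sub_mul, mul_smul_comm, smul_mul_assoc, smul_sub, smul_add, smul_smul, hφ] at h1 ⊢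
  generalize t ^ m = T at *
  generalize q - q⁻¹ = κ at *
  -- The scalar clears the factor κ⁻¹t^(m+1) with which ψ_{i,1} appears in [E_{i,m+1}, F_{i,-m}].
  have h2 := congrArg (fun x => (κ * T⁻¹ * t⁻¹) • x) h1
  simp only [smul_add, smul_sub, smul_smul] at h2
  linear_combination (norm := skip) h2
  match_scalars <;> field_simp <;> ring

end Currents
end QAff

namespace QAff
namespace Currents
open MulOpposite

variable {I : Type*} [DecidableEq I] {G : SimpleGraph I} [DecidableRel G.Adj]
variable {K : Type*} [Field K] {q t : K} {s : ℤ} {R : Type*} [Ring R] [Algebra K R]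

/-! ### The shift rule -/

/-- `up j` shifts `E_i`. -/
def UpE (X : Currents G q t s R) (j i : I) (m : ℤ) : Prop :=
  rder K (X.up j) (X.E i m) =
    (t⁻¹ * ((q ^ cartan G j i)⁻¹ - q ^ cartan G j i)) • X.E i (m + 1)

theorem upE_iff_psiE (h : Generic q t) (X : Currents G q t s R) (j i : I) (m : ℤ) :
    X.UpE j i m ↔ X.PsiE j i 0 m := by
  rw [X.psiE_zero_iff h, UpE, rder_neg_swap, neg_eq_iff_eq_neg, ← neg_smul]
  rw [show -(t⁻¹ * ((q ^ cartan G j i)⁻¹ - q ^ cartan G j i)) =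
    t⁻¹ * (q ^ cartan G j i - (q ^ cartan G j i)⁻¹) by ring]

/-- The flip sends ψ_{j,1} to t⁻¹φ_{j,-1} and reverses products, so the shift rule for `up`, once
proved for every system of currents, also yields the one for `down`. -/
theorem upE_flip_iff (h : Generic q t) (X : Currents G q t s R) (j i : I) (m : ℤ) :
    (X.flip h.t0).UpE j i m ↔ rder K (X.down j) (X.E i (-m)) =
      (q ^ cartan G j i - (q ^ cartan G j i)⁻¹) • X.E i (-m - 1) := by
  have h1 : (X.flip h.t0).up j = t⁻¹ • op (X.down j) := by
    simp only [up, down, flip, ← op_mul, ← op_smul, neg_zero, zpow_zero, inv_one, one_smul, zpow_neg, zpow_one,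
      smul_mul_assoc, X.kφ]
  have h2 : ∀ x y : R, rder K (op x) (op y) = op (-rder K x y) := fun x y => by
    simp only [rder_apply, ← op_mul, ← op_sub, neg_sub]
  have h3 : ∀ m, (X.flip h.t0).E i m = op (X.E i (-m)) := fun _ => rfl
  rw [UpE, h1, rder_smul_left, h3, h3, h2, ← smul_smul, smul_right_injective _ (inv_ne_zero h.t0) |>.eq_iff,
    ← op_smul, op_inj, neg_eq_iff_eq_neg, ← neg_smul, neg_sub, neg_add, sub_eq_add_neg (-m)]

theorem upE_swap_iff (h : Generic q t) (X : Currents G q t s R) (j i : I) (m : ℤ) :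
    (X.swap h.q0 h.t0).UpE j i m ↔ rder K (X.up j) (X.F i m) =
      (q ^ cartan G j i - (q ^ cartan G j i)⁻¹) • X.F i (m + 1) := by
  have h1 : (X.swap h.q0 h.t0).up j = t • X.up j := by
    simp only [up, swap, zpow_zero, one_smul, zpow_one, mul_smul_comm]
  have h3 : ∀ m, (X.swap h.q0 h.t0).E i m = X.F i m := fun _ => rfl
  rw [UpE, h1, rder_smul_left, h3, h3, inv_inv, ← smul_smul, smul_right_injective _ h.t0 |>.eq_iff,
    inv_zpow, inv_inv]

/-- The degree-zero modes commute with all Cartan modes, so they can be pulled out; they cancel the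
factor ψ_{j,0}φ_{i,0} on the right of the Heisenberg relation. A central bracket means that `up` and
`down` commute as derivations. -/
theorem rder_down_up (X : Currents G q t s R) (i j : I) :
    ∃ x : K, rder K (X.down i) (X.up j) = algebraMap K R x := by
  obtain ⟨x, hx⟩ := X.ψφ_heis i j
  refine ⟨x, ?_⟩
  calc rder K (X.down i) (X.up j) =
      X.φ j 0 * X.ψ i 0 * (X.ψ j 1 * X.φ i (-1) - X.φ i (-1) * X.ψ j 1) := by
        rw [rder_apply, up, down, mul_sub]
        congr 1
        · rw [mul_assoc, ← mul_assoc _ (X.ψ i 0), ← X.kψ, mul_assoc, mul_assoc]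
        · rw [mul_assoc (X.ψ i 0), ← mul_assoc _ (X.φ j 0), ← X.φkφ, mul_assoc, ← mul_assoc (X.ψ i 0),
            ← X.φk, mul_assoc]
    _ = _ := by
        rw [hx, mul_smul_comm, ← mul_assoc, mul_assoc _ _ (X.ψ j 0), ← X.kψ, ← mul_assoc, X.φψ, one_mul,
          X.ψφ, Algebra.algebraMap_eq_smul_one]

theorem rder_algebraMap (x : K) (y : R) : rder K (algebraMap K R x) y = 0 :=
  rder_eq_zero.2 (Algebra.commutes x y).symm

/-- Same computation as for one vertex, applied to the only quadratic relation that is given: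
F_{j,-s} commutes with E_i, so the bracket only turns E_{j,s} and E_{j,s+1} into Cartan modes. -/
theorem psiE_adj_base (h : Generic q t) (X : Currents G q t s R) {i j : I} (hij : G.Adj i j) :
    X.PsiE j i 0 s := by
  have h1 := congrArg (rder K (X.F j (-s))) (X.EE_adj i j hij)
  have ht := h.t0
  have hq0 := h.q0
  have hqq := h.sub_inv
  have hT : t ^ s ≠ 0 := zpow_ne_zero _ h.t0
  have hφ := X.φE j i (s + 1)
  rw [cartan_adj G hij.symm, zpow_neg_one] at hφ
  rw [PsiE, cartan_adj G hij.symm, zpow_neg_one]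
  simp only [map_smul, map_add, rder_mul, rder_F_E, X.rder_F_E_ne hij.ne, add_neg_cancel, show s + 1 + -s = 1 by ring,
    X.φ_pos j 1 one_pos, smul_zero, sub_zero, zero_add, zpow_add₀ ht, zpow_neg, zpow_one,
    mul_sub, sub_mul, mul_smul_comm, smul_mul_assoc, smul_sub, smul_add, smul_smul, hφ, add_zero, mul_zero, zero_mul] at h1 ⊢
  generalize t ^ s = T at *
  generalize q - q⁻¹ = κ at *
  have h2 := congrArg (fun x => (κ * T⁻¹ * t⁻¹) • x) h1
  simp only [smul_add, smul_sub, smul_smul] at h2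
  linear_combination (norm := skip) h2
  match_scalars <;> field_simp <;> ring

theorem upE_self (h : Generic q t) (X : Currents G q t s R) (i : I) (m : ℤ) : X.UpE i i m :=
  (X.upE_iff_psiE h i i m).2 (X.psiE_self_zero h i m)

theorem rder_down_E_self (h : Generic q t) (X : Currents G q t s R) (i : I) (m : ℤ) :
    rder K (X.down i) (X.E i m) = (q ^ 2 - (q ^ 2)⁻¹) • X.E i (m - 1) := by
  have := (X.upE_flip_iff h i i (-m)).1 ((X.flip h.t0).upE_self h i (-m))
  rwa [neg_neg, cartan_self, zpow_ofNat] at this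

theorem Generic.q4 (h : Generic q t) : q ^ 2 - (q ^ 2)⁻¹ ≠ 0 := by
  have h0 := h.q0
  intro h'
  apply h.q_pow 4 (by norm_num)
  field_simp at h'
  linear_combination h'

/-- Bracket the shift rule at m with `down i`. It commutes with `up j` as a derivation and lowers
E_i by one with the same nonzero factor q² - q⁻² on both sides, which is then divided out. -/
theorem upE_pred (h : Generic q t) (X : Currents G q t s R) {i j : I} {m : ℤ} (hm : X.UpE j i m) :
    X.UpE j i (m - 1) := by
  have h4 := Generic.q4 h
  have h1 := congrArg (rder K (X.down i)) hm
  obtain ⟨x, hx⟩ := X.rder_down_up i j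
  rw [rder_jacobi, hx, rder_algebraMap, add_zero, map_smul, X.rder_down_E_self h, X.rder_down_E_self h,
    map_smul, smul_comm, smul_right_injective _ h4 |>.eq_iff] at h1
  rw [UpE, h1, show m + 1 - 1 = m - 1 + 1 by ring]

theorem upE_of_le (h : Generic q t) (X : Currents G q t s R) {i j : I} (hij : G.Adj i j) {m : ℤ}
    (hm : m ≤ s) : X.UpE j i m := by
  induction m, hm using Int.leInductionDown with
  | base => exact (X.upE_iff_psiE h j i s).2 (X.psiE_adj_base h hij)
  | pred n hn ih => exact X.upE_pred h ih

theorem rder_up_ψ0 (X : Currents G q t s R) (i j : I) : rder K (X.up j) (X.ψ i 0) = 0 := by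
  rw [rder_eq_zero, up, ← mul_assoc, X.kφ, mul_assoc, mul_assoc, X.kψ]

theorem rder_up_φ0 (X : Currents G q t s R) (i j : I) : rder K (X.up j) (X.φ i 0) = 0 := by
  rw [rder_eq_zero, up, ← mul_assoc, X.φkφ, mul_assoc, mul_assoc, X.φk]

/-- Upward propagation by `up i` is not available, since its bracket with `up j` is not yet known to
vanish. Instead the defect Z of the shift rule is shown to behave like a vector of weight α_i in an
sl₂ computation: it commutes with F_{i,-m} and q²-commutes with E_{i,m}, which forces Z = 0. -/
theorem upE_of_gt (h : Generic q t) (X : Currents G q t s R) {i j : I} (hij : G.Adj i j) {m : ℤ}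
    (hm : s < m) : X.UpE j i m := by
  have ht := h.t0
  have hq0 := h.q0
  have hqq := h.sub_inv
  have hT : t ^ m ≠ 0 := zpow_ne_zero _ h.t0
  have ha : cartan G j i = -1 := cartan_adj G hij.symm
  -- `swap` moves the base position to -s - 1, and -m ≤ -s - 1 exactly because m > s: the half that
  -- is already known for F is the half still missing for E.
  have hF : rder K (X.up j) (X.F i (-m)) = (q⁻¹ - q) • X.F i (-m + 1) := by
    have := (X.upE_swap_iff h j i (-m)).1 ((X.swap h.q0 h.t0).upE_of_le h.inv hij (by omega))
    rwa [ha, zpow_neg_one, inv_inv] at this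
  set Z := rder K (X.up j) (X.E i m) - (t⁻¹ * (q - q⁻¹)) • X.E i (m + 1) with hZ
  suffices hZ0 : Z = 0 by
    rw [UpE, ha, zpow_neg_one, inv_inv]; exact sub_eq_zero.1 hZ0
  -- Bracketing the Serre relation with F_{j,1} turns E_{j,0} into a multiple of ψ_{j,1} =
  -- ψ_{j,0}·`up j`. What remains says that the bracket of E_{i,m} with `up j` q²-commutes with
  -- E_{i,m}. So does E_{i,m+1}, hence Z does.
  have hE1 : Z * X.E i m = q ^ 2 • (X.E i m * Z) := by
    have h1 := congrArg (fun x => X.φ j 0 * rder K (X.F j 1) x) (X.EEE i j hij m 0)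
    have hE0 := X.kE' hq0 j i m
    rw [ha, zpow_neg_one, inv_inv] at hE0
    have hE2 : ∀ y, X.E i m * (X.ψ j 0 * y) = q • (X.ψ j 0 * (X.E i m * y)) := fun y => by
      rw [← mul_assoc, hE0, smul_mul_assoc, mul_assoc]
    have hψ : ∀ y, X.φ j 0 * (X.ψ j 0 * y) = y := fun y => by rw [← mul_assoc, X.φψ, one_mul]
    have hEE := X.EE i m
    simp only [map_smul, map_add, rder_mul, rder_F_E, X.rder_F_E_ne hij.ne, zero_add,
      X.φ_pos j 1 one_pos, smul_zero, sub_zero, zpow_zero, one_smul, X.ψ_eq_up j, hE2, hψ, mul_assoc,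
      mul_add, mul_smul_comm, smul_mul_assoc, smul_smul, add_zero, mul_zero, zero_mul] at h1
    rw [hZ, rder_apply]
    generalize q - q⁻¹ = κ at *
    simp only [sub_mul, mul_sub, mul_smul_comm, smul_mul_assoc, smul_sub, smul_smul, hEE, mul_assoc]
    have h2 := congrArg (fun x => κ • x) h1
    simp only [smul_add, smul_smul] at h2
    linear_combination (norm := skip) -h2
    match_scalars <;> field_simp <;> ring
  -- By the Jacobi identity one part is the bracket of `up j` with a combination of ψ_{i,0} and
  -- φ_{i,0}, which is zero; the other two parts are multiples of ψ_{i,1} that cancel.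
  have hF1 : rder K (X.F i (-m)) Z = 0 := by
    rw [hZ, map_sub, rder_jacobi, rder_neg_swap _ (X.up j), hF, ← neg_smul, rder_smul_left, map_smul]
    simp only [rder_F_E, add_neg_cancel, map_smul, map_sub, rder_up_ψ0, rder_up_φ0, smul_zero, sub_zero,
      show m + (-m + 1) = 1 by ring, show m + 1 + -m = 1 by ring, X.φ_pos i 1 one_pos, zpow_add₀ ht,
      zpow_one, smul_smul]
    match_scalars
    field_simp
    ring
  have hk : X.ψ i 0 * Z = q ^ 2 • (Z * X.ψ i 0) := by
    have hu := rder_eq_zero.1 (X.rder_up_ψ0 i j)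
    have he := X.kE i i m
    have he1 := X.kE i i (m + 1)
    rw [cartan_self, zpow_ofNat] at he he1
    rw [hZ, rder_apply]
    simp only [mul_sub, sub_mul, mul_smul_comm, smul_mul_assoc, smul_sub, he1]
    rw [← mul_assoc, he, ← mul_assoc, hu, mul_assoc, he, smul_mul_assoc, mul_assoc, hu]
    simp only [mul_smul_comm, mul_assoc, smul_comm (q ^ 2)]
  have hk' : Z * X.φ i 0 = q ^ 2 • (X.φ i 0 * Z) := by
    calc Z * X.φ i 0 = X.φ i 0 * (X.ψ i 0 * Z) * X.φ i 0 := by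
          rw [← mul_assoc, X.φψ, one_mul]
      _ = _ := by
        rw [hk, mul_smul_comm, smul_mul_assoc, ← mul_assoc, mul_assoc _ (X.ψ i 0), X.ψφ, mul_one]
  have h1 := congrArg (rder K (X.F i (-m))) hE1
  simp only [map_smul, rder_mul, hF1, mul_zero, zero_mul, add_zero, zero_add, rder_F_E, add_neg_cancel,
    mul_smul_comm, smul_mul_assoc, mul_sub, sub_mul, hk, hk', smul_sub, smul_smul] at h1
  -- The φ_{i,0} terms have the coefficient q²t^(-m) on both sides and cancel; the ψ_{i,0} terms
  -- differ by the factor q⁴.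
  have h2 : (t ^ m * (1 - q ^ 4)) • (Z * X.ψ i 0) = 0 := by
    have h2 := congrArg (fun x => (q - q⁻¹) • x) h1
    simp only [smul_sub, smul_smul] at h2
    linear_combination (norm := skip) h2
    generalize q - q⁻¹ = κ at *
    match_scalars <;> field_simp <;> ring
  have h3 : Z * X.ψ i 0 = 0 := (smul_eq_zero.1 h2).resolve_left
    (mul_ne_zero hT (sub_ne_zero.2 (h.q_pow 4 (by norm_num)).symm))
  rw [← mul_one Z, ← X.ψφ i, ← mul_assoc, h3, zero_mul]

/-- For vertices that are not joined: what commutes with E_j and F_j commutes with ψ_{j,1}. -/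
theorem ψ1_eq (h : Generic q t) (X : Currents G q t s R) (j : I) (a : ℤ) :
    X.ψ j 1 = ((q - q⁻¹) * t ^ (-a)) • rder K (X.F j (1 - a)) (X.E j a) := by
  rw [rder_F_E, show a + (1 - a) = 1 by ring, X.φ_pos j 1 one_pos, smul_zero, sub_zero, smul_smul,
    smul_smul, mul_right_comm _ _ (q - q⁻¹)⁻¹, mul_inv_cancel₀ h.sub_inv, one_mul, ← zpow_add₀ h.t0,
    neg_add_cancel, zpow_zero, one_smul]

theorem upE (h : Generic q t) (X : Currents G q t s R) (j i : I) (m : ℤ) : X.UpE j i m := by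
  by_cases hij : i = j
  · subst hij; exact X.upE_self h i m
  by_cases hadj : G.Adj i j
  · rcases le_or_gt m s with hm | hm
    · exact X.upE_of_le h hadj hm
    · exact X.upE_of_gt h hadj hm
  · rw [upE_iff_psiE h, psiE_zero_iff h, cartan_far G (Ne.symm hij) (fun h => hadj h.symm), zpow_zero, inv_one,
      sub_self, mul_zero, zero_smul, rder_eq_zero, up]
    have h1 := X.φE j i m
    rw [cartan_far G (Ne.symm hij) (fun h => hadj h.symm), zpow_zero, one_smul] at h1
    have h2 : rder K (X.E i m) (X.ψ j 1) = 0 := by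
      rw [X.ψ1_eq h j 0, map_smul, rder_jacobi, rder_eq_zero.2 (X.EE_far i j hij hadj m 0).symm,
        rder_eq_zero.2 (X.EF_ne i j hij m _).symm, map_zero, rder_apply, mul_zero, zero_mul, sub_zero,
        add_zero, smul_zero]
    rw [← mul_assoc, h1, mul_assoc, mul_assoc, rder_eq_zero.1 h2]

theorem rder_up_E (h : Generic q t) (X : Currents G q t s R) (j i : I) (m : ℤ) :
    rder K (X.up j) (X.E i m) =
      (t⁻¹ * ((q ^ cartan G j i)⁻¹ - q ^ cartan G j i)) • X.E i (m + 1) := X.upE h j i m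

theorem rder_down_E (h : Generic q t) (X : Currents G q t s R) (j i : I) (m : ℤ) :
    rder K (X.down j) (X.E i m) =
      (q ^ cartan G j i - (q ^ cartan G j i)⁻¹) • X.E i (m - 1) := by
  have := (X.upE_flip_iff h j i (-m)).1 ((X.flip h.t0).upE h j i (-m))
  rwa [neg_neg] at this

end Currents
end QAff

/-! ### Spreading relations by shifts: quadratic, Cartan and Serre relations -/

namespace QAff

/-- Induction on the distance k of the two indices, for k and k + 1 together: the shift condition at
distance k + 1 relates distances k and k + 2. At distance 1 it reads 2f(m, m+1) = 0 by symmetry,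
which is where torsion-freeness enters. -/
theorem eq_zero_of_symm_of_shift {M : Type*} [AddCommGroup M] [IsAddTorsionFree M] (f : ℤ → ℤ → M)
    (hs : ∀ m n, f m n = f n m) (h0 : ∀ m, f m m = 0)
    (hstep : ∀ m n, f m n = 0 → f (m + 1) n + f m (n + 1) = 0) (m n : ℤ) : f m n = 0 := by
  have key : ∀ k : ℕ, (∀ m, f m (m + k) = 0) ∧ ∀ m, f m (m + k + 1) = 0 := by
    intro k
    induction k with
    | zero =>
      refine ⟨fun m => by simpa using h0 m, fun m => ?_⟩
      have h1 := hstep m m (h0 m)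
      rw [hs (m + 1) m, ← two_nsmul] at h1
      simpa using (smul_eq_zero.1 h1).resolve_left two_ne_zero
    | succ k ih =>
      refine ⟨fun m => by simpa [add_assoc] using ih.2 m, fun m => ?_⟩
      have h1 := hstep m (m + k + 1) (ih.2 m)
      have h2 := ih.1 (m + 1)
      rw [show m + 1 + (k : ℤ) = m + k + 1 by ring] at h2
      rw [h2, zero_add] at h1
      rw [← h1]; push_cast; congr 1; ring
  rcases le_total m n with h | h
  · obtain ⟨k, rfl⟩ := Int.le.dest h
    exact (key k).1 m
  · obtain ⟨k, rfl⟩ := Int.le.dest h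
    rw [hs]
    exact (key k).1 n

theorem eq_zero_of_smul_eq_zero {K : Type*} [Field K] {M : Type*} [AddCommGroup M] [Module K M] {a : K}
    (ha : a ≠ 0) {x : M} (h : a • x = 0) : x = 0 :=
  (smul_eq_zero.1 h).resolve_left ha

/-- Moves p past x and then past y. The four instances of the one-step relations are weighted so
that all mixed terms x·p·y cancel. -/
theorem two_step {K : Type*} [Field K] {R : Type*} [Ring R] [Algebra K R] {a α β : K} (ha : a ≠ 0)
    {p x y : ℤ → R}
    (hx : ∀ N m, p (N + 1) * x m - (α * a) • (p N * x (m + 1)) =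
      a • (x m * p (N + 1)) - α • (x (m + 1) * p N))
    (hy : ∀ N b, p (N + 1) * y b - (β * a⁻¹) • (p N * y (b + 1)) =
      a⁻¹ • (y b * p (N + 1)) - β • (y (b + 1) * p N)) (N m b : ℤ) :
    p (N + 1 + 1) * (x m * y b) - (α * a) • (p (N + 1) * (x (m + 1) * y b))
      - (β * a⁻¹) • (p (N + 1) * (x m * y (b + 1))) + (α * β) • (p N * (x (m + 1) * y (b + 1))) =
    x m * y b * p (N + 1 + 1) - (α * a⁻¹) • (x (m + 1) * y b * p (N + 1))
      - (β * a) • (x m * y (b + 1) * p (N + 1)) + (α * β) • (x (m + 1) * y (b + 1) * p N) := by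
  have h1 := congrArg (· * y b) (hx (N + 1) m)
  have h2 := congrArg (fun z => (β * a⁻¹) • (z * y (b + 1))) (hx N m)
  have h3 := congrArg (fun z => a • (x m * z)) (hy (N + 1) b)
  have h4 := congrArg (fun z => α • (x (m + 1) * z)) (hy N b)
  simp only [sub_mul, mul_sub, smul_mul_assoc, mul_smul_comm, smul_sub, smul_smul, mul_assoc]
    at h1 h2 h3 h4 ⊢
  linear_combination (norm := skip) h1 - h2 + h3 - h4
  match_scalars <;> field_simp <;> ring

/-- Difference of the two orders of x and y; the second use of `two_step` has a⁻¹ for a, with α and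
β exchanged. With x = E_i, y = F_i the elements w are Cartan modes, so this is an exchange relation
between Cartan series. -/
theorem two_step_comm {K : Type*} [Field K] {R : Type*} [Ring R] [Algebra K R] {a α β : K} (ha : a ≠ 0)
    {p x y : ℤ → R} {w : ℤ → ℤ → R}
    (hx : ∀ N m, p (N + 1) * x m - (α * a) • (p N * x (m + 1)) =
      a • (x m * p (N + 1)) - α • (x (m + 1) * p N))
    (hy : ∀ N b, p (N + 1) * y b - (β * a⁻¹) • (p N * y (b + 1)) =
      a⁻¹ • (y b * p (N + 1)) - β • (y (b + 1) * p N))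
    (hw : ∀ m b, x m * y b - y b * x m = w m b) (N m b : ℤ) :
    p (N + 1 + 1) * w m b - (α * a) • (p (N + 1) * w (m + 1) b)
      - (β * a⁻¹) • (p (N + 1) * w m (b + 1)) + (α * β) • (p N * w (m + 1) (b + 1)) =
    w m b * p (N + 1 + 1) - (α * a⁻¹) • (w (m + 1) b * p (N + 1))
      - (β * a) • (w m (b + 1) * p (N + 1)) + (α * β) • (w (m + 1) (b + 1) * p N) := by
  have h1 := two_step ha hx hy N m b
  have h2 := two_step (inv_ne_zero ha) hy (by simpa only [inv_inv] using hx) N b m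
  simp only [inv_inv] at h2
  simp only [← hw, mul_sub, sub_mul, smul_sub]
  linear_combination (norm := skip) h1 - h2
  match_scalars <;> ring

namespace Currents
open MulOpposite

variable {I : Type*} [DecidableEq I] {G : SimpleGraph I} [DecidableRel G.Adj]
variable {K : Type*} [Field K] {q t : K} {s : ℤ} {R : Type*} [Ring R] [Algebra K R]

/-- The difference of the two sides of the quadratic relation of `E_i` and `E_j`. -/
def quadE (X : Currents G q t s R) (i j : I) (m n : ℤ) : R :=
  X.E i (m + 1) * X.E j n - q ^ cartan G j i • (X.E j n * X.E i (m + 1))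
    - q ^ cartan G j i • (X.E i m * X.E j (n + 1)) + X.E j (n + 1) * X.E i m

theorem quadE_symm (X : Currents G q t s R) (i : I) (m n : ℤ) : X.quadE i i m n = X.quadE i i n m := by
  simp only [quadE]; abel

theorem rder_up_quadE (h : Generic q t) (X : Currents G q t s R) (k i j : I) (m n : ℤ) :
    rder K (X.up k) (X.quadE i j m n) =
      (t⁻¹ * ((q ^ cartan G k i)⁻¹ - q ^ cartan G k i)) • X.quadE i j (m + 1) n +
      (t⁻¹ * ((q ^ cartan G k j)⁻¹ - q ^ cartan G k j)) • X.quadE i j m (n + 1) := by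
  simp only [quadE, map_add, map_sub, map_smul, rder_mul, X.rder_up_E h, mul_smul_comm, smul_mul_assoc]
  module

theorem rder_down_quadE (h : Generic q t) (X : Currents G q t s R) (k i j : I) (m n : ℤ) :
    rder K (X.down k) (X.quadE i j m n) =
      (q ^ cartan G k i - (q ^ cartan G k i)⁻¹) • X.quadE i j (m - 1) n +
      (q ^ cartan G k j - (q ^ cartan G k j)⁻¹) • X.quadE i j m (n - 1) := by
  simp only [quadE, map_add, map_sub, map_smul, rder_mul, X.rder_down_E h, mul_smul_comm, smul_mul_assoc]
  rw [show m - 1 + 1 = m + 1 - 1 by ring, show n - 1 + 1 = n + 1 - 1 by ring]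
  module

theorem isAddTorsionFree (K : Type*) [Field K] [CharZero K] (R : Type*) [Ring R] [Algebra K R] :
    IsAddTorsionFree R where
  nsmul_right_injective n hn x y hxy := by
    simp only [← Nat.cast_smul_eq_nsmul K] at hxy
    exact smul_right_injective _ (Nat.cast_ne_zero.2 hn) hxy

/-- On the diagonal the expression is twice the given relation. It is symmetric, and `up i` shifts
both indices with the same nonzero factor, so a zero at (m, n) makes the sum of the two shifted
values vanish. -/
theorem quadE_self [CharZero K] (h : Generic q t) (X : Currents G q t s R) (i : I) (m n : ℤ) :
    X.quadE i i m n = 0 := by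
  have := isAddTorsionFree K R
  refine eq_zero_of_symm_of_shift (X.quadE i i) (X.quadE_symm i) (fun m => ?_) (fun m n hmn => ?_) m n
  · rw [quadE, X.EE, cartan_self, zpow_ofNat]; abel
  · have h1 := X.rder_up_quadE h i i i m n
    rw [hmn, map_zero, ← smul_add, eq_comm, cartan_self, zpow_ofNat] at h1
    refine (smul_eq_zero.1 h1).resolve_left (mul_ne_zero (inv_ne_zero h.t0) ?_)
    rw [← neg_sub]; exact neg_ne_zero.2 (Generic.q4 h)

theorem eq_zero_of_two_eqs {α β : K} {x y : R} (hαβ : α ^ 2 - β ^ 2 ≠ 0) (h1 : α • x + β • y = 0)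
    (h2 : β • x + α • y = 0) : x = 0 ∧ y = 0 := by
  constructor
  · refine (smul_eq_zero.1 (?_ : (α ^ 2 - β ^ 2) • x = 0)).resolve_left hαβ
    linear_combination (norm := skip) α • h1 - β • h2
    match_scalars <;> ring
  · refine (smul_eq_zero.1 (?_ : (α ^ 2 - β ^ 2) • y = 0)).resolve_left hαβ
    linear_combination (norm := skip) α • h2 - β • h1
    match_scalars <;> ring

/-- The determinant equals q⁻⁴(q⁶ - 1)(q² - 1). -/
theorem Generic.det (h : Generic q t) : (q ^ 2 - (q ^ 2)⁻¹) ^ 2 - (q⁻¹ - q) ^ 2 ≠ 0 := by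
  have h0 := h.q0
  intro h'
  have h6 := sub_ne_zero.2 (h.q_pow 6 (by norm_num))
  have h2 := sub_ne_zero.2 (h.q_pow 2 (by norm_num))
  refine mul_ne_zero h6 h2 ?_
  field_simp at h'
  linear_combination h'

/-- Here there is no symmetry, but there are two shift operators: `up i` and `up j` give two
independent linear equations for the values at (m+1, n) and (m, n+1), and `down i`, `down j` do the
same below. Hence the zero at (s, s) spreads over all of ℤ². -/
theorem quadE_adj (h : Generic q t) (X : Currents G q t s R) {i j : I} (hij : G.Adj i j) (m n : ℤ) :
    X.quadE i j m n = 0 := by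
  have ht := h.t0
  have hij' : cartan G i j = -1 := cartan_adj G hij
  have hji : cartan G j i = -1 := cartan_adj G hij.symm
  have hdet := Generic.det h
  have up : ∀ m n, X.quadE i j m n = 0 → X.quadE i j (m + 1) n = 0 ∧ X.quadE i j m (n + 1) = 0 := by
    intro m n hmn
    have h1 := X.rder_up_quadE h i i j m n
    have h2 := X.rder_up_quadE h j i j m n
    rw [hmn, map_zero, eq_comm] at h1 h2
    rw [cartan_self, zpow_ofNat, hij', zpow_neg_one, inv_inv] at h1
    rw [cartan_self, zpow_ofNat, hji, zpow_neg_one, inv_inv] at h2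
    refine eq_zero_of_two_eqs ?_ h1 h2
    intro h'
    apply hdet
    have h'' : t⁻¹ ^ 2 * ((q ^ 2 - (q ^ 2)⁻¹) ^ 2 - (q⁻¹ - q) ^ 2) = 0 := by linear_combination h'
    exact (mul_eq_zero.1 h'').resolve_left (pow_ne_zero _ (inv_ne_zero ht))
  have down : ∀ m n, X.quadE i j m n = 0 → X.quadE i j (m - 1) n = 0 ∧ X.quadE i j m (n - 1) = 0 := by
    intro m n hmn
    have h1 := X.rder_down_quadE h i i j m n
    have h2 := X.rder_down_quadE h j i j m n
    rw [hmn, map_zero, eq_comm] at h1 h2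
    rw [cartan_self, zpow_ofNat, hij', zpow_neg_one, inv_inv] at h1
    rw [cartan_self, zpow_ofNat, hji, zpow_neg_one, inv_inv] at h2
    exact eq_zero_of_two_eqs hdet h1 h2
  have base : X.quadE i j s s = 0 := by
    have h1 := X.EE_adj i j hij
    rw [quadE, hji, zpow_neg_one]
    linear_combination (norm := module) h1
  have h1 : ∀ m, X.quadE i j m s = 0 := fun m =>
    Int.inductionOn' m s base (fun k _ hk => (up k s hk).1) (fun k _ hk => (down k s hk).1)
  exact Int.inductionOn' n s (h1 m) (fun k _ hk => (up m k hk).2) (fun k _ hk => (down m k hk).2)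

theorem quadE_eq_zero [CharZero K] (h : Generic q t) (X : Currents G q t s R) (i j : I) (m n : ℤ) :
    X.quadE i j m n = 0 := by
  by_cases hij : i = j
  · subst hij; exact X.quadE_self h i m n
  by_cases hadj : G.Adj i j
  · exact X.quadE_adj h hadj m n
  · rw [quadE, cartan_far G (Ne.symm hij) (fun h => hadj h.symm), zpow_zero, one_smul, one_smul,
      X.EE_far i j hij hadj, X.EE_far i j hij hadj]
    abel

/-- The difference of the two sides of the commutation relation of `ψ_j` and `E_i`, times `t`. -/
def crossPsi (X : Currents G q t s R) (j i : I) (N m : ℤ) : R :=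
  X.E i (m + 1) * X.ψ j N - q ^ cartan G j i • (X.ψ j N * X.E i (m + 1))
    - (q ^ cartan G j i * t) • (X.E i m * X.ψ j (N + 1)) + t • (X.ψ j (N + 1) * X.E i m)

/-- The difference of the two sides of the commutation relation of `φ_j` and `E_i`. -/
def crossPhi (X : Currents G q t s R) (j i : I) (N m : ℤ) : R :=
  X.E i (m + 1) * X.φ j N - q ^ cartan G j i • (X.φ j N * X.E i (m + 1))
    - q ^ cartan G j i • (X.E i m * X.φ j (N + 1)) + X.φ j (N + 1) * X.E i m

theorem psiE_iff_crossPsi (h : Generic q t) (X : Currents G q t s R) (j i : I) (N m : ℤ) :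
    X.PsiE j i N m ↔ X.crossPsi j i N m = 0 := by
  have ht := h.t0
  rw [PsiE, ← sub_eq_zero, ← smul_right_injective _ ht |>.eq_iff (b := 0)]
  rw [smul_zero, crossPsi]
  refine iff_of_eq (congrArg (· = 0) ?_)
  match_scalars <;> field_simp

theorem rder_F_quadE_ne (h : Generic q t) (X : Currents G q t s R) {i j : I} (hij : i ≠ j) (m n b : ℤ) :
    rder K (X.F j b) (X.quadE i j m n) =
      (q - q⁻¹)⁻¹ • (t ^ n • X.crossPsi j i (n + b) m - t ^ b • X.crossPhi j i (n + b) m) := by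
  simp only [quadE, map_add, map_sub, map_smul, rder_mul, rder_F_E, X.rder_F_E_ne hij, mul_zero, zero_mul,
    crossPsi, crossPhi, mul_smul_comm, smul_mul_assoc, mul_sub, sub_mul, add_right_comm n 1 b,
    zpow_add_one₀ h.t0]
  module

theorem rder_F_quadE_self (h : Generic q t) (X : Currents G q t s R) (i : I) (m n b : ℤ) :
    rder K (X.F i b) (X.quadE i i m n) =
      (q - q⁻¹)⁻¹ • (t ^ n • X.crossPsi i i (n + b) m - t ^ b • X.crossPhi i i (n + b) m +
        (t ^ m • X.crossPsi i i (m + b) n - t ^ b • X.crossPhi i i (m + b) n)) := by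
  simp only [quadE, map_add, map_sub, map_smul, rder_mul, rder_F_E,
    crossPsi, crossPhi, mul_smul_comm, smul_mul_assoc, mul_sub, sub_mul, add_right_comm n 1 b,
    add_right_comm m 1 b, zpow_add_one₀ h.t0]
  module

/-- The bracket of a quadratic relation with F_{j,b} is a combination of the ψ–E relation and the
φ–E relation. For i ≠ j two choices of indices separate them; for i = j and N ≥ 0 the φ part
vanishes by itself and the case N = 0 is known. -/
theorem psiE [CharZero K] (h : Generic q t) (X : Currents G q t s R) (j i : I) (N m : ℤ) :
    X.PsiE j i N m := by
  have ht := h.t0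
  have hκ := inv_ne_zero h.sub_inv
  rw [psiE_iff_crossPsi h]
  by_cases hij : i = j
  · subst hij
    -- Below N = -1 all modes of ψ involved are zero, and at N = -1 only the weight relation of
    -- ψ_{i,0} is left.
    rcases lt_trichotomy N (-1) with hN | rfl | hN
    · rw [crossPsi, X.ψ_neg _ _ (by omega), X.ψ_neg _ _ (by omega)]; simp
    · rw [crossPsi, X.ψ_neg _ (-1) (by omega), neg_add_cancel, X.kE]
      simp only [mul_zero, zero_mul, smul_zero, sub_zero]
      module
    · have h1 := X.rder_F_quadE_self h i m (N + m) (-m)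
      have h0 := (X.psiE_iff_crossPsi h i i 0 (N + m)).1 (X.psiE_self_zero h i (N + m))
      have hφ : ∀ N n, 0 ≤ N → X.crossPhi i i N n = 0 := by
        intro N n hN
        rcases hN.eq_or_lt with rfl | hN
        · rw [crossPhi, X.φE, X.φ_pos _ (0 + 1) (by omega)]; simp
        · rw [crossPhi, X.φ_pos _ N (by omega), X.φ_pos _ (N + 1) (by omega)]; simp
      rw [X.quadE_self h, map_zero, add_neg_cancel, show N + m + -m = N by ring, h0,
        hφ _ _ (by omega), hφ _ _ le_rfl] at h1
      simpa [hκ, ht, h.sub_inv, zpow_ne_zero] using h1.symm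
  · have h0 := X.rder_F_quadE_ne h hij m 0 N
    have h1 := X.rder_F_quadE_ne h hij m 1 (N - 1)
    rw [X.quadE_eq_zero h, map_zero, eq_comm, smul_eq_zero, or_iff_right hκ] at h0 h1
    rw [zero_add, zpow_zero, one_smul] at h0
    rw [show 1 + (N - 1) = N by ring, zpow_one, zpow_sub_one₀ ht] at h1
    refine eq_zero_of_smul_eq_zero h.t_sub_inv ?_
    linear_combination (norm := module) h1 - t⁻¹ • h0

theorem ψE [CharZero K] (h : Generic q t) (X : Currents G q t s R) (j i : I) (N m : ℤ) :
    X.ψ j (N + 1) * X.E i m - (t⁻¹ * q ^ cartan G j i) • (X.ψ j N * X.E i (m + 1)) =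
      q ^ cartan G j i • (X.E i m * X.ψ j (N + 1)) - t⁻¹ • (X.E i (m + 1) * X.ψ j N) :=
  X.psiE h j i N m

/-- The flip exchanges ψ and φ and negates indices, so this is `ψE` read backwards. The other two
Cartan relations come from `swap` in the same way. -/
theorem φE_cross [CharZero K] (h : Generic q t) (X : Currents G q t s R) (j i : I) (N m : ℤ) :
    X.φ j (N + 1) * X.E i m - (1 * q ^ cartan G j i) • (X.φ j N * X.E i (m + 1)) =
      q ^ cartan G j i • (X.E i m * X.φ j (N + 1)) - (1 : K) • (X.E i (m + 1) * X.φ j N) := by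
  have ht := h.t0
  have h1 := congrArg (fun x => t ^ (-N) • x.unop) ((X.flip ht).ψE h j i (-N - 1) (-m - 1))
  simp only [flip, ← op_mul, ← op_smul, ← op_sub, unop_op, smul_sub, mul_smul_comm, smul_mul_assoc,
    smul_smul] at h1
  simp only [show -(-N - 1 + 1) = N by ring, show -(-N - 1) = N + 1 by ring,
    show -(-m - 1 + 1) = m by ring, show -(-m - 1) = m + 1 by ring, zpow_neg, zpow_add₀ ht, zpow_one] at h1
  have hT := zpow_ne_zero N ht
  generalize t ^ N = T at *
  linear_combination (norm := skip) h1
  match_scalars <;> field_simp <;> ring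

theorem ψF [CharZero K] (h : Generic q t) (X : Currents G q t s R) (j i : I) (N m : ℤ) :
    X.ψ j (N + 1) * X.F i m - (1 * (q ^ cartan G j i)⁻¹) • (X.ψ j N * X.F i (m + 1)) =
      (q ^ cartan G j i)⁻¹ • (X.F i m * X.ψ j (N + 1)) - (1 : K) • (X.F i (m + 1) * X.ψ j N) := by
  have ht := h.t0
  have h1 := congrArg (fun x => t ^ (-N - 1) • x) ((X.swap h.q0 ht).ψE h.inv j i N m)
  simp only [swap, smul_sub, mul_smul_comm, smul_mul_assoc, smul_smul, inv_zpow, inv_inv] at h1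
  simp only [zpow_neg, zpow_sub₀ ht, zpow_add₀ ht, zpow_one] at h1
  have hT := zpow_ne_zero N ht
  generalize t ^ N = T at *
  linear_combination (norm := skip) h1
  match_scalars <;> field_simp <;> ring

theorem φF_cross [CharZero K] (h : Generic q t) (X : Currents G q t s R) (j i : I) (N m : ℤ) :
    X.φ j (N + 1) * X.F i m - (t⁻¹ * (q ^ cartan G j i)⁻¹) • (X.φ j N * X.F i (m + 1)) =
      (q ^ cartan G j i)⁻¹ • (X.F i m * X.φ j (N + 1)) - t⁻¹ • (X.F i (m + 1) * X.φ j N) := by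
  have ht := h.t0
  have h1 := congrArg (fun x => t ^ (-N - 1) • x) ((X.swap h.q0 ht).φE_cross h.inv j i N m)
  simp only [swap, smul_sub, mul_smul_comm, smul_mul_assoc, smul_smul, inv_zpow] at h1
  simp only [zpow_neg, zpow_sub₀ ht, zpow_add₀ ht, zpow_one] at h1
  have hT := zpow_ne_zero N ht
  generalize t ^ N = T at *
  linear_combination (norm := skip) h1
  match_scalars <;> field_simp <;> ring

/-- For M > 0 the brackets [E_{i,m}, F_{i,b}] that occur have m + b > 0 and contain no φ_i, so
commuting them past ψ_j involves ψ's only. -/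
theorem ψψ_two_step [CharZero K] (h : Generic q t) (X : Currents G q t s R) (j i : I) (N M : ℤ)
    (hM : 0 < M) :
    rder K (X.ψ i M) (X.ψ j (N + 1 + 1)) -
      (q ^ cartan G j i + (q ^ cartan G j i)⁻¹) • rder K (X.ψ i (M + 1)) (X.ψ j (N + 1)) +
      rder K (X.ψ i (M + 1 + 1)) (X.ψ j N) = 0 := by
  have ht := h.t0
  have hκ := h.sub_inv
  have ha : q ^ cartan G j i ≠ 0 := zpow_ne_zero _ h.q0
  have h1 := congrArg (fun x => (q - q⁻¹) • x) (two_step_comm ha (X.ψE h j i) (X.ψF h j i) (X.EF i) N 0 M)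
  simp only [zero_add, show 1 + M = M + 1 by ring, show 1 + (M + 1) = M + 1 + 1 by ring,
    X.φ_pos i M hM, X.φ_pos i (M + 1) (by omega), X.φ_pos i (M + 1 + 1) (by omega), smul_zero, sub_zero,
    zpow_zero, zpow_one, one_smul, mul_smul_comm, smul_mul_assoc, smul_sub, smul_add, smul_smul] at h1
  simp only [rder_apply]
  generalize q - q⁻¹ = κ at *
  linear_combination (norm := skip) h1
  match_scalars <;> field_simp <;> ring

/-- For M > 0, `ψψ_two_step` determines the bracket with ψ_{j,N} from those with ψ_{j,N-1} and
ψ_{j,N-2}; induction on N starts from ψ_{j,0}, which commutes with everything here. -/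
theorem ψ_comm [CharZero K] (h : Generic q t) (X : Currents G q t s R) (j i : I) (N M : ℤ) :
    X.ψ j N * X.ψ i M = X.ψ i M * X.ψ j N := by
  suffices h1 : ∀ n : ℕ, ∀ N : ℤ, N < n → ∀ M, rder K (X.ψ i M) (X.ψ j N) = 0 from
    rder_eq_zero.1 (h1 (N.toNat + 1) N (by omega) M)
  intro n
  induction n with
  | zero => intro N hN M; rw [X.ψ_neg j N (by simpa using hN), map_zero]
  | succ n ih =>
    intro N hN M
    rcases lt_trichotomy N 0 with hN0 | rfl | hN0
    · rw [X.ψ_neg j N hN0, map_zero]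
    · rw [rder_eq_zero, X.kψ]
    rcases lt_trichotomy M 0 with hM | rfl | hM
    · rw [X.ψ_neg i M hM, rder_apply, mul_zero, zero_mul, sub_zero]
    · rw [rder_eq_zero, X.kψ]
    have h1 := X.ψψ_two_step h j i (N - 2) M hM
    rw [ih (N - 2) (by push_cast at hN; omega), ih (N - 2 + 1) (by push_cast at hN; omega), smul_zero, sub_zero, add_zero] at h1
    rw [← h1]; congr 2; ring

theorem φ_comm [CharZero K] (h : Generic q t) (X : Currents G q t s R) (j i : I) (N M : ℤ) :
    X.φ j N * X.φ i M = X.φ i M * X.φ j N := by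
  have h1 := congrArg unop ((X.flip h.t0).ψ_comm h i j (-M) (-N))
  simp only [flip, ← op_mul, unop_op, neg_neg, mul_smul_comm, smul_mul_assoc, smul_smul, mul_comm (t ^ M)] at h1
  exact smul_right_injective _ (mul_ne_zero (zpow_ne_zero N h.t0) (zpow_ne_zero M h.t0)) h1

/-- Here M is arbitrary, so the brackets [E, F] have φ_i parts as well. These drop out, since the
φ's commute and enter both sides with equal coefficients. -/
theorem φψ_two_step [CharZero K] (h : Generic q t) (X : Currents G q t s R) (j i : I) (N M : ℤ) :
    X.φ j (N + 1 + 1) * X.ψ i M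
      - (q ^ cartan G j i * t + (q ^ cartan G j i)⁻¹ * t⁻¹) • (X.φ j (N + 1) * X.ψ i (M + 1))
      + X.φ j N * X.ψ i (M + 1 + 1) =
    X.ψ i M * X.φ j (N + 1 + 1)
      - ((q ^ cartan G j i)⁻¹ * t + q ^ cartan G j i * t⁻¹) • (X.ψ i (M + 1) * X.φ j (N + 1))
      + X.ψ i (M + 1 + 1) * X.φ j N := by
  have ht := h.t0
  have hκ := h.sub_inv
  have ha : q ^ cartan G j i ≠ 0 := zpow_ne_zero _ h.q0
  have h1 := congrArg (fun x => (q - q⁻¹) • x)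
    (two_step_comm ha (X.φE_cross h j i) (X.φF_cross h j i) (X.EF i) N 0 M)
  have hT := zpow_ne_zero M ht
  generalize q - q⁻¹ = κ at *
  simp only [zero_add, show 1 + M = M + 1 by ring, show 1 + (M + 1) = M + 1 + 1 by ring,
    zpow_zero, zpow_one, one_smul, mul_smul_comm, smul_mul_assoc, smul_sub, smul_add, smul_smul,
    mul_sub, sub_mul, X.φ_comm h i j, zpow_add₀ ht] at h1
  generalize t ^ M = T at *
  linear_combination (norm := skip) h1
  match_scalars <;> field_simp <;> ring

theorem serreE [CharZero K] (h : Generic q t) (X : Currents G q t s R) {i j : I} (hij : G.Adj i j)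
    (m m' n : ℤ) :
    X.E j n * X.E i m * X.E i m' + X.E i m * X.E i m' * X.E j n +
      (X.E j n * X.E i m' * X.E i m + X.E i m' * X.E i m * X.E j n) =
    (q + q⁻¹) • (X.E i m * X.E j n * X.E i m') + (q + q⁻¹) • (X.E i m' * X.E j n * X.E i m) := by
  -- The function to be killed takes values in families indexed by n: the bracket with `up i` also
  -- moves the index of E_j, so vanishing has to be carried for all n at once.
  have := isAddTorsionFree K (ℤ → R)
  rw [← sub_eq_zero]
  set f : ℤ → ℤ → ℤ → R := fun m m' n => X.E j n * X.E i m * X.E i m' + X.E i m * X.E i m' * X.E j n +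
      (X.E j n * X.E i m' * X.E i m + X.E i m' * X.E i m * X.E j n) -
    ((q + q⁻¹) • (X.E i m * X.E j n * X.E i m') + (q + q⁻¹) • (X.E i m' * X.E j n * X.E i m)) with hf
  refine congrFun (eq_zero_of_symm_of_shift f (fun m m' => ?_) (fun m => ?_) (fun m m' hm => ?_) m m') n
  · funext n; simp only [hf]; abel
  · funext n; simp only [hf, X.EEE i j hij, Pi.zero_apply]; abel
  · funext n
    have h1 := congrArg (rder K (X.up i)) (congrFun hm n)
    -- The part of the bracket that falls on E_{j,n} is a multiple of the assumption at n + 1.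
    have h2 := congrFun hm (n + 1)
    have hne : t⁻¹ * ((q ^ 2)⁻¹ - q ^ 2) ≠ 0 := by
      refine mul_ne_zero (inv_ne_zero h.t0) ?_
      rw [← neg_sub]; exact neg_ne_zero.2 (Generic.q4 h)
    simp only [hf, Pi.add_apply, Pi.zero_apply, map_add, map_sub, map_smul, map_zero, rder_mul, X.rder_up_E h,
      mul_smul_comm, smul_mul_assoc, cartan_self, cartan_adj G hij, zpow_neg_one, inv_inv, zpow_ofNat,
      add_mul] at h1 h2 ⊢
    refine eq_zero_of_smul_eq_zero hne ?_
    linear_combination (norm := skip) h1 - (t⁻¹ * (q - q⁻¹)) • h2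
    module

theorem serreF [CharZero K] (h : Generic q t) (X : Currents G q t s R) {i j : I} (hij : G.Adj i j)
    (m m' n : ℤ) :
    X.F j n * X.F i m * X.F i m' + X.F i m * X.F i m' * X.F j n +
      (X.F j n * X.F i m' * X.F i m + X.F i m' * X.F i m * X.F j n) =
    (q + q⁻¹) • (X.F i m * X.F j n * X.F i m') + (q + q⁻¹) • (X.F i m' * X.F j n * X.F i m) := by
  have h1 := (X.swap h.q0 h.t0).serreE h.inv hij m m' n
  rwa [inv_inv, add_comm q⁻¹] at h1

theorem quadF [CharZero K] (h : Generic q t) (X : Currents G q t s R) (i j : I) (m n : ℤ) :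
    X.F i (m + 1) * X.F j n - (q ^ cartan G j i)⁻¹ • (X.F j n * X.F i (m + 1))
    - (q ^ cartan G j i)⁻¹ • (X.F i m * X.F j (n + 1)) + X.F j (n + 1) * X.F i m = 0 := by
  have h1 := (X.swap h.q0 h.t0).quadE_eq_zero h.inv i j m n
  rwa [quadE, inv_zpow] at h1

end Currents
end QAff

namespace QAff

/-! ### Quantum integers -/

section qint

variable {K : Type*} [Field K] {q : K}

theorem zpow_ne_one (hq : ∀ n : ℕ, 0 < n → q ^ n ≠ 1) {n : ℤ} (hn : n ≠ 0) : q ^ n ≠ 1 := by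
  intro h
  rcases Int.eq_nat_or_neg n with ⟨m, rfl | rfl⟩
  · rw [zpow_natCast] at h
    exact hq m (by omega) h
  · rw [zpow_neg, inv_eq_one, zpow_natCast] at h
    exact hq m (by omega) h

theorem q_sub_inv_ne (hq0 : q ≠ 0) (hq : ∀ n : ℕ, 0 < n → q ^ n ≠ 1) : q - q⁻¹ ≠ 0 := by
  intro h'
  have : q * (q - q⁻¹) = 0 := by rw [h', mul_zero]
  rw [mul_sub, mul_inv_cancel₀ hq0, ← sq] at this
  exact hq 2 (by norm_num) (sub_eq_zero.1 this)

theorem qint_ne_zero (hq0 : q ≠ 0) (hq : ∀ n : ℕ, 0 < n → q ^ n ≠ 1) {n : ℤ} (hn : n ≠ 0) :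
    qint q n ≠ 0 := by
  refine div_ne_zero ?_ (q_sub_inv_ne hq0 hq)
  intro h
  refine zpow_ne_one hq (n := 2 * n) (by omega) ?_
  rw [two_mul, zpow_add₀ hq0]
  nth_rw 2 [sub_eq_zero.1 h]
  rw [← zpow_add₀ hq0, add_neg_cancel, zpow_zero]

theorem qint_neg (n : ℤ) : qint q (-n) = -qint q n := by
  rw [qint, qint, neg_neg, ← neg_div, neg_sub]

theorem qint_zero : qint q 0 = 0 := by simp [qint]

theorem qint_one (hκ : q - q⁻¹ ≠ 0) : qint q 1 = 1 := by
  rw [qint, zpow_one, zpow_neg_one, div_self hκ]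

theorem qint_two (hq0 : q ≠ 0) (hκ : q - q⁻¹ ≠ 0) : qint q 2 = q + q⁻¹ := by
  rw [qint, div_eq_iff hκ, zpow_neg]
  norm_cast
  field_simp
  ring

/-- This is the inductive step for the coefficient in `Sl2String.e_f_pow`. -/
theorem qint_mul_succ (hq0 : q ≠ 0) (hκ : q - q⁻¹ ≠ 0) (j m : ℤ) :
    qint q (j + 1) * qint q (m - j) = qint q j * qint q (m - j + 1) + qint q (m - 2 * j) := by
  have hA := zpow_ne_zero j hq0
  have hB := zpow_ne_zero m hq0
  have h2 : q ^ (2 * j) = q ^ j * q ^ j := by rw [two_mul, zpow_add₀ hq0]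
  simp only [qint]
  rw [div_mul_div_comm, div_mul_div_comm, div_add_div _ _ (mul_ne_zero hκ hκ) hκ,
    div_eq_div_iff (mul_ne_zero hκ hκ) (mul_ne_zero (mul_ne_zero hκ hκ) hκ)]
  simp only [neg_add, neg_sub, zpow_add₀ hq0, zpow_sub₀ hq0, zpow_neg, zpow_one, h2]
  generalize q ^ j = A at *
  generalize q ^ m = B at *
  field_simp
  ring

end qint

/-! ### Bounded strings for U_q(sl₂) -/

/-- A string of weight spaces for a copy of `U_q(sl₂)`, with finitely many nonzero terms. -/
structure Sl2String {K : Type*} [Field K] (q : K) {V : Type*} [AddCommGroup V] [Module K V]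
    (e f : Module.End K V) (W : ℤ → Submodule K V) (w : ℤ) : Prop where
  e_mem : ∀ k v, v ∈ W k → e v ∈ W (k + 1)
  f_mem : ∀ k v, v ∈ W k → f v ∈ W (k - 1)
  comm : ∀ k v, v ∈ W k → e (f v) = f (e v) + qint q (w + 2 * k) • v
  bdd : ∃ N : ℤ, ∀ k, N ≤ |k| → W k = ⊥

namespace Sl2String

variable {K : Type*} [Field K] {q : K} {V : Type*} [AddCommGroup V] [Module K V]
  {e f : Module.End K V} {W : ℤ → Submodule K V} {w : ℤ}

theorem symm (h : Sl2String q e f W w) : Sl2String q f e (fun k => W (-k)) (-w) where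
  e_mem k v hv := by rw [neg_add]; exact h.f_mem _ v hv
  f_mem k v hv := by rw [neg_sub, sub_eq_add_neg, add_comm]; exact h.e_mem _ v hv
  comm k v hv := by
    rw [h.comm _ v hv, show -w + 2 * k = -(w + 2 * -k) by ring, qint_neg, neg_smul, add_neg_cancel_right]
  bdd := h.bdd.imp fun N hN k hk => hN _ (by rwa [abs_neg])

theorem f_pow_mem (h : Sl2String q e f W w) (j : ℕ) {k : ℤ} {v : V} (hv : v ∈ W k) :
    (f ^ j) v ∈ W (k - j) := by
  induction j with
  | zero => simpa using hv
  | succ j ih =>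
    rw [pow_succ', Module.End.mul_apply]
    have := h.f_mem _ _ ih
    rwa [sub_sub] at this

theorem e_f_pow (hq0 : q ≠ 0) (hκ : q - q⁻¹ ≠ 0) (h : Sl2String q e f W w) (j : ℕ) {k : ℤ} {v : V}
    (hv : v ∈ W k) : e ((f ^ (j + 1)) v) =
      (f ^ (j + 1)) (e v) + (qint q (j + 1) * qint q (w + 2 * k - j)) • (f ^ j) v := by
  induction j with
  | zero =>
    simp [h.comm k v hv, qint_one hκ]
  | succ j ih =>
    rw [pow_succ', Module.End.mul_apply, h.comm _ _ (h.f_pow_mem (j + 1) hv), ih, map_add, map_smul,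
      ← Module.End.mul_apply f, ← Module.End.mul_apply f, ← pow_succ', ← pow_succ', add_assoc, ← add_smul]
    have := qint_mul_succ hq0 hκ (j + 1) (w + 2 * k)
    push_cast at this ⊢
    rw [this]
    congr 3
    · ring_nf
    · congr 1; ring

variable (hq0 : q ≠ 0) (hq : ∀ n : ℕ, 0 < n → q ^ n ≠ 1)
include hq0 hq

/-- On a highest weight vector v of weight λ, e f^(j+1) v = [j+1][λ-j] f^j v, with nonzero
coefficient for j < λ; so a vanishing power of f can be lowered to f⁰. -/
theorem eq_zero_of_f_pow_of_e (h : Sl2String q e f W w) {k : ℤ} {v : V} (hv : v ∈ W k) (he : e v = 0)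
    (j : ℕ) (hj : j ≤ w + 2 * k) (hf : (f ^ j) v = 0) : v = 0 := by
  induction j with
  | zero => simpa using hf
  | succ j ih =>
    have h1 := h.e_f_pow hq0 (q_sub_inv_ne hq0 hq) j hv
    rw [hf, he, map_zero, map_zero, zero_add, eq_comm] at h1
    push_cast at hj
    refine ih (by omega) (eq_zero_of_smul_eq_zero (mul_ne_zero (qint_ne_zero hq0 hq ?_)
      (qint_ne_zero hq0 hq ?_)) h1) <;> omega

/-- Descending induction from the top of the string. If f^j v = 0, commuting e past f^(j+1) gives
f^(j+1)(e v) = 0. The weight of e v is larger by two, so e v = 0 by induction and v is a highest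
weight vector. -/
theorem eq_zero_of_f_pow (h : Sl2String q e f W w) {k : ℤ} {v : V} (hv : v ∈ W k)
    (j : ℕ) (hj : j ≤ w + 2 * k) (hf : (f ^ j) v = 0) : v = 0 := by
  obtain ⟨N, hN⟩ := h.bdd
  have key : ∀ n : ℕ, ∀ k : ℤ, N - k ≤ n → ∀ v ∈ W k, ∀ j : ℕ, j ≤ w + 2 * k → (f ^ j) v = 0 → v = 0 := by
    intro n
    induction n with
    | zero =>
      intro k hk v hv _ _ _
      rw [hN k ((by simpa using hk : N ≤ k).trans (le_abs_self k))] at hv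
      exact (Submodule.mem_bot K).1 hv
    | succ n ih =>
      intro k hk v hv j hj hf
      have h1 := h.e_f_pow hq0 (q_sub_inv_ne hq0 hq) j hv
      rw [pow_succ', Module.End.mul_apply, hf, map_zero, map_zero, smul_zero, add_zero, eq_comm,
        ← pow_succ'] at h1
      have he := ih (k + 1) (by push_cast at hk; omega) (e v) (h.e_mem k v hv) (j + 1)
        (by push_cast; omega) h1
      exact h.eq_zero_of_f_pow_of_e hq0 hq hv he j hj hf
  exact key (N - k).toNat k (Int.self_le_toNat _) v hv j hj hf

/-- Every v is killed by some e^j. If e^(j+1) v = 0, then e^j kills e f v + x v, where x =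
[j+1][-λ-j] for the weight λ of v; x is nonzero as λ > 0. By induction that vector is in the image
of e f, so x v is too. -/
theorem exists_e_f_eq (h : Sl2String q e f W w) {k : ℤ} (hk : 0 < w + 2 * k) {v : V} (hv : v ∈ W k) :
    ∃ u ∈ W k, e (f u) = v := by
  obtain ⟨N, hN⟩ := h.bdd
  have hpow : ∀ j : ℕ, (e ^ j) v ∈ W (k + j) := fun j => by
    have := h.symm.f_pow_mem j (k := -k) (v := v) (by rwa [neg_neg])
    simpa [add_comm] using this
  have key : ∀ j : ℕ, ∀ v ∈ W k, (e ^ j) v = 0 → ∃ u ∈ W k, e (f u) = v := by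
    intro j
    induction j with
    | zero => intro v _ h0; exact ⟨0, zero_mem _, by simpa using h0.symm⟩
    | succ j ih =>
      intro v hv h0
      have h1 := h.symm.e_f_pow hq0 (q_sub_inv_ne hq0 hq) j (k := -k) (v := v) (by rwa [neg_neg])
      set x := qint q (j + 1) * qint q (-w + 2 * -k - j) with hx
      have hx0 : x ≠ 0 := mul_ne_zero (qint_ne_zero hq0 hq (by omega)) (qint_ne_zero hq0 hq (by omega))
      have hefv : e (f v) ∈ W k := by
        have := h.e_mem _ _ (h.f_mem k v hv)
        rwa [sub_add_cancel] at this
      obtain ⟨u, hu, hu'⟩ := ih (e (f v) + x • v) (add_mem hefv (Submodule.smul_mem _ _ hv)) (by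
        rw [map_add, map_smul, ← Module.End.mul_apply (e ^ j), ← pow_succ, ← h1, h0, map_zero])
      refine ⟨x⁻¹ • (u - v), Submodule.smul_mem _ _ (sub_mem hu hv), ?_⟩
      rw [map_smul, map_smul, map_sub, map_sub, hu', add_sub_cancel_left, smul_smul, inv_mul_cancel₀ hx0,
        one_smul]
  refine key (N - k).toNat v hv ?_
  have h1 := hpow (N - k).toNat
  rw [hN _ (le_trans (by omega) (le_abs_self _))] at h1
  exact (Submodule.mem_bot K).1 h1

/-- Descending induction on k. In negative weight, v lies in the image of f e, and S commutes with
f. In weight m ≥ 0, v may be changed by an element f u, on which S vanishes, into a highest weight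
vector; then f^(m+1) kills v and hence S v, but it is injective in weight m + 3. -/
theorem intertwiner_eq_zero {W' : ℤ → Submodule K V} (h : Sl2String q e f W w)
    (h' : Sl2String q e f W' (w + 3)) (S : Module.End K V) (hS : ∀ k v, v ∈ W k → S v ∈ W' k)
    (hf : ∀ v, S (f v) = f (S v)) {k : ℤ} {v : V} (hv : v ∈ W k) : S v = 0 := by
  obtain ⟨N, hN⟩ := h.bdd
  have key : ∀ n : ℕ, ∀ k : ℤ, N - k ≤ n → ∀ v ∈ W k, S v = 0 := by
    intro n
    induction n with
    | zero =>
      intro k hk v hv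
      rw [hN k ((by simpa using hk : N ≤ k).trans (le_abs_self k))] at hv
      rw [(Submodule.mem_bot K).1 hv, map_zero]
    | succ n ih =>
      intro k hk v hv
      have ih := ih (k + 1) (by push_cast at hk; omega)
      rcases lt_or_ge (w + 2 * k) 0 with hneg | hpos
      · obtain ⟨u, hu, rfl⟩ := h.symm.exists_e_f_eq hq0 hq (k := -k) (by omega) (v := v) (by rwa [neg_neg])
        rw [neg_neg] at hu
        rw [hf, ih _ (h.e_mem k u hu), map_zero]
      -- The vector e v has weight at least 2, so e v = e f u for some u one step higher, and v - f
      -- u is killed by e.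
      · obtain ⟨u, hu, huv⟩ := h.exists_e_f_eq hq0 hq (k := k + 1) (by omega) (h.e_mem k v hv)
        have hfu : f u ∈ W k := by
          have := h.f_mem _ _ hu
          rwa [add_sub_cancel_right] at this
        have hv0 : v - f u ∈ W k := sub_mem hv hfu
        have he0 : e (v - f u) = 0 := by rw [map_sub, huv, sub_self]
        have hSv : S v = S (v - f u) := by rw [map_sub, hf, ih u hu, map_zero, sub_zero]
        obtain ⟨m, hm⟩ := Int.eq_ofNat_of_zero_le hpos
        -- The coefficient [m - m] vanishes, so this vector is killed by e; its weight is -m - 2 <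
        -- 0, where e is injective.
        have hf0 : (f ^ (m + 1)) (v - f u) = 0 := by
          have h1 := h.e_f_pow hq0 (q_sub_inv_ne hq0 hq) m hv0
          rw [he0, map_zero, hm, sub_self, qint_zero, mul_zero, zero_smul, add_zero] at h1
          have h2 := h.f_pow_mem (m + 1) hv0
          refine h.symm.eq_zero_of_f_pow hq0 hq (k := -(k - (m + 1 : ℕ))) (by rwa [neg_neg]) 1 ?_
            (by rwa [pow_one])
          push_cast; omega
        rw [hSv]
        refine h'.eq_zero_of_f_pow hq0 hq (hS k _ hv0) (m + 1) (by push_cast; omega) ?_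
        have hfS : ∀ j : ℕ, ∀ v, (f ^ j) (S v) = S ((f ^ j) v) := by
          intro j
          induction j with
          | zero => intro v; simp
          | succ j ihj =>
            intro v
            rw [pow_succ', Module.End.mul_apply, Module.End.mul_apply, ihj, hf]
        rw [hfS, hf0, map_zero]
  exact key (N - k).toNat k (Int.self_le_toNat _) v hv

end Sl2String

/-- The k terms and the k' terms cancel separately once k and k' are moved to the right; T behaves
as a vector of weight -1, for which q + q⁻¹ is the right coefficient. -/
theorem rder_serre_eq_zero {K : Type*} [Field K] {R : Type*} [Ring R] [Algebra K R] {q x : K} (hq0 : q ≠ 0)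
    {e f T k k' : R} (hef : rder K f e = x • (k - k')) (hT : rder K f T = 0)
    (ke : k * e = q ^ 2 • (e * k)) (ke' : k' * e = (q ^ 2)⁻¹ • (e * k'))
    (kT : k * T = q⁻¹ • (T * k)) (kT' : k' * T = q • (T * k')) :
    rder K f (T * e * e + e * e * T - (q + q⁻¹) • (e * T * e)) = 0 := by
  have ke2 : ∀ y, k * (e * y) = q ^ 2 • (e * (k * y)) := fun y => by
    rw [← mul_assoc, ke, smul_mul_assoc, mul_assoc]
  have kT2 : ∀ y, k * (T * y) = q⁻¹ • (T * (k * y)) := fun y => by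
    rw [← mul_assoc, kT, smul_mul_assoc, mul_assoc]
  have ke2' : ∀ y, k' * (e * y) = (q ^ 2)⁻¹ • (e * (k' * y)) := fun y => by
    rw [← mul_assoc, ke', smul_mul_assoc, mul_assoc]
  have kT2' : ∀ y, k' * (T * y) = q • (T * (k' * y)) := fun y => by
    rw [← mul_assoc, kT', smul_mul_assoc, mul_assoc]
  simp only [map_add, map_sub, map_smul, rder_mul, hef, hT, mul_zero, zero_mul, zero_add, add_zero,
    mul_sub, sub_mul, mul_add, add_mul, mul_smul_comm, smul_mul_assoc, mul_assoc, ke, ke', kT, kT', ke2, kT2,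
    ke2', kT2', smul_sub, smul_add, smul_smul]
  match_scalars <;> field_simp <;> ring

end QAff

namespace QAff

/-! ### Endomorphisms of a weight module -/

section Total

variable {I : Type*} [Fintype I] [DecidableEq I]
variable {K : Type*} [Field K] {V : Type*} [AddCommGroup V] [Module K V] {g : Gen I → Module.End K V}

theorem IsWeightModule.bijective (hW : IsWeightModule g) :
    Function.Bijective (DirectSum.coeLinearMap (weightSpace g)) := hW

/-- The endomorphism of a weight module which is given by `x l` on the weight space of `l`. -/
noncomputable def total (hW : IsWeightModule g) (x : AffWeight I → Module.End K V) : Module.End K V :=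
  DirectSum.toModule K _ V (fun l => (x l).comp (weightSpace g l).subtype) ∘ₗ
    (LinearEquiv.ofBijective (DirectSum.coeLinearMap (weightSpace g)) hW.bijective).symm.toLinearMap

theorem total_apply (hW : IsWeightModule g) (x : AffWeight I → Module.End K V) {l : AffWeight I} {v : V}
    (hv : v ∈ weightSpace g l) : total hW x v = x l v := by
  have h1 : (LinearEquiv.ofBijective (DirectSum.coeLinearMap (weightSpace g)) hW.bijective).symm v =
      DirectSum.lof K _ _ l ⟨v, hv⟩ := by
    rw [LinearEquiv.symm_apply_eq, LinearEquiv.ofBijective_apply, DirectSum.coeLinearMap_lof]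
  rw [total, LinearMap.comp_apply, LinearEquiv.coe_coe, h1, DirectSum.toModule_lof]
  rfl

theorem total_mul_one (hW : IsWeightModule g) (x : AffWeight I → Module.End K V) (l : AffWeight I) :
    total hW x * g (.one l) = x l * g (.one l) :=
  LinearMap.ext fun v => total_apply hW x ⟨v, rfl⟩

/-- The relations are imposed over each 1_l; through this lemma they become identities in the
endomorphism ring. -/
theorem end_ext (hW : IsWeightModule g) {x y : Module.End K V}
    (h : ∀ l, x * g (.one l) = y * g (.one l)) : x = y := by
  have htop : (⨆ l, weightSpace g l) = ⊤ := hW.submodule_iSup_eq_top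
  refine LinearMap.ext fun v => ?_
  have hv : v ∈ ⨆ l, weightSpace g l := by rw [htop]; trivial
  induction hv using Submodule.iSup_induction' with
  | mem l v hv => obtain ⟨u, rfl⟩ := hv; exact LinearMap.congr_fun (h l) u
  | zero => simp
  | add u v _ _ hu hv => rw [map_add, map_add, hu, hv]

/-- A homogeneous operator which respects the idempotents. -/
structure WOp.IsHom (g : Gen I → Module.End K V) (X : WOp I (Module.End K V)) : Prop where
  right : ∀ l, X l * g (.one l) = X l
  left : ∀ l, g (.one (l + X.deg)) * X l = X l

theorem WOp.IsHom.mul {X Y : WOp I (Module.End K V)} (hX : X.IsHom g) (hY : Y.IsHom g) :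
    (X * Y).IsHom g where
  right l := by
    change X _ * Y l * _ = X _ * Y l
    rw [mul_assoc, hY.right]
  left l := by
    change g (.one (l + (X.deg + Y.deg))) * (X _ * Y l) = X _ * Y l
    rw [add_comm X.deg, ← add_assoc, ← mul_assoc, hX.left]

/-- The endomorphism given by a homogeneous operator. -/
noncomputable def WOp.tot (hW : IsWeightModule g) (X : WOp I (Module.End K V)) : Module.End K V :=
  total hW X.app

theorem WOp.IsHom.tot_mul_one (hW : IsWeightModule g) {X : WOp I (Module.End K V)} (hX : X.IsHom g)
    (l : AffWeight I) : X.tot hW * g (.one l) = X l := by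
  rw [WOp.tot, total_mul_one, hX.right]

theorem WOp.IsHom.tot_mul_app (hW : IsWeightModule g) {X Y : WOp I (Module.End K V)} (hX : X.IsHom g)
    (hY : Y.IsHom g) (l : AffWeight I) : X.tot hW * Y l = (X * Y) l := by
  rw [← hY.left, ← mul_assoc, hX.tot_mul_one hW]
  rfl

theorem WOp.IsHom.mul_tot_mul_one (hW : IsWeightModule g) {X Y : WOp I (Module.End K V)} (hX : X.IsHom g)
    (hY : Y.IsHom g) (l : AffWeight I) : X.tot hW * Y.tot hW * g (.one l) = (X * Y) l := by
  rw [mul_assoc, hY.tot_mul_one hW, hX.tot_mul_app hW hY]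

theorem WOp.IsHom.tot_mul (hW : IsWeightModule g) {X Y : WOp I (Module.End K V)} (hX : X.IsHom g)
    (hY : Y.IsHom g) : (X * Y).tot hW = X.tot hW * Y.tot hW :=
  end_ext hW fun l => by rw [(hX.mul hY).tot_mul_one hW, hX.mul_tot_mul_one hW hY]

/-- The diagonal endomorphism with eigenvalue `x l` on the weight space of `l`. -/
noncomputable def diag (hW : IsWeightModule g) (x : AffWeight I → K) : Module.End K V :=
  total hW fun l => x l • 1

theorem diag_mul_one (hW : IsWeightModule g) (x : AffWeight I → K) (l : AffWeight I) :
    diag hW x * g (.one l) = x l • g (.one l) := by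
  rw [diag, total_mul_one, smul_mul_assoc, one_mul]

theorem WOp.IsHom.diag_mul_app (hW : IsWeightModule g) (x : AffWeight I → K)
    {X : WOp I (Module.End K V)} (hX : X.IsHom g) (l : AffWeight I) :
    diag hW x * X l = x (l + X.deg) • X l := by
  rw [← hX.left, ← mul_assoc, diag_mul_one, smul_mul_assoc]

theorem diag_mul (hW : IsWeightModule g) (x y : AffWeight I → K) :
    diag hW x * diag hW y = diag hW fun l => x l * y l :=
  end_ext hW fun l => by
    rw [mul_assoc, diag_mul_one, diag_mul_one, mul_smul_comm, diag_mul_one, smul_smul, mul_comm]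

theorem diag_one (hW : IsWeightModule g) : diag hW (fun _ => 1) = 1 :=
  end_ext hW fun l => by rw [diag_mul_one, one_smul, one_mul]

theorem WOp.IsHom.diag_mul_tot (hW : IsWeightModule g) (x : AffWeight I → K)
    {X : WOp I (Module.End K V)} (hX : X.IsHom g) {a : K} (ha : ∀ l, x (l + X.deg) = a * x l) :
    diag hW x * X.tot hW = a • (X.tot hW * diag hW x) :=
  end_ext hW fun l => by
    rw [mul_assoc, hX.tot_mul_one hW, hX.diag_mul_app hW, smul_mul_assoc, mul_assoc, diag_mul_one,
      mul_smul_comm, hX.tot_mul_one hW, smul_smul, ha]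

end Total

/-! ### The generators as endomorphisms -/

section Ops

variable {I : Type*} [Fintype I] [DecidableEq I] {G : SimpleGraph I} [DecidableRel G.Adj]
variable {K : Type*} [Field K] {q : K} {c : ℕ}
variable {V : Type*} [AddCommGroup V] [Module K V] {g : Gen I → Module.End K V}

/-- All relations in `r` hold. -/
def Holds {A : Type*} (r : A → A → Prop) : Prop := ∀ x y, r x y → x = y

theorem opQ1_mul_opQ_deg {n m : ℕ} (h : m ≤ n) (i : I) :
    (opQ1 c g i (n - m) * opQ c g i m).deg = ((n : ℤ) * (c : ℤ)) • delta I := by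
  change (((n - m : ℕ) : ℤ) * (c : ℤ)) • delta I + ((m : ℤ) * (c : ℤ)) • delta I = _
  rw [← add_smul, Nat.cast_sub h]; congr 1; ring

theorem opP1_mul_opP_deg {n m : ℕ} (h : m ≤ n) (i : I) :
    (opP1 c g i (n - m) * opP c g i m).deg = -(((n : ℤ) * (c : ℤ)) • delta I) := by
  change -((((n - m : ℕ) : ℤ) * (c : ℤ)) • delta I) + -(((m : ℤ) * (c : ℤ)) • delta I) = _
  rw [← neg_add, ← add_smul, Nat.cast_sub h]; congr 2; ring

section Hom

variable (hw : Holds (WeightRel G c g))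
include hw

theorem opE_isHom (i : I) (r : ℤ) : (opE G c g i r).IsHom g :=
  ⟨fun l => hw _ _ (.E_right i r l), fun l => hw _ _ (.E_left i r l)⟩

theorem opF_isHom (i : I) (r : ℤ) : (opF G c g i r).IsHom g :=
  ⟨fun l => hw _ _ (.F_right i r l), fun l => hw _ _ (.F_left i r l)⟩

theorem opP_isHom (i : I) (n : ℕ) : (opP c g i n).IsHom g :=
  ⟨fun l => hw _ _ (.P_right i n l), fun l => hw _ _ (.P_left i n l)⟩

theorem opP1_isHom (i : I) (n : ℕ) : (opP1 c g i n).IsHom g :=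
  ⟨fun l => hw _ _ (.P1_right i n l), fun l => hw _ _ (.P1_left i n l)⟩

theorem opQ_isHom (i : I) (n : ℕ) : (opQ c g i n).IsHom g :=
  ⟨fun l => hw _ _ (.Q_right i n l), fun l => hw _ _ (.Q_left i n l)⟩

theorem opQ1_isHom (i : I) (n : ℕ) : (opQ1 c g i n).IsHom g :=
  ⟨fun l => hw _ _ (.Q1_right i n l), fun l => hw _ _ (.Q1_left i n l)⟩

theorem opQb_isHom (i : I) (n : ℕ) : (opQb q c g i n).IsHom g where
  right l := by
    simp only [opQb, Finset.sum_mul, smul_mul_assoc, ((opQ1_isHom hw _ _).mul (opQ_isHom hw _ _)).right]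
  left l := by
    simp only [opQb, Finset.mul_sum, mul_smul_comm]
    refine Finset.sum_congr rfl fun m hm => ?_
    rw [← opQ1_mul_opQ_deg (g := g) (Finset.mem_range_succ_iff.1 hm) i,
      ((opQ1_isHom hw _ _).mul (opQ_isHom hw _ _)).left]

theorem opPb_isHom (i : I) (n : ℕ) : (opPb q c g i n).IsHom g where
  right l := by
    simp only [opPb, Finset.sum_mul, smul_mul_assoc, ((opP1_isHom hw _ _).mul (opP_isHom hw _ _)).right]
  left l := by
    simp only [opPb, Finset.mul_sum, mul_smul_comm]
    refine Finset.sum_congr rfl fun m hm => ?_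
    rw [← opP1_mul_opP_deg (g := g) (Finset.mem_range_succ_iff.1 hm) i,
      ((opP1_isHom hw _ _).mul (opP_isHom hw _ _)).left]

theorem tot_opQb (hW : IsWeightModule g) (i : I) (n : ℕ) : (opQb q c g i n).tot hW =
    ∑ m ∈ Finset.range (n + 1), ((-q) ^ m * qint q (m : ℤ)) •
      ((opQ1 c g i (n - m)).tot hW * (opQ c g i m).tot hW) :=
  end_ext hW fun l => by
    rw [(opQb_isHom hw i n).tot_mul_one]
    simp only [Finset.sum_mul, smul_mul_assoc, (opQ1_isHom hw _ _).mul_tot_mul_one hW (opQ_isHom hw _ _)]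
    rfl

theorem tot_opPb (hW : IsWeightModule g) (i : I) (n : ℕ) : (opPb q c g i n).tot hW =
    ∑ m ∈ Finset.range (n + 1), ((-q) ^ (-(m : ℤ)) * qint q (m : ℤ)) •
      ((opP1 c g i (n - m)).tot hW * (opP c g i m).tot hW) :=
  end_ext hW fun l => by
    rw [(opPb_isHom hw i n).tot_mul_one]
    simp only [Finset.sum_mul, smul_mul_assoc, (opP1_isHom hw _ _).mul_tot_mul_one hW (opP_isHom hw _ _)]
    rfl

end Hom

theorem heisLike_zero (i j : I) : heisLike q G c i j 0 = 1 := by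
  have h1 : symDim q (deg2C c) 0 = 1 := by
    rw [symDim, Fintype.sum_unique, Subsingleton.elim default Sym.nil]
    simp
  unfold heisLike
  split_ifs with h h' h''
  · exact h1
  · simp [extDim]
  · rfl
  · exact absurd rfl h''

section Heis

variable (hw : Holds (WeightRel G c g)) (hh : Holds (HeisRel G q c g)) (hW : IsWeightModule g)
include hw hh

theorem tot_opQ_zero (i : I) : (opQ c g i 0).tot hW = 1 :=
  end_ext hW fun l => by rw [(opQ_isHom hw i 0).tot_mul_one, hh _ _ (.Q_zero i l), one_mul]

theorem tot_opQ1_zero (i : I) : (opQ1 c g i 0).tot hW = 1 :=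
  end_ext hW fun l => by rw [(opQ1_isHom hw i 0).tot_mul_one, hh _ _ (.Q1_zero i l), one_mul]

theorem tot_opP_zero (i : I) : (opP c g i 0).tot hW = 1 :=
  end_ext hW fun l => by rw [(opP_isHom hw i 0).tot_mul_one, hh _ _ (.P_zero i l), one_mul]

theorem tot_opP1_zero (i : I) : (opP1 c g i 0).tot hW = 1 :=
  end_ext hW fun l => by rw [(opP1_isHom hw i 0).tot_mul_one, hh _ _ (.P1_zero i l), one_mul]

theorem tot_Q_inv (i : I) {n : ℕ} (hn : 0 < n) :
    ∑ k ∈ Finset.range (n + 1), (-1 : K) ^ k • ((opQ1 c g i k).tot hW * (opQ c g i (n - k)).tot hW) = 0 :=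
  end_ext hW fun l => by
    rw [zero_mul, ← hh _ _ (.Q_inv i n hn l)]
    simp only [Finset.sum_mul, smul_mul_assoc, (opQ1_isHom hw _ _).mul_tot_mul_one hW (opQ_isHom hw _ _)]

theorem tot_P_inv (i : I) {n : ℕ} (hn : 0 < n) :
    ∑ k ∈ Finset.range (n + 1), (-1 : K) ^ k • ((opP1 c g i k).tot hW * (opP c g i (n - k)).tot hW) = 0 :=
  end_ext hW fun l => by
    rw [zero_mul, ← hh _ _ (.P_inv i n hn l)]
    simp only [Finset.sum_mul, smul_mul_assoc, (opP1_isHom hw _ _).mul_tot_mul_one hW (opP_isHom hw _ _)]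

theorem tot_Q_P_one (i j : I) :
    (opQ c g j 1).tot hW * (opP c g i 1).tot hW =
      (opP c g i 1).tot hW * (opQ c g j 1).tot hW + heisLike q G c i j 1 • 1 :=
  end_ext hW fun l => by
    rw [(opQ_isHom hw _ _).mul_tot_mul_one hW (opP_isHom hw _ _), hh _ _ (.Q_P i j 1 1 l), min_self,
      Finset.sum_range_succ, Finset.sum_range_one, heisLike_zero, one_smul, add_mul,
      (opP_isHom hw _ _).mul_tot_mul_one hW (opQ_isHom hw _ _), ← (opP_isHom hw _ _).mul_tot_mul_one hW
      (opQ_isHom hw _ (1 - 1)), Nat.sub_self, tot_opP_zero hw hh, tot_opQ_zero hw hh, smul_mul_assoc, one_mul]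

theorem tot_opQb_one (hκ : q - q⁻¹ ≠ 0) (i : I) :
    (opQb q c g i 1).tot hW = -(q • (opQ c g i 1).tot hW) := by
  rw [tot_opQb hw, Finset.sum_range_succ, Finset.sum_range_one]
  simp [qint_zero, qint_one hκ, tot_opQ1_zero hw hh]

theorem tot_opPb_one (hκ : q - q⁻¹ ≠ 0) (i : I) :
    (opPb q c g i 1).tot hW = -(q⁻¹ • (opP c g i 1).tot hW) := by
  rw [tot_opPb hw, Finset.sum_range_succ, Finset.sum_range_one]
  simp [qint_zero, qint_one hκ, tot_opP1_zero hw hh]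

end Heis

end Ops
end QAff

namespace QAff

/-! ### A weight module as a system of currents -/

section Realize

variable {I : Type*} [Fintype I] [DecidableEq I] {G : SimpleGraph I} [DecidableRel G.Adj]
variable {K : Type*} [Field K] {q : K} {c : ℕ}
variable {V : Type*} [AddCommGroup V] [Module K V] {g : Gen I → Module.End K V}

theorem pair_add_E (l : AffWeight I) (i j : I) (r : ℤ) :
    pair (l + (opE G c g j r).deg) i = pair l i + cartan G j i := by
  simp [pair, opE, simpleRoot, delta]

theorem pair_add_F (l : AffWeight I) (i j : I) (r : ℤ) :
    pair (l + (opF G c g j r).deg) i = pair l i - cartan G j i := by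
  simp [pair, opF, simpleRoot, delta, sub_eq_add_neg]

theorem pair_add_Qb (l : AffWeight I) (i j : I) (n : ℕ) :
    pair (l + (opQb q c g j n).deg) i = pair l i := by
  simp [pair, opQb, delta]

theorem pair_add_Pb (l : AffWeight I) (i j : I) (n : ℕ) :
    pair (l + (opPb q c g j n).deg) i = pair l i := by
  simp [pair, opPb, delta]

/-- The operator `q^(h_i)`. -/
noncomputable def kOp (q : K) (hW : IsWeightModule g) (i : I) : Module.End K V :=
  diag hW fun l => q ^ pair l i

/-- The operator `q^(-h_i)`. -/
noncomputable def kInv (q : K) (hW : IsWeightModule g) (i : I) : Module.End K V :=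
  diag hW fun l => q ^ (-pair l i)

theorem kOp_mul_kInv (hq0 : q ≠ 0) (hW : IsWeightModule g) (i : I) : kOp q hW i * kInv q hW i = 1 := by
  rw [kOp, kInv, diag_mul, ← diag_one hW]
  congr 1; funext l
  rw [← zpow_add₀ hq0, add_neg_cancel, zpow_zero]

theorem kInv_mul_kOp (hq0 : q ≠ 0) (hW : IsWeightModule g) (i : I) : kInv q hW i * kOp q hW i = 1 := by
  rw [kOp, kInv, diag_mul, ← diag_one hW]
  congr 1; funext l
  rw [← zpow_add₀ hq0, neg_add_cancel, zpow_zero]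

theorem diag_comm (hW : IsWeightModule g) (x y : AffWeight I → K) :
    diag hW x * diag hW y = diag hW y * diag hW x := by
  rw [diag_mul, diag_mul]; congr 1; funext l; rw [mul_comm]

section Weight

variable (hq0 : q ≠ 0) (hw : Holds (WeightRel G c g)) (hW : IsWeightModule g)
include hq0 hw

theorem kOp_E (j i : I) (m : ℤ) : kOp q hW j * (opE G c g i m).tot hW =
    q ^ cartan G j i • ((opE G c g i m).tot hW * kOp q hW j) :=
  (opE_isHom hw i m).diag_mul_tot hW _ fun l => by
    rw [pair_add_E, cartan_symm, add_comm, zpow_add₀ hq0]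

theorem kOp_F (j i : I) (m : ℤ) : kOp q hW j * (opF G c g i m).tot hW =
    q ^ (-cartan G j i) • ((opF G c g i m).tot hW * kOp q hW j) :=
  (opF_isHom hw i m).diag_mul_tot hW _ fun l => by
    rw [pair_add_F, cartan_symm, sub_eq_neg_add, zpow_add₀ hq0]

theorem kOp_Qb (j i : I) (n : ℕ) : kOp q hW j * (opQb q c g i n).tot hW =
    (opQb q c g i n).tot hW * kOp q hW j := by
  rw [kOp, (opQb_isHom hw i n).diag_mul_tot hW _ (a := 1) fun l => by rw [pair_add_Qb, one_mul], one_smul]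

theorem kInv_Qb (j i : I) (n : ℕ) : kInv q hW j * (opQb q c g i n).tot hW =
    (opQb q c g i n).tot hW * kInv q hW j := by
  rw [kInv, (opQb_isHom hw i n).diag_mul_tot hW _ (a := 1) fun l => by rw [pair_add_Qb, one_mul], one_smul]

theorem kOp_Pb (j i : I) (n : ℕ) : kOp q hW j * (opPb q c g i n).tot hW =
    (opPb q c g i n).tot hW * kOp q hW j := by
  rw [kOp, (opPb_isHom hw i n).diag_mul_tot hW _ (a := 1) fun l => by rw [pair_add_Pb, one_mul], one_smul]

end Weight

/-- The coefficients of the Cartan current `ψ_i`. -/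
noncomputable def psiOp (q : K) (c : ℕ) (hW : IsWeightModule g) (i : I) (n : ℤ) : Module.End K V :=
  if n < 0 then 0 else if n = 0 then kOp q hW i else
    (q - q⁻¹) • (kOp q hW i * (opQb q c g i n.toNat).tot hW)

/-- The coefficients of the Cartan current `φ_i`. -/
noncomputable def phiOp (q : K) (c : ℕ) (hW : IsWeightModule g) (i : I) (n : ℤ) : Module.End K V :=
  if 0 < n then 0 else if n = 0 then kInv q hW i else
    -(q - q⁻¹) • (kInv q hW i * (opPb q c g i (-n).toNat).tot hW)

theorem psiOp_zero (hW : IsWeightModule g) (i : I) : psiOp q c hW i 0 = kOp q hW i := by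
  simp [psiOp]

theorem phiOp_zero (hW : IsWeightModule g) (i : I) : phiOp q c hW i 0 = kInv q hW i := by
  simp [phiOp]

theorem psiOp_pos (hW : IsWeightModule g) (i : I) {n : ℤ} (hn : 0 < n) : psiOp q c hW i n =
    (q - q⁻¹) • (kOp q hW i * (opQb q c g i n.toNat).tot hW) := by
  rw [psiOp, if_neg hn.not_gt, if_neg hn.ne']

theorem phiOp_neg (hW : IsWeightModule g) (i : I) {n : ℤ} (hn : n < 0) : phiOp q c hW i n =
    -(q - q⁻¹) • (kInv q hW i * (opPb q c g i (-n).toNat).tot hW) := by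
  rw [phiOp, if_neg hn.not_gt, if_neg hn.ne]

variable (hq0 : q ≠ 0) (hκ : q - q⁻¹ ≠ 0) (hB : Holds (BaseRel G q c g)) (hW : IsWeightModule g)

theorem Holds.weight (hB : Holds (BaseRel G q c g)) : Holds (WeightRel G c g) :=
  fun x y h => hB x y (.weight x y h)

theorem Holds.heis (hB : Holds (BaseRel G q c g)) : Holds (HeisRel G q c g) :=
  fun x y h => hB x y (.heis x y h)

include hq0 hκ hB in
-- The three cases of the E–F relation become one formula when q^(±h_i) and the factors ±(q - q⁻¹)
-- are absorbed in ψ_i and φ_i. These diagonal operators commute with Q^[1ⁿ] and P^[1ⁿ], whose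
-- weights are multiples of δ.
theorem EF_tot (i : I) (a b : ℤ) :
    (opE G c g i a).tot hW * (opF G c g i b).tot hW - (opF G c g i b).tot hW * (opE G c g i a).tot hW =
      (q - q⁻¹)⁻¹ • ((q ^ c) ^ a • psiOp q c hW i (a + b) - (q ^ c) ^ b • phiOp q c hW i (a + b)) := by
  refine end_ext hW fun l => ?_
  have hE := opE_isHom hB.weight i a
  have hF := opF_isHom hB.weight i b
  have hpow : ∀ a : ℤ, (q ^ c) ^ a = q ^ (a * (c : ℤ)) := fun a => by
    rw [← zpow_natCast q c, ← zpow_mul, mul_comm]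
  rw [sub_mul, hE.mul_tot_mul_one hW hF, hF.mul_tot_mul_one hW hE, hpow, hpow]
  rcases lt_trichotomy (a + b) 0 with h | h | h
  · rw [hB _ _ (.ef _ _ (.neg i a b h l)), phiOp_neg hW i h, psiOp, if_pos h, smul_zero, zero_sub]
    simp only [neg_smul, smul_neg, neg_neg, smul_mul_assoc]
    rw [mul_assoc, (opPb_isHom hB.weight i _).tot_mul_one hW, kInv, (opPb_isHom hB.weight i _).diag_mul_app hW,
      pair_add_Pb, smul_smul, smul_smul, smul_smul, show -(a + b) = -a - b by ring]
    congr 1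
    generalize q - q⁻¹ = κ at *
    field_simp
  · rw [hB _ _ (.ef _ _ (.zero i a b h l)), h, psiOp_zero, phiOp_zero, smul_mul_assoc, sub_mul, smul_mul_assoc,
      smul_mul_assoc, kOp, kInv, diag_mul_one, diag_mul_one, smul_smul, smul_smul, ← sub_smul, smul_smul,
      qint, ← zpow_add₀ hq0, ← zpow_add₀ hq0, show b = -a by omega, div_eq_inv_mul]
    congr 3
    · ring_nf
    · ring_nf
  · rw [hB _ _ (.ef _ _ (.pos i a b h l)), psiOp_pos hW i h, phiOp, if_pos h, smul_zero, sub_zero,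
      smul_mul_assoc, smul_mul_assoc, smul_mul_assoc, mul_assoc,
      (opQb_isHom hB.weight i _).tot_mul_one hW, kOp, (opQb_isHom hB.weight i _).diag_mul_app hW,
      pair_add_Qb, smul_smul, smul_smul, smul_smul]
    congr 1
    generalize q - q⁻¹ = κ at *
    field_simp

include hB in
theorem EF_tot_ne (i j : I) (hij : i ≠ j) (a b : ℤ) :
    (opE G c g i a).tot hW * (opF G c g j b).tot hW = (opF G c g j b).tot hW * (opE G c g i a).tot hW := by
  have hE := opE_isHom hB.weight i a
  have hF := opF_isHom hB.weight j b
  refine end_ext hW fun l => ?_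
  rw [hE.mul_tot_mul_one hW hF, hF.mul_tot_mul_one hW hE]
  exact sub_eq_zero.1 (hB _ _ (.ef _ _ (.ne i j hij a b l)))

/-- A weight module over the algebra with the reduced relations, in terms of currents. -/
noncomputable def realize (hS : Holds (SerreEqRel G q c g)) :
    Currents G q (q ^ c) 0 (Module.End K V) where
  E i m := (opE G c g i m).tot hW
  F i m := (opF G c g i m).tot hW
  ψ i n := psiOp q c hW i n
  φ i n := phiOp q c hW i n
  ψ_neg i n h := by rw [psiOp, if_pos h]
  φ_pos i n h := by rw [phiOp, if_pos h]
  ψφ i := by rw [psiOp_zero, phiOp_zero, kOp_mul_kInv hq0]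
  φψ i := by rw [psiOp_zero, phiOp_zero, kInv_mul_kOp hq0]
  kE j i m := by rw [psiOp_zero, kOp_E hq0 hB.weight]
  kF j i m := by rw [psiOp_zero, kOp_F hq0 hB.weight]
  kψ j i m := by
    rw [psiOp_zero, psiOp]
    split_ifs
    · rw [mul_zero, zero_mul]
    · exact diag_comm hW _ _
    · rw [mul_smul_comm, smul_mul_assoc, mul_assoc, ← kOp_Qb hq0 hB.weight, ← mul_assoc, ← mul_assoc]
      congr 2; exact diag_comm hW _ _
  kφ j i m := by
    rw [psiOp_zero, phiOp]
    split_ifs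
    · rw [mul_zero, zero_mul]
    · exact diag_comm hW _ _
    · rw [mul_smul_comm, smul_mul_assoc, mul_assoc, ← kOp_Pb hq0 hB.weight, ← mul_assoc, ← mul_assoc]
      congr 2; exact diag_comm hW _ _
  EF i a b := EF_tot hq0 hκ hB hW i a b
  EF_ne i j h a b := EF_tot_ne hB hW i j h a b
  EE i n := by
    have hE := opE_isHom hB.weight
    refine end_ext hW fun l => ?_
    have h1 := hB _ _ (.EE i (n + 1) l)
    rw [add_sub_cancel_right] at h1
    rw [smul_mul_assoc, (hE _ _).mul_tot_mul_one hW (hE _ _), (hE _ _).mul_tot_mul_one hW (hE _ _), h1]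
  FF i n := by
    have hF := opF_isHom hB.weight
    refine end_ext hW fun l => ?_
    have h1 := hB _ _ (.FF i (n + 1) l)
    rw [add_sub_cancel_right] at h1
    rw [smul_mul_assoc, (hF _ _).mul_tot_mul_one hW (hF _ _), (hF _ _).mul_tot_mul_one hW (hF _ _), h1]
  -- The relation imposed on E_{i,1}, E_{j,0} is the one at base position 0.
  EE_adj i j h := by
    have hE := opE_isHom hB.weight
    refine end_ext hW fun l => ?_
    have h1 := hB _ _ (.EE_adj i j h l)
    simp only [smul_mul_assoc, add_mul, (hE _ _).mul_tot_mul_one hW (hE _ _), zero_add, h1]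
  FF_adj i j h := by
    have hF := opF_isHom hB.weight
    refine end_ext hW fun l => ?_
    have h1 := hB _ _ (.FF_adj i j h l)
    simp only [smul_mul_assoc, add_mul, (hF _ _).mul_tot_mul_one hW (hF _ _), neg_zero, zero_sub]
    rw [h1, smul_smul, mul_inv_cancel₀ hq0, one_smul]
  EE_far i j hne h m n := by
    have hE := opE_isHom hB.weight
    refine end_ext hW fun l => ?_
    rw [(hE _ _).mul_tot_mul_one hW (hE _ _), (hE _ _).mul_tot_mul_one hW (hE _ _)]
    exact hB _ _ (.far _ _ (.E i j hne h m n l))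
  FF_far i j hne h m n := by
    have hF := opF_isHom hB.weight
    refine end_ext hW fun l => ?_
    rw [(hF _ _).mul_tot_mul_one hW (hF _ _), (hF _ _).mul_tot_mul_one hW (hF _ _)]
    exact hB _ _ (.far _ _ (.F i j hne h m n l))
  EEE i j h m n := by
    have hE := opE_isHom hB.weight
    refine end_ext hW fun l => ?_
    have h1 := hS _ _ (.E i j h m n l)
    rw [qint_two hq0 hκ] at h1
    simp only [smul_mul_assoc, add_mul, ← (hE _ _).tot_mul hW (hE _ _),
      ((hE _ _).mul (hE _ _)).mul_tot_mul_one hW (hE _ _), h1]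
  FFF i j h m n := by
    have hF := opF_isHom hB.weight
    refine end_ext hW fun l => ?_
    have h1 := hS _ _ (.F i j h m n l)
    rw [qint_two hq0 hκ] at h1
    simp only [smul_mul_assoc, add_mul, ← (hF _ _).tot_mul hW (hF _ _),
      ((hF _ _).mul (hF _ _)).mul_tot_mul_one hW (hF _ _), h1]
  ψφ_heis i j := by
    have hw := hB.weight
    have hh := hB.heis
    -- The factors q - q⁻¹ of ψ_{j,1} and -(q - q⁻¹) of φ_{i,-1} multiply; the factors -q and -q⁻¹
    -- in Q^[1] = -qQ⁽¹⁾ and P^[1] = -q⁻¹P⁽¹⁾ cancel.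
    refine ⟨-(q - q⁻¹) ^ 2 * heisLike q G c i j 1, ?_⟩
    rw [psiOp_pos hW j one_pos, phiOp_neg hW i (by norm_num), psiOp_zero, phiOp_zero, neg_neg, Int.toNat_one]
    rw [smul_mul_smul_comm, smul_mul_smul_comm]
    have e1 : kOp q hW j * (opQb q c g j 1).tot hW * (kInv q hW i * (opPb q c g i 1).tot hW) =
        kOp q hW j * kInv q hW i * ((opQb q c g j 1).tot hW * (opPb q c g i 1).tot hW) := by
      simp only [mul_assoc]; rw [← mul_assoc _ (kInv q hW i), ← kInv_Qb hq0 hw, mul_assoc]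
    have e2 : kInv q hW i * (opPb q c g i 1).tot hW * (kOp q hW j * (opQb q c g j 1).tot hW) =
        kOp q hW j * kInv q hW i * ((opPb q c g i 1).tot hW * (opQb q c g j 1).tot hW) := by
      simp only [mul_assoc]; rw [← mul_assoc _ (kOp q hW j), ← kOp_Pb hq0 hw, mul_assoc, ← mul_assoc,
        ← mul_assoc (kOp q hW j)]
      congr 1; exact diag_comm hW _ _
    rw [e1, e2, tot_opQb_one hw hh hW hκ, tot_opPb_one hw hh hW hκ, neg_mul_neg, neg_mul_neg,
      smul_mul_smul_comm, smul_mul_smul_comm, tot_Q_P_one hw hh]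
    simp only [mul_smul_comm, mul_add, smul_add, mul_one, mul_inv_cancel₀ hq0, inv_mul_cancel₀ hq0, one_smul]
    module

end Realize
end QAff

namespace QAff

/-! ### The Serre relation on integrable modules -/

section Integrable

variable {I : Type*} [Fintype I] [DecidableEq I] {G : SimpleGraph I} [DecidableRel G.Adj]
variable {K : Type*} [Field K] {q : K} {c : ℕ}
variable {V : Type*} [AddCommGroup V] [Module K V] {g : Gen I → Module.End K V}

theorem WOp.IsHom.tot_mem (hW : IsWeightModule g) {X : WOp I (Module.End K V)} (hX : X.IsHom g)
    {l : AffWeight I} {v : V} (hv : v ∈ weightSpace g l) : X.tot hW v ∈ weightSpace g (l + X.deg) := by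
  obtain ⟨u, rfl⟩ := hv
  rw [← Module.End.mul_apply, hX.tot_mul_one hW, ← hX.left]
  exact ⟨_, rfl⟩

/-- In an integrable module, an operator which commutes with the lowering operator `Y` of a copy of
`U_q(sl₂)` and has weight `-1` satisfies the Serre relation with the raising operator `X`. -/
theorem serre_of_integrable (hq0 : q ≠ 0) (hq : ∀ n : ℕ, 0 < n → q ^ n ≠ 1) (hW : IsWeightModule g)
    {X Y Z : WOp I (Module.End K V)} (hX : X.IsHom g) (hY : Y.IsHom g) (hZ : Z.IsHom g)
    (hXY : Y.deg = -X.deg) (ht : AffWeight I → ℤ) (htX : ∀ l, ht (l + X.deg) = ht l + 2)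
    (htZ : ∀ l, ht (l + Z.deg) = ht l - 1)
    (hcomm : ∀ l, (X * Y) l - (Y * X) l = qint q (ht l) • g (.one l))
    (hZY : ∀ l, (Z * Y) l = (Y * Z) l)
    (hbdd : ∀ l, ∃ N : ℤ, ∀ n : ℤ, N ≤ |n| → weightSpace g (l + n • X.deg) = ⊥) (l : AffWeight I) :
    (Z * X * X) l + (X * X * Z) l = qint q 2 • (X * Z * X) l := by
  have hκ := q_sub_inv_ne hq0 hq
  have hXY' : X.tot hW * Y.tot hW - Y.tot hW * X.tot hW = diag hW fun l => qint q (ht l) :=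
    end_ext hW fun l => by
      rw [sub_mul, hX.mul_tot_mul_one hW hY, hY.mul_tot_mul_one hW hX, hcomm, diag_mul_one]
  have htk : ∀ (k : ℤ) l, ht (l + k • X.deg) = ht l + 2 * k := fun k l => by
    induction k using Int.induction_on with
    | zero => simp
    | succ k ih => rw [add_smul, one_smul, ← add_assoc, htX, ih]; ring
    | pred k ih =>
      have := htX (l + (-(k : ℤ) - 1) • X.deg)
      rw [add_assoc, ← add_one_zsmul, sub_add_cancel, ih] at this
      linarith
  -- The weight spaces along the line through l in the direction of X; integrability makes the
  -- string bounded.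
  have hstr : ∀ l, Sl2String q (X.tot hW) (Y.tot hW) (fun k => weightSpace g (l + k • X.deg)) (ht l) := by
    intro l
    refine ⟨fun k v hv => ?_, fun k v hv => ?_, fun k v hv => ?_, hbdd l⟩
    · rw [add_smul, one_smul, ← add_assoc]
      exact hX.tot_mem hW hv
    · rw [sub_smul, one_smul, sub_eq_add_neg, ← add_assoc, ← hXY]
      exact hY.tot_mem hW hv
    · obtain ⟨u, rfl⟩ := hv
      have h1 := LinearMap.congr_fun (congrArg (· * g (.one (l + k • X.deg))) hXY') u
      simp only [diag_mul_one, htk, sub_mul] at h1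
      exact sub_eq_iff_eq_add'.1 h1
  set S := Z.tot hW * X.tot hW * X.tot hW + X.tot hW * X.tot hW * Z.tot hW -
    (q + q⁻¹) • (X.tot hW * Z.tot hW * X.tot hW) with hS
  have hSmem : ∀ l, ∀ v ∈ weightSpace g l, S v ∈ weightSpace g (l + (X.deg + X.deg + Z.deg)) := by
    intro l v hv
    refine sub_mem (add_mem ?_ ?_) (Submodule.smul_mem _ _ ?_)
    · have := hZ.tot_mem hW (hX.tot_mem hW (hX.tot_mem hW hv))
      rwa [add_assoc, add_assoc, ← add_assoc X.deg] at this
    · have := hX.tot_mem hW (hX.tot_mem hW (hZ.tot_mem hW hv))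
      rwa [add_assoc, add_assoc, add_comm Z.deg] at this
    · have := hX.tot_mem hW (hZ.tot_mem hW (hX.tot_mem hW hv))
      rwa [add_assoc, add_assoc, add_comm Z.deg, ← add_assoc X.deg] at this
  have hSf : rder K (Y.tot hW) S = 0 := by
    rw [hS]
    refine rder_serre_eq_zero hq0 (x := (q - q⁻¹)⁻¹) (k := diag hW fun l => q ^ ht l)
      (k' := diag hW fun l => q ^ (-ht l)) ?_ ?_ ?_ ?_ ?_ ?_
    · rw [rder_apply, hXY']
      refine end_ext hW fun l => ?_
      rw [smul_mul_assoc, sub_mul, diag_mul_one, diag_mul_one, diag_mul_one, ← sub_smul, smul_smul, qint,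
        div_eq_inv_mul]
    · rw [rder_eq_zero]
      exact end_ext hW fun l => by rw [hZ.mul_tot_mul_one hW hY, hY.mul_tot_mul_one hW hZ, hZY]
    · exact hX.diag_mul_tot hW _ fun l => by rw [htX, add_comm, zpow_add₀ hq0]; norm_cast
    · exact hX.diag_mul_tot hW _ fun l => by
        rw [htX, add_comm, neg_add, zpow_add₀ hq0, zpow_neg q 2]; norm_cast
    · exact hZ.diag_mul_tot hW _ fun l => by rw [htZ, sub_eq_neg_add, zpow_add₀ hq0, zpow_neg_one]
    · exact hZ.diag_mul_tot hW _ fun l => by rw [htZ, neg_sub, sub_eq_add_neg, zpow_add₀ hq0, zpow_one]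
  have hS0 : S * g (.one l) = 0 := by
    refine LinearMap.ext fun u => ?_
    -- Two raising operators and one Z of weight -1: S carries the string of l to a string whose
    -- weights are larger by 3.
    have h3 : ht (l + (X.deg + X.deg + Z.deg)) = ht l + 3 := by
      rw [← add_assoc, ← add_assoc, htZ, htX, htX]; ring
    have h' := hstr (l + (X.deg + X.deg + Z.deg))
    rw [h3] at h'
    refine (hstr l).intertwiner_eq_zero hq0 hq h' S (fun k v hv => ?_)
      (fun v => LinearMap.congr_fun (rder_eq_zero.1 hSf) v) (k := 0) (v := g (.one l) u) ?_
    · have := hSmem _ v hv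
      rwa [add_right_comm] at this
    · rw [zero_smul, add_zero]; exact ⟨u, rfl⟩
  rw [hS] at hS0
  simp only [sub_mul, add_mul, smul_mul_assoc, ← hX.tot_mul hW hX, ← hZ.tot_mul hW hX, ← hX.tot_mul hW hZ,
    (hX.mul hX).mul_tot_mul_one hW hZ, (hZ.mul hX).mul_tot_mul_one hW hX,
    (hX.mul hZ).mul_tot_mul_one hW hX] at hS0
  rw [qint_two hq0 hκ]
  exact sub_eq_zero.1 hS0

theorem isRealRoot_simpleRoot (i : I) (k : ℤ) : IsRealRoot G (simpleRoot G i + k • delta I) := by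
  refine ⟨Pi.single i 1, k, ?_, ?_⟩
  · simp [Pi.single_apply, cartan_self]
  · simp [Pi.single_apply]

theorem isRealRoot_neg_simpleRoot (i : I) (k : ℤ) : IsRealRoot G (-simpleRoot G i + k • delta I) := by
  refine ⟨Pi.single i (-1), k, ?_, ?_⟩
  · simp [Pi.single_apply, cartan_self]
  · simp [Pi.single_apply]

/-- E_{i,m} and F_{i,-m} form a copy of U_q(sl₂) for the real root α_i + mcδ, with weight ⟨l, α_i⟩ +
mc, and E_{j,n} commutes with its lowering operator. For the F's the raising operator is F_{i,m},
with root -α_i + mcδ and weight -⟨l, α_i⟩ + mc. -/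
theorem serreEq_of_isIntegrable (hq0 : q ≠ 0) (hq : ∀ n : ℕ, 0 < n → q ^ n ≠ 1)
    (hB : Holds (BaseRel G q c g)) (hW : IsWeightModule g) (hI : IsIntegrable G g) :
    Holds (SerreEqRel G q c g) := by
  have hE := opE_isHom hB.weight
  have hF := opF_isHom hB.weight
  rintro x y (⟨i, j, hij, m, n, l⟩ | ⟨i, j, hij, m, n, l⟩)
  · refine serre_of_integrable hq0 hq hW (hE i m) (hF i (-m)) (hE j n) ?_
      (fun l => pair l i + m * c) (fun l => ?_) (fun l => ?_) (fun l => ?_) (fun l => ?_) (fun l => ?_) l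
    · simp only [opE, opF, neg_mul, neg_smul, neg_add]
    · rw [pair_add_E, cartan_self]; ring
    · rw [pair_add_E, cartan_adj G hij.symm]; ring
    · exact hB _ _ (.ef _ _ (.zero i m (-m) (add_neg_cancel m) l))
    · exact sub_eq_zero.1 (hB _ _ (.ef _ _ (.ne j i hij.ne' n (-m) l)))
    · exact hI l _ (isRealRoot_simpleRoot i _)
  · refine serre_of_integrable hq0 hq hW (hF i m) (hE i (-m)) (hF j n) ?_
      (fun l => -pair l i + m * c) (fun l => ?_) (fun l => ?_) (fun l => ?_) (fun l => ?_) (fun l => ?_) l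
    · simp only [opE, opF, neg_mul, neg_smul, neg_add, neg_neg]
    · rw [pair_add_F, cartan_self]; ring
    · rw [pair_add_F, cartan_adj G hij.symm]; ring
    · rw [← neg_sub, hB _ _ (.ef _ _ (.zero i (-m) m (neg_add_cancel m) l)), ← neg_smul, ← qint_neg]
      congr 2; ring
    · exact (sub_eq_zero.1 (hB _ _ (.ef _ _ (.ne i j hij.ne (-m) n l)))).symm
    · exact hI l _ (isRealRoot_neg_simpleRoot i _)

end Integrable
end QAff

namespace QAff

/-! ### Transport of relations along algebra homomorphisms -/

section Functoriality

variable {I : Type*} [DecidableEq I] {G : SimpleGraph I} [DecidableRel G.Adj]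
variable {K : Type*} [Field K] {q : K} {c : ℕ}
variable {A B : Type*} [Ring A] [Algebra K A] [Ring B] [Algebra K B] (f : A →ₐ[K] B) (g : Gen I → A)

/-- The image of a homogeneous operator under a homomorphism. -/
def WOp.map (X : WOp I A) : WOp I B := ⟨X.deg, fun l => f (X l)⟩

theorem WOp.map_app (X : WOp I A) (l : AffWeight I) : f (X l) = (X.map f) l := rfl

theorem WOp.map_mul (X Y : WOp I A) : (X * Y).map f = X.map f * Y.map f := by
  change WOp.mk _ _ = WOp.mk _ _
  congr 1
  funext l
  exact _root_.map_mul f _ _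

theorem map_opE (i : I) (r : ℤ) : (opE G c g i r).map f = opE G c (f ∘ g) i r := rfl

theorem map_opF (i : I) (r : ℤ) : (opF G c g i r).map f = opF G c (f ∘ g) i r := rfl

theorem map_opP (i : I) (n : ℕ) : (opP c g i n).map f = opP c (f ∘ g) i n := rfl

theorem map_opP1 (i : I) (n : ℕ) : (opP1 c g i n).map f = opP1 c (f ∘ g) i n := rfl

theorem map_opQ (i : I) (n : ℕ) : (opQ c g i n).map f = opQ c (f ∘ g) i n := rfl

theorem map_opQ1 (i : I) (n : ℕ) : (opQ1 c g i n).map f = opQ1 c (f ∘ g) i n := rfl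

theorem map_opQb (i : I) (n : ℕ) : (opQb q c g i n).map f = opQb q c (f ∘ g) i n := by
  unfold WOp.map opQb
  congr 1
  funext l
  simp only [map_sum, map_smul, WOp.map_app f, WOp.map_mul, map_opQ, map_opQ1]

theorem map_opPb (i : I) (n : ℕ) : (opPb q c g i n).map f = opPb q c (f ∘ g) i n := by
  unfold WOp.map opPb
  congr 1
  funext l
  simp only [map_sum, map_smul, WOp.map_app f, WOp.map_mul, map_opP, map_opP1]

variable {f g}

/-- Relations are required only after applying f, so this covers both quotient maps from the free
algebra and representations. -/
theorem holds_weightRel (h : ∀ x y, WeightRel G c g x y → f x = f y) : Holds (WeightRel G c (f ∘ g)) := by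
  intro x y hxy
  cases hxy with
  | idem l => exact (map_mul f _ _).symm.trans (h _ _ (.idem l))
  | orth l m hlm => simpa only [map_add, map_sub, map_neg, map_smul, map_sum, map_mul, map_zero, WOp.map_app f, WOp.map_mul, map_opE, map_opF, map_opP,
    map_opP1, map_opQ, map_opQ1, map_opQb, map_opPb, ← Function.comp_apply (f := f) (g := g)] using h _ _ (.orth l m hlm)
  | E_right i r l => exact (map_mul f _ _).symm.trans (h _ _ (.E_right i r l))
  | E_left i r l => exact (map_mul f _ _).symm.trans (h _ _ (.E_left i r l))
  | F_right i r l => exact (map_mul f _ _).symm.trans (h _ _ (.F_right i r l))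
  | F_left i r l => exact (map_mul f _ _).symm.trans (h _ _ (.F_left i r l))
  | P_right i r l => exact (map_mul f _ _).symm.trans (h _ _ (.P_right i r l))
  | P_left i r l => exact (map_mul f _ _).symm.trans (h _ _ (.P_left i r l))
  | P1_right i r l => exact (map_mul f _ _).symm.trans (h _ _ (.P1_right i r l))
  | P1_left i r l => exact (map_mul f _ _).symm.trans (h _ _ (.P1_left i r l))
  | Q_right i r l => exact (map_mul f _ _).symm.trans (h _ _ (.Q_right i r l))
  | Q_left i r l => exact (map_mul f _ _).symm.trans (h _ _ (.Q_left i r l))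
  | Q1_right i r l => exact (map_mul f _ _).symm.trans (h _ _ (.Q1_right i r l))
  | Q1_left i r l => exact (map_mul f _ _).symm.trans (h _ _ (.Q1_left i r l))

theorem holds_heisRel (h : ∀ x y, HeisRel G q c g x y → f x = f y) : Holds (HeisRel G q c (f ∘ g)) := by
  intro x y hxy
  cases hxy with
  | Q_zero i l => simpa only [map_add, map_sub, map_neg, map_smul, map_sum, map_mul, map_zero, WOp.map_app f, WOp.map_mul, map_opE, map_opF, map_opP,
    map_opP1, map_opQ, map_opQ1, map_opQb, map_opPb, ← Function.comp_apply (f := f) (g := g)] using h _ _ (.Q_zero i l)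
  | Q1_zero i l => simpa only [map_add, map_sub, map_neg, map_smul, map_sum, map_mul, map_zero, WOp.map_app f, WOp.map_mul, map_opE, map_opF, map_opP,
    map_opP1, map_opQ, map_opQ1, map_opQb, map_opPb, ← Function.comp_apply (f := f) (g := g)] using h _ _ (.Q1_zero i l)
  | P_zero i l => simpa only [map_add, map_sub, map_neg, map_smul, map_sum, map_mul, map_zero, WOp.map_app f, WOp.map_mul, map_opE, map_opF, map_opP,
    map_opP1, map_opQ, map_opQ1, map_opQb, map_opPb, ← Function.comp_apply (f := f) (g := g)] using h _ _ (.P_zero i l)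
  | P1_zero i l => simpa only [map_add, map_sub, map_neg, map_smul, map_sum, map_mul, map_zero, WOp.map_app f, WOp.map_mul, map_opE, map_opF, map_opP,
    map_opP1, map_opQ, map_opQ1, map_opQb, map_opPb, ← Function.comp_apply (f := f) (g := g)] using h _ _ (.P1_zero i l)
  | Q_inv i n hn l => simpa only [map_add, map_sub, map_neg, map_smul, map_sum, map_mul, map_zero, WOp.map_app f, WOp.map_mul, map_opE, map_opF, map_opP,
    map_opP1, map_opQ, map_opQ1, map_opQb, map_opPb, ← Function.comp_apply (f := f) (g := g)] using h _ _ (.Q_inv i n hn l)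
  | P_inv i n hn l => simpa only [map_add, map_sub, map_neg, map_smul, map_sum, map_mul, map_zero, WOp.map_app f, WOp.map_mul, map_opE, map_opF, map_opP,
    map_opP1, map_opQ, map_opQ1, map_opQb, map_opPb, ← Function.comp_apply (f := f) (g := g)] using h _ _ (.P_inv i n hn l)
  | Q_P i j n m l => simpa only [map_add, map_sub, map_neg, map_smul, map_sum, map_mul, map_zero, WOp.map_app f, WOp.map_mul, map_opE, map_opF, map_opP,
    map_opP1, map_opQ, map_opQ1, map_opQb, map_opPb, ← Function.comp_apply (f := f) (g := g)] using h _ _ (.Q_P i j n m l)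
  | Q1_P1 i j n m l => simpa only [map_add, map_sub, map_neg, map_smul, map_sum, map_mul, map_zero, WOp.map_app f, WOp.map_mul, map_opE, map_opF, map_opP,
    map_opP1, map_opQ, map_opQ1, map_opQb, map_opPb, ← Function.comp_apply (f := f) (g := g)] using h _ _ (.Q1_P1 i j n m l)
  | Q1_P i j n m l => simpa only [map_add, map_sub, map_neg, map_smul, map_sum, map_mul, map_zero, WOp.map_app f, WOp.map_mul, map_opE, map_opF, map_opP,
    map_opP1, map_opQ, map_opQ1, map_opQb, map_opPb, ← Function.comp_apply (f := f) (g := g)] using h _ _ (.Q1_P i j n m l)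
  | Q_P1 i j n m l => simpa only [map_add, map_sub, map_neg, map_smul, map_sum, map_mul, map_zero, WOp.map_app f, WOp.map_mul, map_opE, map_opF, map_opP,
    map_opP1, map_opQ, map_opQ1, map_opQb, map_opPb, ← Function.comp_apply (f := f) (g := g)] using h _ _ (.Q_P1 i j n m l)

theorem holds_efRel (h : ∀ x y, EFRel G q c g x y → f x = f y) : Holds (EFRel G q c (f ∘ g)) := by
  intro x y hxy
  cases hxy with
  | pos i a b hab l => simpa only [map_add, map_sub, map_neg, map_smul, map_sum, map_mul, map_zero, WOp.map_app f, WOp.map_mul, map_opE, map_opF, map_opP,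
    map_opP1, map_opQ, map_opQ1, map_opQb, map_opPb, ← Function.comp_apply (f := f) (g := g)] using h _ _ (.pos i a b hab l)
  | neg i a b hab l => simpa only [map_add, map_sub, map_neg, map_smul, map_sum, map_mul, map_zero, WOp.map_app f, WOp.map_mul, map_opE, map_opF, map_opP,
    map_opP1, map_opQ, map_opQ1, map_opQb, map_opPb, ← Function.comp_apply (f := f) (g := g)] using h _ _ (.neg i a b hab l)
  | zero i a b hab l => simpa only [map_add, map_sub, map_neg, map_smul, map_sum, map_mul, map_zero, WOp.map_app f, WOp.map_mul, map_opE, map_opF, map_opP,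
    map_opP1, map_opQ, map_opQ1, map_opQb, map_opPb, ← Function.comp_apply (f := f) (g := g)] using h _ _ (.zero i a b hab l)
  | ne i j hij a b l => simpa only [map_add, map_sub, map_neg, map_smul, map_sum, map_mul, map_zero, WOp.map_app f, WOp.map_mul, map_opE, map_opF, map_opP,
    map_opP1, map_opQ, map_opQ1, map_opQb, map_opPb, ← Function.comp_apply (f := f) (g := g)] using h _ _ (.ne i j hij a b l)

theorem holds_farRel (h : ∀ x y, FarRel G c g x y → f x = f y) : Holds (FarRel G c (f ∘ g)) := by
  intro x y hxy
  cases hxy with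
  | E i j hne hij m n l => simpa only [map_add, map_sub, map_neg, map_smul, map_sum, map_mul, map_zero, WOp.map_app f, WOp.map_mul, map_opE, map_opF, map_opP,
    map_opP1, map_opQ, map_opQ1, map_opQb, map_opPb, ← Function.comp_apply (f := f) (g := g)] using h _ _ (.E i j hne hij m n l)
  | F i j hne hij m n l => simpa only [map_add, map_sub, map_neg, map_smul, map_sum, map_mul, map_zero, WOp.map_app f, WOp.map_mul, map_opE, map_opF, map_opP,
    map_opP1, map_opQ, map_opQ1, map_opQb, map_opPb, ← Function.comp_apply (f := f) (g := g)] using h _ _ (.F i j hne hij m n l)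

theorem holds_baseRel (h : ∀ x y, BaseRel G q c g x y → f x = f y) : Holds (BaseRel G q c (f ∘ g)) := by
  intro x y hxy
  cases hxy with
  | weight _ _ hxy => exact holds_weightRel (fun x y hxy => h x y (.weight x y hxy)) _ _ hxy
  | heis _ _ hxy => exact holds_heisRel (fun x y hxy => h x y (.heis x y hxy)) _ _ hxy
  | ef _ _ hxy => exact holds_efRel (fun x y hxy => h x y (.ef x y hxy)) _ _ hxy
  | far _ _ hxy => exact holds_farRel (fun x y hxy => h x y (.far x y hxy)) _ _ hxy
  | EE i n l => simpa only [map_add, map_sub, map_neg, map_smul, map_sum, map_mul, map_zero, WOp.map_app f, WOp.map_mul, map_opE, map_opF, map_opP,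
    map_opP1, map_opQ, map_opQ1, map_opQb, map_opPb, ← Function.comp_apply (f := f) (g := g)] using h _ _ (.EE i n l)
  | FF i n l => simpa only [map_add, map_sub, map_neg, map_smul, map_sum, map_mul, map_zero, WOp.map_app f, WOp.map_mul, map_opE, map_opF, map_opP,
    map_opP1, map_opQ, map_opQ1, map_opQb, map_opPb, ← Function.comp_apply (f := f) (g := g)] using h _ _ (.FF i n l)
  | EE_adj i j hij l => simpa only [map_add, map_sub, map_neg, map_smul, map_sum, map_mul, map_zero, WOp.map_app f, WOp.map_mul, map_opE, map_opF, map_opP,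
    map_opP1, map_opQ, map_opQ1, map_opQb, map_opPb, ← Function.comp_apply (f := f) (g := g)] using h _ _ (.EE_adj i j hij l)
  | FF_adj i j hij l => simpa only [map_add, map_sub, map_neg, map_smul, map_sum, map_mul, map_zero, WOp.map_app f, WOp.map_mul, map_opE, map_opF, map_opP,
    map_opP1, map_opQ, map_opQ1, map_opQb, map_opPb, ← Function.comp_apply (f := f) (g := g)] using h _ _ (.FF_adj i j hij l)

theorem holds_serreEqRel (h : ∀ x y, SerreEqRel G q c g x y → f x = f y) :
    Holds (SerreEqRel G q c (f ∘ g)) := by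
  intro x y hxy
  cases hxy with
  | E i j hij m n l => simpa only [map_add, map_sub, map_neg, map_smul, map_sum, map_mul, map_zero, WOp.map_app f, WOp.map_mul, map_opE, map_opF, map_opP,
    map_opP1, map_opQ, map_opQ1, map_opQb, map_opPb, ← Function.comp_apply (f := f) (g := g)] using h _ _ (.E i j hij m n l)
  | F i j hij m n l => simpa only [map_add, map_sub, map_neg, map_smul, map_sum, map_mul, map_zero, WOp.map_app f, WOp.map_mul, map_opE, map_opF, map_opP,
    map_opP1, map_opQ, map_opQ1, map_opQb, map_opPb, ← Function.comp_apply (f := f) (g := g)] using h _ _ (.F i j hij m n l)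


/-- Weights and coefficients do not involve the algebra, so the image of an instance of a relation
is an instance of the same relation. -/
theorem WeightRel.map {x y : A} (h : WeightRel G c g x y) : WeightRel G c (f ∘ g) (f x) (f y) := by
  cases h <;> simp only [map_add, map_sub, map_neg, map_smul, map_sum, map_mul, map_zero, WOp.map_app f, WOp.map_mul, map_opE,
    map_opF, map_opP, map_opP1, map_opQ, map_opQ1, map_opQb, map_opPb, ← Function.comp_apply (f := f) (g := g)]
  case idem l => exact .idem l
  case orth l m hlm => exact .orth l m hlm
  case E_right i r l => exact .E_right i r l
  case E_left i r l => exact .E_left i r l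
  case F_right i r l => exact .F_right i r l
  case F_left i r l => exact .F_left i r l
  case P_right i r l => exact .P_right i r l
  case P_left i r l => exact .P_left i r l
  case P1_right i r l => exact .P1_right i r l
  case P1_left i r l => exact .P1_left i r l
  case Q_right i r l => exact .Q_right i r l
  case Q_left i r l => exact .Q_left i r l
  case Q1_right i r l => exact .Q1_right i r l
  case Q1_left i r l => exact .Q1_left i r l

theorem HeisRel.map {x y : A} (h : HeisRel G q c g x y) : HeisRel G q c (f ∘ g) (f x) (f y) := by
  cases h <;> simp only [map_add, map_sub, map_neg, map_smul, map_sum, map_mul, map_zero, WOp.map_app f, WOp.map_mul, map_opE,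
    map_opF, map_opP, map_opP1, map_opQ, map_opQ1, map_opQb, map_opPb, ← Function.comp_apply (f := f) (g := g)]
  case Q_zero i l => exact .Q_zero i l
  case Q1_zero i l => exact .Q1_zero i l
  case P_zero i l => exact .P_zero i l
  case P1_zero i l => exact .P1_zero i l
  case Q_inv i n hn l => exact .Q_inv i n hn l
  case P_inv i n hn l => exact .P_inv i n hn l
  case Q_P i j n m l => exact .Q_P i j n m l
  case Q1_P1 i j n m l => exact .Q1_P1 i j n m l
  case Q1_P i j n m l => exact .Q1_P i j n m l
  case Q_P1 i j n m l => exact .Q_P1 i j n m l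

theorem EFRel.map {x y : A} (h : EFRel G q c g x y) : EFRel G q c (f ∘ g) (f x) (f y) := by
  cases h <;> simp only [map_add, map_sub, map_neg, map_smul, map_sum, map_mul, map_zero, WOp.map_app f, WOp.map_mul, map_opE,
    map_opF, map_opP, map_opP1, map_opQ, map_opQ1, map_opQb, map_opPb, ← Function.comp_apply (f := f) (g := g)]
  case pos i a b hab l => exact .pos i a b hab l
  case neg i a b hab l => exact .neg i a b hab l
  case zero i a b hab l => exact .zero i a b hab l
  case ne i j hij a b l => exact .ne i j hij a b l

theorem FarRel.map {x y : A} (h : FarRel G c g x y) : FarRel G c (f ∘ g) (f x) (f y) := by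
  cases h <;> simp only [map_add, map_sub, map_neg, map_smul, map_sum, map_mul, map_zero, WOp.map_app f, WOp.map_mul, map_opE,
    map_opF, map_opP, map_opP1, map_opQ, map_opQ1, map_opQb, map_opPb, ← Function.comp_apply (f := f) (g := g)]
  case E i j hne hij m n l => exact .E i j hne hij m n l
  case F i j hne hij m n l => exact .F i j hne hij m n l

theorem PQCommRel.map {x y : A} (h : PQCommRel c g x y) : PQCommRel c (f ∘ g) (f x) (f y) := by
  cases h <;> simp only [map_add, map_sub, map_neg, map_smul, map_sum, map_mul, map_zero, WOp.map_app f, WOp.map_mul, map_opE,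
    map_opF, map_opP, map_opP1, map_opQ, map_opQ1, map_opQb, map_opPb, ← Function.comp_apply (f := f) (g := g)]
  case P_P i j n m l => exact .P_P i j n m l
  case P_P1 i j n m l => exact .P_P1 i j n m l
  case P1_P1 i j n m l => exact .P1_P1 i j n m l
  case Q_Q i j n m l => exact .Q_Q i j n m l
  case Q_Q1 i j n m l => exact .Q_Q1 i j n m l
  case Q1_Q1 i j n m l => exact .Q1_Q1 i j n m l

theorem PQEFRel.map {x y : A} (h : PQEFRel G q c g x y) : PQEFRel G q c (f ∘ g) (f x) (f y) := by
  cases h <;> simp only [map_add, map_sub, map_neg, map_smul, map_sum, map_mul, map_zero, WOp.map_app f, WOp.map_mul, map_opE,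
    map_opF, map_opP, map_opP1, map_opQ, map_opQ1, map_opQb, map_opPb, ← Function.comp_apply (f := f) (g := g)]
  case QE_zero i b l => exact .QE_zero i b l
  case QE i a ha b l => exact .QE i a ha b l
  case QF_zero i b l => exact .QF_zero i b l
  case QF i a ha b l => exact .QF i a ha b l
  case PE_zero i b l => exact .PE_zero i b l
  case PE i a ha b l => exact .PE i a ha b l
  case PF_zero i b l => exact .PF_zero i b l
  case PF i a ha b l => exact .PF i a ha b l
  case adj_QE_zero i j h b l => exact .adj_QE_zero i j h b l
  case adj_QE i j h a ha b l => exact .adj_QE i j h a ha b l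
  case adj_QF_zero i j h b l => exact .adj_QF_zero i j h b l
  case adj_QF i j h a ha b l => exact .adj_QF i j h a ha b l
  case adj_PE_zero i j h b l => exact .adj_PE_zero i j h b l
  case adj_PE i j h a ha b l => exact .adj_PE i j h a ha b l
  case adj_PF_zero i j h b l => exact .adj_PF_zero i j h b l
  case adj_PF i j h a ha b l => exact .adj_PF i j h a ha b l
  case far_QE i j hne h a ha b l => exact .far_QE i j hne h a ha b l
  case far_QF i j hne h a ha b l => exact .far_QF i j hne h a ha b l
  case far_PE i j hne h a ha b l => exact .far_PE i j hne h a ha b l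
  case far_PF i j hne h a ha b l => exact .far_PF i j hne h a ha b l

theorem FullRel.map {x y : A} (h : FullRel G q c g x y) : FullRel G q c (f ∘ g) (f x) (f y) := by
  cases h
  case weight h => exact .weight _ _ h.map
  case pqComm h => exact .pqComm _ _ h.map
  case heis h => exact .heis _ _ h.map
  case pqef h => exact .pqef _ _ h.map
  case ef h => exact .ef _ _ h.map
  case far h => exact .far _ _ h.map
  all_goals simp only [map_add, map_sub, map_neg, map_smul, map_sum, map_mul, map_zero, WOp.map_app f, WOp.map_mul, map_opE,
    map_opF, map_opP, map_opP1, map_opQ, map_opQ1, map_opQb, map_opPb, ← Function.comp_apply (f := f) (g := g)]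
  case EE i m n l => exact .EE i m n l
  case FF i m n l => exact .FF i m n l
  case EE_adj i j h m n l => exact .EE_adj i j h m n l
  case FF_adj i j h m n l => exact .FF_adj i j h m n l
  case serreE i j h n m l => exact .serreE i j h n m l
  case serreF i j h n m l => exact .serreF i j h n m l

end Functoriality
end QAff

namespace QAff
namespace Currents

variable {I : Type*} [DecidableEq I] {G : SimpleGraph I} [DecidableRel G.Adj]
variable {K : Type*} [Field K] [CharZero K] {q t : K} {s : ℤ} {R : Type*} [Ring R] [Algebra K R]

/-! ### Cartan modes without their group-like factor -/

/-- The coefficients of `ψ_j`, made to have weight a multiple of `δ`. -/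
def upN (X : Currents G q t s R) (j : I) (n : ℤ) : R := X.φ j 0 * X.ψ j n

/-- The coefficients of `φ_j`, made to have weight a multiple of `δ`. -/
def downN (X : Currents G q t s R) (j : I) (n : ℤ) : R := X.ψ j 0 * X.φ j (-n)

theorem upN_zero (X : Currents G q t s R) (j : I) : X.upN j 0 = 1 := X.φψ j

theorem downN_zero (X : Currents G q t s R) (j : I) : X.downN j 0 = 1 := by
  rw [downN, neg_zero, X.ψφ]

/-- This is `ψE` multiplied by φ_{j,0}; commuting φ_{j,0} past E_i produces the powers of q in the
Q–E relations. -/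
theorem upN_E (h : Generic q t) (X : Currents G q t s R) (j i : I) (n m : ℤ) :
    X.upN j (n + 1) * X.E i m - X.E i m * X.upN j (n + 1) =
      t⁻¹ • (q ^ cartan G j i • (X.upN j n * X.E i (m + 1))
        - (q ^ cartan G j i)⁻¹ • (X.E i (m + 1) * X.upN j n)) := by
  have ht := h.t0
  have ha : q ^ cartan G j i ≠ 0 := zpow_ne_zero _ h.q0
  have h1 := congrArg (fun x => X.φ j 0 * x) (X.ψE h j i n m)
  have hE : ∀ m y, X.φ j 0 * (X.E i m * y) = (q ^ cartan G j i)⁻¹ • (X.E i m * (X.φ j 0 * y)) := fun m y => by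
    rw [← mul_assoc, smul_inv_comm ha (X.φE j i m), smul_mul_assoc, mul_assoc]
  simp only [mul_sub, mul_smul_comm, hE, smul_smul] at h1
  simp only [upN, mul_assoc]
  linear_combination (norm := skip) h1
  match_scalars <;> field_simp <;> ring

theorem downN_E (h : Generic q t) (X : Currents G q t s R) (j i : I) (n m : ℤ) :
    X.downN j (n + 1) * X.E i (m + 1) - X.E i (m + 1) * X.downN j (n + 1) =
      (q ^ cartan G j i)⁻¹ • (X.downN j n * X.E i m) - q ^ cartan G j i • (X.E i m * X.downN j n) := by
  have ht := h.t0
  have ha : q ^ cartan G j i ≠ 0 := zpow_ne_zero _ h.q0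
  have h1 := congrArg (fun x => (q ^ cartan G j i)⁻¹ • (X.ψ j 0 * x)) (X.φE_cross h j i (-(n + 1)) m)
  have hE : ∀ m y, X.ψ j 0 * (X.E i m * y) = q ^ cartan G j i • (X.E i m * (X.ψ j 0 * y)) := fun m y => by
    rw [← mul_assoc, X.kE, smul_mul_assoc, mul_assoc]
  simp only [mul_sub, mul_smul_comm, hE, smul_smul, smul_sub, show -(n + 1) + 1 = -n by ring] at h1
  simp only [downN, mul_assoc]
  linear_combination (norm := skip) -h1
  match_scalars <;> field_simp <;> ring

theorem upN_F (h : Generic q t) (X : Currents G q t s R) (j i : I) (n m : ℤ) :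
    X.upN j (n + 1) * X.F i m - X.F i m * X.upN j (n + 1) =
      (q ^ cartan G j i)⁻¹ • (X.upN j n * X.F i (m + 1)) - q ^ cartan G j i • (X.F i (m + 1) * X.upN j n) := by
  have ht := h.t0
  have h1 := congrArg (fun x => (t ^ (n + 1))⁻¹ • x) ((X.swap h.q0 ht).upN_E h.inv j i n m)
  simp only [upN, swap, zpow_zero, one_smul, mul_smul_comm, smul_mul_assoc, smul_sub, smul_smul, inv_zpow,
    inv_inv] at h1
  simp only [zpow_add₀ ht, zpow_one] at h1
  have hT := zpow_ne_zero n ht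
  generalize t ^ n = T at *
  simp only [upN]
  linear_combination (norm := skip) h1
  match_scalars <;> field_simp <;> ring

theorem downN_F (h : Generic q t) (X : Currents G q t s R) (j i : I) (n m : ℤ) :
    X.downN j (n + 1) * X.F i (m + 1) - X.F i (m + 1) * X.downN j (n + 1) =
      t • (q ^ cartan G j i • (X.downN j n * X.F i m)
        - (q ^ cartan G j i)⁻¹ • (X.F i m * X.downN j n)) := by
  have ht := h.t0
  have h1 := congrArg (fun x => t ^ (n + 1) • x) ((X.swap h.q0 ht).downN_E h.inv j i n m)
  simp only [downN, swap, zpow_zero, one_smul, mul_smul_comm, smul_mul_assoc, smul_sub, smul_smul, inv_zpow,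
    inv_inv] at h1
  simp only [zpow_neg, zpow_add₀ ht, zpow_one] at h1
  have hT := zpow_ne_zero n ht
  generalize t ^ n = T at *
  simp only [downN]
  linear_combination (norm := skip) h1
  match_scalars <;> field_simp <;> ring

/-- For C = 0 the commutator at n + 1 is a multiple of the one at n with shifted m, so induction on
n starts from `upN_zero`, for all m at once. -/
theorem upN_E_far (h : Generic q t) (X : Currents G q t s R) {i j : I} (hC : cartan G j i = 0) (n : ℕ) :
    ∀ m, X.upN j n * X.E i m = X.E i m * X.upN j n := by
  induction n with
  | zero => intro m; rw [Nat.cast_zero, upN_zero, mul_one, one_mul]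
  | succ n ih =>
    intro m
    have h1 := X.upN_E h j i n m
    rwa [hC, zpow_zero, inv_one, one_smul, one_smul, ih, sub_self, smul_zero, sub_eq_zero] at h1

theorem upN_F_far (h : Generic q t) (X : Currents G q t s R) {i j : I} (hC : cartan G j i = 0) (n : ℕ) :
    ∀ m, X.upN j n * X.F i m = X.F i m * X.upN j n := by
  induction n with
  | zero => intro m; rw [Nat.cast_zero, upN_zero, mul_one, one_mul]
  | succ n ih =>
    intro m
    have h1 := X.upN_F h j i n m
    rwa [hC, zpow_zero, inv_one, one_smul, one_smul, ih, sub_self, sub_eq_zero] at h1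

theorem downN_E_far (h : Generic q t) (X : Currents G q t s R) {i j : I} (hC : cartan G j i = 0) (n : ℕ) :
    ∀ m, X.downN j n * X.E i m = X.E i m * X.downN j n := by
  induction n with
  | zero => intro m; rw [Nat.cast_zero, downN_zero, mul_one, one_mul]
  | succ n ih =>
    intro m
    have h1 := X.downN_E h j i n (m - 1)
    rwa [hC, zpow_zero, inv_one, one_smul, one_smul, ih, sub_self, sub_eq_zero, sub_add_cancel] at h1

theorem downN_F_far (h : Generic q t) (X : Currents G q t s R) {i j : I} (hC : cartan G j i = 0) (n : ℕ) :
    ∀ m, X.downN j n * X.F i m = X.F i m * X.downN j n := by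
  induction n with
  | zero => intro m; rw [Nat.cast_zero, downN_zero, mul_one, one_mul]
  | succ n ih =>
    intro m
    have h1 := X.downN_F h j i n (m - 1)
    rwa [hC, zpow_zero, inv_one, one_smul, one_smul, ih, sub_self, smul_zero, sub_eq_zero, sub_add_cancel] at h1

theorem upN_comm (h : Generic q t) (X : Currents G q t s R) (i j : I) (m n : ℤ) :
    X.upN i m * X.upN j n = X.upN j n * X.upN i m := by
  simp only [upN]
  rw [mul_assoc, ← mul_assoc (X.ψ i m), ← X.φk, mul_assoc (X.φ j 0) (X.ψ j n), ← mul_assoc (X.ψ j n), ← X.φk,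
    mul_assoc (X.φ j 0), mul_assoc (X.φ i 0), X.ψ_comm h, ← mul_assoc, ← mul_assoc, X.φkφ]
  simp only [mul_assoc]

theorem downN_comm (h : Generic q t) (X : Currents G q t s R) (i j : I) (m n : ℤ) :
    X.downN i m * X.downN j n = X.downN j n * X.downN i m := by
  simp only [downN]
  rw [mul_assoc, ← mul_assoc (X.φ i _), ← X.kφ, mul_assoc (X.ψ j 0) (X.φ j _), ← mul_assoc (X.φ j _), ← X.kφ,
    mul_assoc (X.ψ j 0), mul_assoc (X.ψ i 0), X.φ_comm h, ← mul_assoc, ← mul_assoc, X.kψ]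
  simp only [mul_assoc]

end Currents
end QAff

namespace QAff

/-! ### Relations of P, Q with E, F on weight modules -/

section Full

variable {I : Type*} [Fintype I] [DecidableEq I] {G : SimpleGraph I} [DecidableRel G.Adj]
variable {K : Type*} [Field K] {q : K} {c : ℕ}
variable {V : Type*} [AddCommGroup V] [Module K V] {g : Gen I → Module.End K V}
variable (hq0 : q ≠ 0) (hκ : q - q⁻¹ ≠ 0) (hB : Holds (BaseRel G q c g)) (hW : IsWeightModule g)
variable (hS : Holds (SerreEqRel G q c g))

/-- Positivity matters: for n = 0 the left side is 1, while Q^[1⁰] = 0. For this reason the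
relations of Q^[1] and P^[1] have a form of their own. -/
theorem realize_upN (j : I) {n : ℕ} (hn : 0 < n) :
    (realize hq0 hκ hB hW hS).upN j n = (q - q⁻¹) • (opQb q c g j n).tot hW := by
  change phiOp q c hW j 0 * psiOp q c hW j n = _
  rw [psiOp_pos hW j (by exact_mod_cast hn), phiOp_zero, mul_smul_comm, ← mul_assoc, kInv_mul_kOp hq0, one_mul,
    Int.toNat_natCast]

theorem realize_downN (j : I) {n : ℕ} (hn : 0 < n) :
    (realize hq0 hκ hB hW hS).downN j n = -(q - q⁻¹) • (opPb q c g j n).tot hW := by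
  change psiOp q c hW j 0 * phiOp q c hW j (-n) = _
  rw [phiOp_neg hW j (by omega), psiOp_zero, mul_smul_comm, ← mul_assoc, kOp_mul_kInv hq0, one_mul,
    neg_neg, Int.toNat_natCast]

section

variable [CharZero K] (h : Generic q (q ^ c))
include hq0 hκ hB hS h

theorem tot_Qb_E (j i : I) {n : ℕ} (hn : 0 < n) (m : ℤ) :
    q ^ c • ((opQb q c g j (n + 1)).tot hW * (opE G c g i m).tot hW -
      (opE G c g i m).tot hW * (opQb q c g j (n + 1)).tot hW) =
    q ^ cartan G j i • ((opQb q c g j n).tot hW * (opE G c g i (m + 1)).tot hW) -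
      (q ^ cartan G j i)⁻¹ • ((opE G c g i (m + 1)).tot hW * (opQb q c g j n).tot hW) := by
  have h1 := (realize hq0 hκ hB hW hS).upN_E h j i n m
  rw [← Nat.cast_succ, realize_upN _ _ _ _ _ _ hn, realize_upN _ _ _ _ _ _ n.succ_pos] at h1
  change (q - q⁻¹) • _ * (opE G c g i m).tot hW - (opE G c g i m).tot hW * _ =
    _ • (_ • (_ * (opE G c g i (m + 1)).tot hW) - _ • ((opE G c g i (m + 1)).tot hW * _)) at h1
  have ht := h.t0
  generalize q - q⁻¹ = κ at *
  have h2 := congrArg (fun x => (κ⁻¹ * q ^ c) • x) h1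
  simp only [smul_mul_assoc, mul_smul_comm] at h2
  linear_combination (norm := skip) h2
  match_scalars <;> field_simp <;> ring

theorem tot_Qb_one_E (j i : I) (m : ℤ) :
    q ^ c • ((opQb q c g j 1).tot hW * (opE G c g i m).tot hW -
      (opE G c g i m).tot hW * (opQb q c g j 1).tot hW) =
    qint q (cartan G j i) • (opE G c g i (m + 1)).tot hW := by
  have h1 := (realize hq0 hκ hB hW hS).upN_E h j i 0 m
  rw [zero_add, ← Nat.cast_one, realize_upN _ _ _ _ _ _ one_pos, Currents.upN_zero] at h1
  change (q - q⁻¹) • _ * (opE G c g i m).tot hW - (opE G c g i m).tot hW * _ =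
    _ • (_ • (_ * (opE G c g i (m + 1)).tot hW) - _ • ((opE G c g i (m + 1)).tot hW * _)) at h1
  have ht := h.t0
  rw [qint, zpow_neg]
  generalize q - q⁻¹ = κ at *
  have h2 := congrArg (fun x => (κ⁻¹ * q ^ c) • x) h1
  simp only [smul_mul_assoc, mul_smul_comm, mul_one, one_mul] at h2
  linear_combination (norm := skip) h2
  match_scalars <;> field_simp <;> ring

theorem tot_Qb_F (j i : I) {n : ℕ} (hn : 0 < n) (m : ℤ) :
    (opQb q c g j (n + 1)).tot hW * (opF G c g i m).tot hW -
      (opF G c g i m).tot hW * (opQb q c g j (n + 1)).tot hW =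
    (q ^ cartan G j i)⁻¹ • ((opQb q c g j n).tot hW * (opF G c g i (m + 1)).tot hW) -
      q ^ cartan G j i • ((opF G c g i (m + 1)).tot hW * (opQb q c g j n).tot hW) := by
  have h1 := (realize hq0 hκ hB hW hS).upN_F h j i n m
  rw [← Nat.cast_succ, realize_upN _ _ _ _ _ _ hn, realize_upN _ _ _ _ _ _ n.succ_pos] at h1
  change (q - q⁻¹) • _ * (opF G c g i m).tot hW - (opF G c g i m).tot hW * _ =
    _ • (_ * (opF G c g i (m + 1)).tot hW) - _ • ((opF G c g i (m + 1)).tot hW * _) at h1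
  generalize q - q⁻¹ = κ at *
  have h2 := congrArg (fun x => κ⁻¹ • x) h1
  simp only [smul_mul_assoc, mul_smul_comm] at h2
  linear_combination (norm := skip) h2
  match_scalars <;> field_simp <;> ring

theorem tot_Qb_one_F (j i : I) (m : ℤ) :
    (opQb q c g j 1).tot hW * (opF G c g i m).tot hW -
      (opF G c g i m).tot hW * (opQb q c g j 1).tot hW =
    -(qint q (cartan G j i) • (opF G c g i (m + 1)).tot hW) := by
  have h1 := (realize hq0 hκ hB hW hS).upN_F h j i 0 m
  rw [zero_add, ← Nat.cast_one, realize_upN _ _ _ _ _ _ one_pos, Currents.upN_zero] at h1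
  change (q - q⁻¹) • _ * (opF G c g i m).tot hW - (opF G c g i m).tot hW * _ =
    _ • (_ * (opF G c g i (m + 1)).tot hW) - _ • ((opF G c g i (m + 1)).tot hW * _) at h1
  rw [qint, zpow_neg]
  generalize q - q⁻¹ = κ at *
  have h2 := congrArg (fun x => κ⁻¹ • x) h1
  simp only [smul_mul_assoc, mul_smul_comm, mul_one, one_mul] at h2
  linear_combination (norm := skip) h2
  match_scalars <;> field_simp <;> ring

theorem tot_Pb_E (j i : I) {n : ℕ} (hn : 0 < n) (m : ℤ) :
    (opPb q c g j (n + 1)).tot hW * (opE G c g i (m + 1)).tot hW -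
      (opE G c g i (m + 1)).tot hW * (opPb q c g j (n + 1)).tot hW =
    (q ^ cartan G j i)⁻¹ • ((opPb q c g j n).tot hW * (opE G c g i m).tot hW) -
      q ^ cartan G j i • ((opE G c g i m).tot hW * (opPb q c g j n).tot hW) := by
  have h1 := (realize hq0 hκ hB hW hS).downN_E h j i n m
  rw [← Nat.cast_succ, realize_downN _ _ _ _ _ _ hn, realize_downN _ _ _ _ _ _ n.succ_pos] at h1
  change -(q - q⁻¹) • _ * (opE G c g i (m + 1)).tot hW - (opE G c g i (m + 1)).tot hW * _ =
    _ • (_ * (opE G c g i m).tot hW) - _ • ((opE G c g i m).tot hW * _) at h1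
  generalize q - q⁻¹ = κ at *
  have h2 := congrArg (fun x => (-κ⁻¹) • x) h1
  simp only [smul_mul_assoc, mul_smul_comm] at h2
  linear_combination (norm := skip) h2
  match_scalars <;> field_simp <;> ring

theorem tot_Pb_one_E (j i : I) (m : ℤ) :
    (opPb q c g j 1).tot hW * (opE G c g i (m + 1)).tot hW -
      (opE G c g i (m + 1)).tot hW * (opPb q c g j 1).tot hW =
    qint q (cartan G j i) • (opE G c g i m).tot hW := by
  have h1 := (realize hq0 hκ hB hW hS).downN_E h j i 0 m
  rw [zero_add, ← Nat.cast_one, realize_downN _ _ _ _ _ _ one_pos, Currents.downN_zero] at h1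
  change -(q - q⁻¹) • _ * (opE G c g i (m + 1)).tot hW - (opE G c g i (m + 1)).tot hW * _ =
    _ • (_ * (opE G c g i m).tot hW) - _ • ((opE G c g i m).tot hW * _) at h1
  rw [qint, zpow_neg]
  generalize q - q⁻¹ = κ at *
  have h2 := congrArg (fun x => (-κ⁻¹) • x) h1
  simp only [smul_mul_assoc, mul_smul_comm, mul_one, one_mul] at h2
  linear_combination (norm := skip) h2
  match_scalars <;> field_simp <;> ring

theorem tot_Pb_F (j i : I) {n : ℕ} (hn : 0 < n) (m : ℤ) :
    (q ^ c)⁻¹ • ((opPb q c g j (n + 1)).tot hW * (opF G c g i (m + 1)).tot hW -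
      (opF G c g i (m + 1)).tot hW * (opPb q c g j (n + 1)).tot hW) =
    q ^ cartan G j i • ((opPb q c g j n).tot hW * (opF G c g i m).tot hW) -
      (q ^ cartan G j i)⁻¹ • ((opF G c g i m).tot hW * (opPb q c g j n).tot hW) := by
  have h1 := (realize hq0 hκ hB hW hS).downN_F h j i n m
  rw [← Nat.cast_succ, realize_downN _ _ _ _ _ _ hn, realize_downN _ _ _ _ _ _ n.succ_pos] at h1
  change -(q - q⁻¹) • _ * (opF G c g i (m + 1)).tot hW - (opF G c g i (m + 1)).tot hW * _ =
    _ • (_ • (_ * (opF G c g i m).tot hW) - _ • ((opF G c g i m).tot hW * _)) at h1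
  have ht := h.t0
  generalize q - q⁻¹ = κ at *
  have h2 := congrArg (fun x => (-(κ⁻¹ * (q ^ c)⁻¹)) • x) h1
  simp only [smul_mul_assoc, mul_smul_comm] at h2
  linear_combination (norm := skip) h2
  match_scalars <;> field_simp <;> ring

theorem tot_Pb_one_F (j i : I) (m : ℤ) :
    (q ^ c)⁻¹ • ((opPb q c g j 1).tot hW * (opF G c g i (m + 1)).tot hW -
      (opF G c g i (m + 1)).tot hW * (opPb q c g j 1).tot hW) =
    -(qint q (cartan G j i) • (opF G c g i m).tot hW) := by
  have h1 := (realize hq0 hκ hB hW hS).downN_F h j i 0 m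
  rw [zero_add, ← Nat.cast_one, realize_downN _ _ _ _ _ _ one_pos, Currents.downN_zero] at h1
  change -(q - q⁻¹) • _ * (opF G c g i (m + 1)).tot hW - (opF G c g i (m + 1)).tot hW * _ =
    _ • (_ • (_ * (opF G c g i m).tot hW) - _ • ((opF G c g i m).tot hW * _)) at h1
  have ht := h.t0
  rw [qint, zpow_neg]
  generalize q - q⁻¹ = κ at *
  have h2 := congrArg (fun x => (-(κ⁻¹ * (q ^ c)⁻¹)) • x) h1
  simp only [smul_mul_assoc, mul_smul_comm, mul_one, one_mul] at h2
  linear_combination (norm := skip) h2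
  match_scalars <;> field_simp <;> ring

theorem tot_Qb_comm (i j : I) (m n : ℕ) : (opQb q c g i m).tot hW * (opQb q c g j n).tot hW =
    (opQb q c g j n).tot hW * (opQb q c g i m).tot hW := by
  have hz : ∀ i, (opQb q c g i 0).tot hW = 0 := fun i => by simp [tot_opQb hB.weight, qint_zero]
  rcases m.eq_zero_or_pos with rfl | hm
  · rw [hz, zero_mul, mul_zero]
  rcases n.eq_zero_or_pos with rfl | hn
  · rw [hz, zero_mul, mul_zero]
  have h1 := (realize hq0 hκ hB hW hS).upN_comm h i j m n
  rw [realize_upN _ _ _ _ _ _ hm, realize_upN _ _ _ _ _ _ hn, smul_mul_smul_comm, smul_mul_smul_comm] at h1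
  exact smul_right_injective _ (mul_ne_zero hκ hκ) h1

theorem tot_Pb_comm (i j : I) (m n : ℕ) : (opPb q c g i m).tot hW * (opPb q c g j n).tot hW =
    (opPb q c g j n).tot hW * (opPb q c g i m).tot hW := by
  have hz : ∀ i, (opPb q c g i 0).tot hW = 0 := fun i => by simp [tot_opPb hB.weight, qint_zero]
  rcases m.eq_zero_or_pos with rfl | hm
  · rw [hz, zero_mul, mul_zero]
  rcases n.eq_zero_or_pos with rfl | hn
  · rw [hz, zero_mul, mul_zero]
  have h1 := (realize hq0 hκ hB hW hS).downN_comm h i j m n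
  rw [realize_downN _ _ _ _ _ _ hm, realize_downN _ _ _ _ _ _ hn, smul_mul_smul_comm, smul_mul_smul_comm] at h1
  exact smul_right_injective _ (mul_ne_zero (neg_ne_zero.2 hκ) (neg_ne_zero.2 hκ)) h1

include hW in
set_option maxHeartbeats 1000000 in
theorem holds_pqefRel : Holds (PQEFRel G q c g) := by
  have hw := hB.weight
  have hQE : ∀ j n i m l, (opQb q c g j n * opE G c g i m) l =
      (opQb q c g j n).tot hW * (opE G c g i m).tot hW * g (.one l) := fun j n i m l =>
    ((opQb_isHom hw j n).mul_tot_mul_one hW (opE_isHom hw i m) l).symm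
  have hEQ : ∀ j n i m l, (opE G c g i m * opQb q c g j n) l =
      (opE G c g i m).tot hW * (opQb q c g j n).tot hW * g (.one l) := fun j n i m l =>
    ((opE_isHom hw i m).mul_tot_mul_one hW (opQb_isHom hw j n) l).symm
  have hQF : ∀ j n i m l, (opQb q c g j n * opF G c g i m) l =
      (opQb q c g j n).tot hW * (opF G c g i m).tot hW * g (.one l) := fun j n i m l =>
    ((opQb_isHom hw j n).mul_tot_mul_one hW (opF_isHom hw i m) l).symm
  have hFQ : ∀ j n i m l, (opF G c g i m * opQb q c g j n) l =
      (opF G c g i m).tot hW * (opQb q c g j n).tot hW * g (.one l) := fun j n i m l =>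
    ((opF_isHom hw i m).mul_tot_mul_one hW (opQb_isHom hw j n) l).symm
  have hPE : ∀ j n i m l, (opPb q c g j n * opE G c g i m) l =
      (opPb q c g j n).tot hW * (opE G c g i m).tot hW * g (.one l) := fun j n i m l =>
    ((opPb_isHom hw j n).mul_tot_mul_one hW (opE_isHom hw i m) l).symm
  have hEP : ∀ j n i m l, (opE G c g i m * opPb q c g j n) l =
      (opE G c g i m).tot hW * (opPb q c g j n).tot hW * g (.one l) := fun j n i m l =>
    ((opE_isHom hw i m).mul_tot_mul_one hW (opPb_isHom hw j n) l).symm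
  have hPF : ∀ j n i m l, (opPb q c g j n * opF G c g i m) l =
      (opPb q c g j n).tot hW * (opF G c g i m).tot hW * g (.one l) := fun j n i m l =>
    ((opPb_isHom hw j n).mul_tot_mul_one hW (opF_isHom hw i m) l).symm
  have hFP : ∀ j n i m l, (opF G c g i m * opPb q c g j n) l =
      (opF G c g i m).tot hW * (opPb q c g j n).tot hW * g (.one l) := fun j n i m l =>
    ((opF_isHom hw i m).mul_tot_mul_one hW (opPb_isHom hw j n) l).symm
  have hE : ∀ i m l, opE G c g i m l = (opE G c g i m).tot hW * g (.one l) := fun i m l =>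
    ((opE_isHom hw i m).tot_mul_one hW l).symm
  have hF : ∀ i m l, opF G c g i m l = (opF G c g i m).tot hW * g (.one l) := fun i m l =>
    ((opF_isHom hw i m).tot_mul_one hW l).symm
  have hm1 : qint q (-1) = -1 := by rw [qint_neg, qint_one hκ]
  intro x y hxy
  -- Each relation is rewritten as an identity of endomorphisms times 1_l, and the factor 1_l is
  -- dropped.
  cases hxy <;> simp only [hQE, hEQ, hQF, hFQ, hPE, hEP, hPF, hFP, hE, hF, ← smul_mul_assoc, ← sub_mul,
    ← add_mul, ← neg_mul] <;> congr 1 <;> try simp only [smul_mul_assoc, neg_mul]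
  case QE_zero i b l => 
    have h1 := tot_Qb_one_E hq0 hκ hB hW hS h i i b
    simp only [cartan_self] at h1
    exact h1
  case QE i a ha b l => 
    have h1 := tot_Qb_E hq0 hκ hB hW hS h i i ha b
    simp only [cartan_self, zpow_ofNat] at h1
    exact h1
  case QF_zero i b l => 
    have h1 := tot_Qb_one_F hq0 hκ hB hW hS h i i b
    simp only [cartan_self] at h1
    exact h1
  case QF i a ha b l => 
    have h1 := tot_Qb_F hq0 hκ hB hW hS h i i ha b
    simp only [cartan_self, zpow_ofNat] at h1
    exact h1
  case PE_zero i b l => 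
    have h1 := tot_Pb_one_E hq0 hκ hB hW hS h i i b
    simp only [cartan_self] at h1
    exact h1
  case PE i a ha b l => 
    have h1 := tot_Pb_E hq0 hκ hB hW hS h i i ha b
    simp only [cartan_self, zpow_ofNat] at h1
    exact h1
  case PF_zero i b l => 
    have h1 := tot_Pb_one_F hq0 hκ hB hW hS h i i b
    simp only [cartan_self] at h1
    exact h1
  case PF i a ha b l => 
    have h1 := tot_Pb_F hq0 hκ hB hW hS h i i ha b
    simp only [cartan_self, zpow_ofNat] at h1
    exact h1
  case adj_QE_zero i j hij b l =>
    rw [tot_Qb_one_E hq0 hκ hB hW hS h, cartan_adj G hij.symm, hm1, neg_one_smul]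
  case adj_QE i j hij a ha b l =>
    rw [tot_Qb_E hq0 hκ hB hW hS h _ _ ha, cartan_adj G hij.symm, zpow_neg_one, inv_inv]; abel
  case adj_QF_zero i j hij b l =>
    rw [tot_Qb_one_F hq0 hκ hB hW hS h, cartan_adj G hij.symm, hm1, neg_one_smul, neg_neg]
  case adj_QF i j hij a ha b l =>
    rw [tot_Qb_F hq0 hκ hB hW hS h _ _ ha, cartan_adj G hij.symm, zpow_neg_one, inv_inv]; abel
  case adj_PE_zero i j hij b l =>
    rw [tot_Pb_one_E hq0 hκ hB hW hS h, cartan_adj G hij.symm, hm1, neg_one_smul]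
  case adj_PE i j hij a ha b l =>
    rw [tot_Pb_E hq0 hκ hB hW hS h _ _ ha, cartan_adj G hij.symm, zpow_neg_one, inv_inv]; abel
  case adj_PF_zero i j hij b l =>
    rw [tot_Pb_one_F hq0 hκ hB hW hS h, cartan_adj G hij.symm, hm1, neg_one_smul, neg_neg]
  case adj_PF i j hij a ha b l =>
    rw [tot_Pb_F hq0 hκ hB hW hS h _ _ ha, cartan_adj G hij.symm, zpow_neg_one, inv_inv]; abel
  case far_QE i j hne hij a ha b l =>
    have h1 := (realize hq0 hκ hB hW hS).upN_E_far h (cartan_far G hne.symm fun h => hij h.symm) a b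
    rw [realize_upN _ _ _ _ _ _ ha, smul_mul_assoc, mul_smul_comm] at h1
    exact smul_right_injective _ hκ h1
  case far_QF i j hne hij a ha b l =>
    have h1 := (realize hq0 hκ hB hW hS).upN_F_far h (cartan_far G hne.symm fun h => hij h.symm) a b
    rw [realize_upN _ _ _ _ _ _ ha, smul_mul_assoc, mul_smul_comm] at h1
    exact smul_right_injective _ hκ h1
  case far_PE i j hne hij a ha b l =>
    have h1 := (realize hq0 hκ hB hW hS).downN_E_far h (cartan_far G hne.symm fun h => hij h.symm) a b
    rw [realize_downN _ _ _ _ _ _ ha, smul_mul_assoc, mul_smul_comm] at h1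
    exact smul_right_injective _ (neg_ne_zero.2 hκ) h1
  case far_PF i j hne hij a ha b l =>
    have h1 := (realize hq0 hκ hB hW hS).downN_F_far h (cartan_far G hne.symm fun h => hij h.symm) a b
    rw [realize_downN _ _ _ _ _ _ ha, smul_mul_assoc, mul_smul_comm] at h1
    exact smul_right_injective _ (neg_ne_zero.2 hκ) h1

end

end Full
end QAff

/-! ### Commutativity of the P's and of the Q's; the full relations on weight modules -/

namespace QAff

/-- In w_n the term m = n is u_n a_n and the term m = 0 drops out, so a_n is determined by w_n and
earlier terms; then the inverse relation determines b_n. Thus Q and P are polynomials in Q^[1ⁿ] and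
P^[1ⁿ], and inherit their commutativity. -/
theorem mem_subalgebra_of_convolution {K R : Type*} [Field K] [Ring R] [Algebra K R] (S : Subalgebra K R)
    {a b w : ℕ → R} {u : ℕ → K} (a0 : a 0 = 1) (b0 : b 0 = 1) (u0 : u 0 = 0) (u1 : ∀ n, 0 < n → u n ≠ 0)
    (hab : ∀ n, 0 < n → ∑ k ∈ Finset.range (n + 1), (-1 : K) ^ k • (b k * a (n - k)) = 0)
    (hw : ∀ n, w n = ∑ m ∈ Finset.range (n + 1), u m • (b (n - m) * a m)) (hS : ∀ n, w n ∈ S)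
    (n : ℕ) : a n ∈ S ∧ b n ∈ S := by
  induction n using Nat.strong_induction_on with
  | _ n ih =>
    rcases n with - | n
    · rw [a0, b0]; exact ⟨S.one_mem, S.one_mem⟩
    have ha : a (n + 1) ∈ S := by
      have h1 := hw (n + 1)
      rw [Finset.sum_range_succ, Nat.sub_self, b0, one_mul, Finset.sum_range_succ', u0, zero_smul, add_zero,
        ← sub_eq_iff_eq_add'] at h1
      have h2 : u (n + 1) • a (n + 1) ∈ S := by
        rw [← h1]
        refine S.sub_mem (hS _) (S.sum_mem fun m hm => S.smul_mem (S.mul_mem ?_ ?_) _)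
        · exact (ih _ (by simp at hm; omega)).2
        · exact (ih _ (by simp at hm; omega)).1
      have h3 := S.smul_mem h2 (u (n + 1))⁻¹
      rwa [smul_smul, inv_mul_cancel₀ (u1 _ n.succ_pos), one_smul] at h3
    refine ⟨ha, ?_⟩
    have h1 := hab (n + 1) n.succ_pos
    rw [Finset.sum_range_succ, Nat.sub_self, a0, mul_one] at h1
    have h2 : (-1 : K) ^ (n + 1) • b (n + 1) ∈ S := by
      rw [eq_neg_of_add_eq_zero_right h1]
      refine S.neg_mem (S.sum_mem fun m hm => S.smul_mem (S.mul_mem ?_ ?_) _)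
      · exact (ih _ (by simp at hm; omega)).2
      -- The term with b_0 contains a_{n+1} itself, which is why a has to come before b.
      · rcases m.eq_zero_or_pos with rfl | hm0
        · exact ha
        · exact (ih _ (by simp at hm; omega)).1
    have h3 := S.smul_mem h2 ((-1 : K) ^ (n + 1))
    rwa [smul_smul, ← mul_pow, neg_mul_neg, one_mul, one_pow, one_smul] at h3

theorem sum_perm_fin_two {M : Type*} [AddCommMonoid M] (f : Equiv.Perm (Fin 2) → M) :
    ∑ s, f s = f 1 + f (Equiv.swap 0 1) := by
  rw [show (Finset.univ : Finset (Equiv.Perm (Fin 2))) = {1, Equiv.swap 0 1} by decide,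
    Finset.sum_pair (by decide)]

section Full

variable {I : Type*} [Fintype I] [DecidableEq I] {G : SimpleGraph I} [DecidableRel G.Adj]
variable {K : Type*} [Field K] {q : K} {c : ℕ}
variable {V : Type*} [AddCommGroup V] [Module K V] {g : Gen I → Module.End K V}

/-- The algebra generated by the operators `Q_i^[1ⁿ]`. -/
noncomputable def algQ (q : K) (c : ℕ) (hW : IsWeightModule g) : Subalgebra K (Module.End K V) :=
  Algebra.adjoin K (Set.range fun x : I × ℕ => (opQb q c g x.1 x.2).tot hW)

/-- The algebra generated by the operators `P_i^[1ⁿ]`. -/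
noncomputable def algP (q : K) (c : ℕ) (hW : IsWeightModule g) : Subalgebra K (Module.End K V) :=
  Algebra.adjoin K (Set.range fun x : I × ℕ => (opPb q c g x.1 x.2).tot hW)

theorem opQb_mem_algQ (hW : IsWeightModule g) (i : I) (n : ℕ) : (opQb q c g i n).tot hW ∈ algQ q c hW :=
  Algebra.subset_adjoin ⟨(i, n), rfl⟩

theorem opPb_mem_algP (hW : IsWeightModule g) (i : I) (n : ℕ) : (opPb q c g i n).tot hW ∈ algP q c hW :=
  Algebra.subset_adjoin ⟨(i, n), rfl⟩

theorem opQ_mem_algQ (hw : Holds (WeightRel G c g)) (hh : Holds (HeisRel G q c g)) (hW : IsWeightModule g)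
    (hq0 : q ≠ 0) (hq : ∀ n : ℕ, 0 < n → q ^ n ≠ 1) (i : I) (n : ℕ) :
    (opQ c g i n).tot hW ∈ algQ q c hW ∧ (opQ1 c g i n).tot hW ∈ algQ q c hW :=
  mem_subalgebra_of_convolution (algQ q c hW) (a := fun n => (opQ c g i n).tot hW)
    (b := fun n => (opQ1 c g i n).tot hW) (tot_opQ_zero hw hh hW i) (tot_opQ1_zero hw hh hW i)
    (u := fun n => (-q) ^ n * qint q n) (by simp [qint_zero])
    (fun n hn => mul_ne_zero (pow_ne_zero _ (neg_ne_zero.2 hq0)) (qint_ne_zero hq0 hq (by omega)))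
    (fun n hn => tot_Q_inv hw hh hW i hn) (fun n => tot_opQb hw hW i n) (fun n => opQb_mem_algQ hW i n) n

theorem opP_mem_algP (hw : Holds (WeightRel G c g)) (hh : Holds (HeisRel G q c g)) (hW : IsWeightModule g)
    (hq0 : q ≠ 0) (hq : ∀ n : ℕ, 0 < n → q ^ n ≠ 1) (i : I) (n : ℕ) :
    (opP c g i n).tot hW ∈ algP q c hW ∧ (opP1 c g i n).tot hW ∈ algP q c hW :=
  mem_subalgebra_of_convolution (algP q c hW) (a := fun n => (opP c g i n).tot hW)
    (b := fun n => (opP1 c g i n).tot hW) (tot_opP_zero hw hh hW i) (tot_opP1_zero hw hh hW i)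
    (u := fun n => (-q) ^ (-(n : ℤ)) * qint q n) (by simp [qint_zero])
    (fun n hn => mul_ne_zero (zpow_ne_zero _ (neg_ne_zero.2 hq0)) (qint_ne_zero hq0 hq (by omega)))
    (fun n hn => tot_P_inv hw hh hW i hn) (fun n => tot_opPb hw hW i n) (fun n => opPb_mem_algP hW i n) n

theorem commute_of_mem_adjoin {R : Type*} [Ring R] [Algebra K R] {s : Set R}
    (hs : ∀ x ∈ s, ∀ y ∈ s, x * y = y * x) {x y : R} (hx : x ∈ Algebra.adjoin K s)
    (hy : y ∈ Algebra.adjoin K s) : x * y = y * x := by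
  have := Algebra.isMulCommutative_adjoin K hs
  exact congrArg Subtype.val (mul_comm' (⟨x, hx⟩ : Algebra.adjoin K s) ⟨y, hy⟩)

variable (hq0 : q ≠ 0) (hq : ∀ n : ℕ, 0 < n → q ^ n ≠ 1) (hB : Holds (BaseRel G q c g))
  (hS : Holds (SerreEqRel G q c g)) (hW : IsWeightModule g) [CharZero K] (h : Generic q (q ^ c))
include hq0 hq hB hS h

theorem algQ_comm {x y : Module.End K V} (hx : x ∈ algQ q c hW) (hy : y ∈ algQ q c hW) : x * y = y * x := by
  refine commute_of_mem_adjoin ?_ hx hy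
  rintro _ ⟨x, rfl⟩ _ ⟨y, rfl⟩
  exact tot_Qb_comm hq0 (q_sub_inv_ne hq0 hq) hB hW hS h _ _ _ _

theorem algP_comm {x y : Module.End K V} (hx : x ∈ algP q c hW) (hy : y ∈ algP q c hW) : x * y = y * x := by
  refine commute_of_mem_adjoin ?_ hx hy
  rintro _ ⟨x, rfl⟩ _ ⟨y, rfl⟩
  exact tot_Pb_comm hq0 (q_sub_inv_ne hq0 hq) hB hW hS h _ _ _ _

include hW

theorem holds_pqCommRel : Holds (PQCommRel c g) := by
  have hw := hB.weight
  have hp := fun i n => (opP_mem_algP hw hB.heis hW hq0 hq i n).1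
  have hp1 := fun i n => (opP_mem_algP hw hB.heis hW hq0 hq i n).2
  have hQ := fun i n => (opQ_mem_algQ hw hB.heis hW hq0 hq i n).1
  have hQ1 := fun i n => (opQ_mem_algQ hw hB.heis hW hq0 hq i n).2
  intro x y hxy
  cases hxy with
  | P_P i j n m l =>
    rw [← (opP_isHom hw _ _).mul_tot_mul_one hW (opP_isHom hw _ _),
      algP_comm hq0 hq hB hS hW h (hp _ _) (hp _ _), (opP_isHom hw _ _).mul_tot_mul_one hW (opP_isHom hw _ _)]
  | P_P1 i j n m l =>
    rw [← (opP_isHom hw _ _).mul_tot_mul_one hW (opP1_isHom hw _ _),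
      algP_comm hq0 hq hB hS hW h (hp _ _) (hp1 _ _), (opP1_isHom hw _ _).mul_tot_mul_one hW (opP_isHom hw _ _)]
  | P1_P1 i j n m l =>
    rw [← (opP1_isHom hw _ _).mul_tot_mul_one hW (opP1_isHom hw _ _),
      algP_comm hq0 hq hB hS hW h (hp1 _ _) (hp1 _ _),
      (opP1_isHom hw _ _).mul_tot_mul_one hW (opP1_isHom hw _ _)]
  | Q_Q i j n m l =>
    rw [← (opQ_isHom hw _ _).mul_tot_mul_one hW (opQ_isHom hw _ _),
      algQ_comm hq0 hq hB hS hW h (hQ _ _) (hQ _ _), (opQ_isHom hw _ _).mul_tot_mul_one hW (opQ_isHom hw _ _)]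
  | Q_Q1 i j n m l =>
    rw [← (opQ_isHom hw _ _).mul_tot_mul_one hW (opQ1_isHom hw _ _),
      algQ_comm hq0 hq hB hS hW h (hQ _ _) (hQ1 _ _), (opQ1_isHom hw _ _).mul_tot_mul_one hW (opQ_isHom hw _ _)]
  | Q1_Q1 i j n m l =>
    rw [← (opQ1_isHom hw _ _).mul_tot_mul_one hW (opQ1_isHom hw _ _),
      algQ_comm hq0 hq hB hS hW h (hQ1 _ _) (hQ1 _ _),
      (opQ1_isHom hw _ _).mul_tot_mul_one hW (opQ1_isHom hw _ _)]

theorem holds_fullRel : Holds (FullRel G q c g) := by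
  have hw := hB.weight
  have hκ := q_sub_inv_ne hq0 hq
  have hE : ∀ i j m n l, (opE G c g i m * opE G c g j n) l =
      (opE G c g i m).tot hW * (opE G c g j n).tot hW * g (.one l) := fun i j m n l =>
    ((opE_isHom hw i m).mul_tot_mul_one hW (opE_isHom hw j n) l).symm
  have hF : ∀ i j m n l, (opF G c g i m * opF G c g j n) l =
      (opF G c g i m).tot hW * (opF G c g j n).tot hW * g (.one l) := fun i j m n l =>
    ((opF_isHom hw i m).mul_tot_mul_one hW (opF_isHom hw j n) l).symm
  have hEEE : ∀ i j k m n p l, (opE G c g i m * opE G c g j n * opE G c g k p) l =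
      (opE G c g i m).tot hW * (opE G c g j n).tot hW * (opE G c g k p).tot hW * g (.one l) :=
    fun i j k m n p l => by
      rw [← (opE_isHom hw _ _).tot_mul hW (opE_isHom hw _ _),
        ((opE_isHom hw _ _).mul (opE_isHom hw _ _)).mul_tot_mul_one hW (opE_isHom hw _ _)]
  have hFFF : ∀ i j k m n p l, (opF G c g i m * opF G c g j n * opF G c g k p) l =
      (opF G c g i m).tot hW * (opF G c g j n).tot hW * (opF G c g k p).tot hW * g (.one l) :=
    fun i j k m n p l => by
      rw [← (opF_isHom hw _ _).tot_mul hW (opF_isHom hw _ _),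
        ((opF_isHom hw _ _).mul (opF_isHom hw _ _)).mul_tot_mul_one hW (opF_isHom hw _ _)]
  set X := realize hq0 hκ hB hW hS with hX
  have eE : ∀ i m, (opE G c g i m).tot hW = X.E i m := fun i m => rfl
  have eF : ∀ i m, (opF G c g i m).tot hW = X.F i m := fun i m => rfl
  intro x y hxy
  cases hxy with
  | weight _ _ hxy => exact hw _ _ hxy
  | pqComm _ _ hxy => exact holds_pqCommRel hq0 hq hB hS hW h _ _ hxy
  | heis _ _ hxy => exact hB.heis _ _ hxy
  | pqef _ _ hxy => exact holds_pqefRel hq0 hκ hB hW hS h _ _ hxy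
  | ef _ _ hxy => exact hB _ _ (.ef _ _ hxy)
  | far _ _ hxy => exact hB _ _ (.far _ _ hxy)
  | EE i m n l =>
    have h1 := X.quadE_eq_zero h i i (m - 1) (n - 1)
    simp only [Currents.quadE, sub_add_cancel, cartan_self, zpow_ofNat] at h1
    simp only [hE, eE, ← add_mul, ← smul_mul_assoc]
    congr 1
    linear_combination (norm := module) h1
  | FF i m n l =>
    have h1 := X.quadF h i i (m - 1) (n - 1)
    simp only [sub_add_cancel, cartan_self, zpow_ofNat] at h1
    -- The F relation comes with q⁻²; the stated form has q² on the other order of the products.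
    have h2 := congrArg (fun x => q ^ 2 • x) h1
    simp only [hF, eF, ← add_mul, ← smul_mul_assoc]
    congr 1
    linear_combination (norm := skip) -h2
    match_scalars <;> field_simp <;> ring
  | EE_adj i j hij m n l =>
    have h1 := X.quadE_eq_zero h i j (m - 1) (n - 1)
    simp only [Currents.quadE, sub_add_cancel, cartan_adj G hij.symm, zpow_neg_one] at h1
    simp only [hE, eE, ← add_mul, ← smul_mul_assoc]
    congr 1
    linear_combination (norm := module) h1
  | FF_adj i j hij m n l =>
    have h1 := X.quadF h i j (m - 1) (n - 1)
    simp only [sub_add_cancel, cartan_adj G hij.symm, zpow_neg_one, inv_inv] at h1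
    have h2 := congrArg (fun x => q⁻¹ • x) h1
    simp only [hF, eF, ← add_mul, ← smul_mul_assoc]
    congr 1
    linear_combination (norm := skip) -h2
    match_scalars <;> field_simp <;> ring
  | serreE i j hij n m l =>
    have h1 := X.serreE h hij (m 0) (m 1) n
    simp only [hEEE, eE, ← add_mul, ← smul_mul_assoc, ← Finset.sum_mul]
    congr 1
    rw [qint_two hq0 hκ, sum_perm_fin_two, sum_perm_fin_two]
    exact h1
  | serreF i j hij n m l =>
    have h1 := X.serreF h hij (m 0) (m 1) n
    simp only [hFFF, eF, ← add_mul, ← smul_mul_assoc, ← Finset.sum_mul]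
    congr 1
    rw [qint_two hq0 hκ, sum_perm_fin_two, sum_perm_fin_two]
    exact h1

end Full
end QAff

namespace QAff

/-! ### From the full to the reduced relations -/

section Reduce

variable {I : Type*} [DecidableEq I] {G : SimpleGraph I} [DecidableRel G.Adj]
variable {K : Type*} [Field K] {q : K} {c : ℕ}
variable {A B : Type*} [Ring A] [Algebra K A] [Ring B] [Algebra K B] {f : A →ₐ[K] B} {g : Gen I → A}

theorem eq_of_add_self_eq (K : Type*) [Field K] [CharZero K] {M : Type*} [AddCommGroup M] [Module K M] {x y : M}
    (h : x + x = y + y) : x = y := by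
  rw [← two_smul K x, ← two_smul K y] at h
  exact smul_right_injective _ two_ne_zero h

/-- The full relations imply the reduced ones. -/
theorem eq_of_reducedRel [CharZero K] (h : ∀ x y, FullRel G q c g x y → f x = f y) {x y : A}
    (hxy : ReducedRel G q c g x y) : f x = f y := by
  cases hxy with
  | base hxy =>
    cases hxy with
    | weight _ _ hxy => exact h _ _ (.weight _ _ hxy)
    | heis _ _ hxy => exact h _ _ (.heis _ _ hxy)
    | ef _ _ hxy => exact h _ _ (.ef _ _ hxy)
    | far _ _ hxy => exact h _ _ (.far _ _ hxy)
    | EE i n l =>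
      have h1 := h _ _ (.EE i n n l)
      rw [smul_add, map_add, map_add] at h1
      exact eq_of_add_self_eq K h1
    | FF i n l =>
      have h1 := h _ _ (.FF i n n l)
      rw [smul_add, map_add, map_add] at h1
      exact eq_of_add_self_eq K h1
    | EE_adj i j hij l =>
      have h1 := h _ _ (.EE_adj i j hij 1 1 l)
      rwa [sub_self] at h1
    | FF_adj i j hij l =>
      have h1 := h _ _ (.FF_adj i j hij 0 0 l)
      rwa [zero_sub] at h1
  | serre hxy =>
    cases hxy with
    | E i j hij m n l =>
      have h1 := h _ _ (.serreE i j hij n (fun _ => m) l)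
      rw [sum_perm_fin_two, sum_perm_fin_two] at h1
      exact eq_of_add_self_eq K ((map_add f _ _).symm.trans (h1.trans (map_add f _ _)))
    | F i j hij m n l =>
      have h1 := h _ _ (.serreF i j hij n (fun _ => m) l)
      rw [sum_perm_fin_two, sum_perm_fin_two] at h1
      exact eq_of_add_self_eq K ((map_add f _ _).symm.trans (h1.trans (map_add f _ _)))

theorem one_mul_gen (hw : Holds (WeightRel G c g)) (s : Gen I) : ∃ l, g (.one l) * g s = g s := by
  cases s with
  | one l => exact ⟨l, hw _ _ (.idem l)⟩
  | E i r l => exact ⟨_, hw _ _ (.E_left i r l)⟩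
  | F i r l => exact ⟨_, hw _ _ (.F_left i r l)⟩
  | P i n l => exact ⟨_, hw _ _ (.P_left i n l)⟩
  | P1 i n l => exact ⟨_, hw _ _ (.P1_left i n l)⟩
  | Q i n l => exact ⟨_, hw _ _ (.Q_left i n l)⟩
  | Q1 i n l => exact ⟨_, hw _ _ (.Q1_left i n l)⟩

/-- Each of the relations that do not occur in the reduced presentation lives over one weight. -/
theorem FullRel.eq_or_mul_one (hB : Holds (BaseRel G q c g)) {x y : A} (h : FullRel G q c g x y) :
    x = y ∨ ∃ l, x * g (.one l) = x ∧ y * g (.one l) = y := by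
  have hw : Holds (WeightRel G c g) := fun x y h => hB x y (.weight x y h)
  have hmul : ∀ (X Y : WOp I A) l u, Y l * u = Y l → (X * Y) l * u = (X * Y) l := fun X Y l u h => by
    change X _ * Y l * u = X _ * Y l
    rw [mul_assoc, h]
  have hE : ∀ i r l, opE G c g i r l * g (.one l) = opE G c g i r l := fun i r l => hw _ _ (.E_right i r l)
  have hF : ∀ i r l, opF G c g i r l * g (.one l) = opF G c g i r l := fun i r l => hw _ _ (.F_right i r l)
  have hP : ∀ i r l, opP c g i r l * g (.one l) = opP c g i r l := fun i r l => hw _ _ (.P_right i r l)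
  have hP1 : ∀ i r l, opP1 c g i r l * g (.one l) = opP1 c g i r l := fun i r l => hw _ _ (.P1_right i r l)
  have hQ : ∀ i r l, opQ c g i r l * g (.one l) = opQ c g i r l := fun i r l => hw _ _ (.Q_right i r l)
  have hQ1 : ∀ i r l, opQ1 c g i r l * g (.one l) = opQ1 c g i r l := fun i r l => hw _ _ (.Q1_right i r l)
  have hQb : ∀ i n l, opQb q c g i n l * g (.one l) = opQb q c g i n l := fun i n l => by
    simp only [opQb, Finset.sum_mul, smul_mul_assoc, hmul, hQ]
  have hPb : ∀ i n l, opPb q c g i n l * g (.one l) = opPb q c g i n l := fun i n l => by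
    simp only [opPb, Finset.sum_mul, smul_mul_assoc, hmul, hP]
  cases h
  case weight hxy => exact .inl (hw _ _ hxy)
  case heis hxy => exact .inl (hB _ _ (.heis _ _ hxy))
  case ef hxy => exact .inl (hB _ _ (.ef _ _ hxy))
  case far hxy => exact .inl (hB _ _ (.far _ _ hxy))
  case pqComm hxy =>
    cases hxy with
    | _ i j n m l => exact .inr ⟨l, by simp only [hmul, hP, hP1, hQ, hQ1], by
        simp only [hmul, hP, hP1, hQ, hQ1]⟩
  case pqef hxy =>
    right
    cases hxy
    all_goals
      rename_i l
      exact ⟨l, by simp only [add_mul, sub_mul, neg_mul, smul_mul_assoc, hmul, hE, hF, hQb, hPb], by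
        simp only [add_mul, sub_mul, neg_mul, smul_mul_assoc, hmul, hE, hF, hQb, hPb]⟩
  all_goals
    rename_i l
    exact .inr ⟨l, by simp only [add_mul, smul_mul_assoc, Finset.sum_mul, hmul, hE, hF], by
      simp only [add_mul, smul_mul_assoc, Finset.sum_mul, hmul, hE, hF]⟩

end Reduce

/-! ### The left ideal generated by the idempotents -/

section Regular

variable {I : Type*} {K : Type*} [Field K] {A : Type*} [Ring A] [Algebra K A] (g : Gen I → A)

/-- The left ideal generated by the idempotents `1_l`. -/
def regular : Submodule A A := Submodule.span A (Set.range fun l => g (.one l))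

/-- The action on `regular g`. -/
noncomputable def regularRep : A →ₐ[K] Module.End K (regular g) := Algebra.lsmul K K (regular g)

variable {g}

/-- Evaluate both operators at the vector 1_l of the left ideal. -/
theorem mul_one_eq_of_regularRep {x y : A} (h : regularRep (K := K) g x = regularRep g y) (l : AffWeight I) :
    x * g (.one l) = y * g (.one l) :=
  congrArg Subtype.val (LinearMap.congr_fun h ⟨g (.one l), Submodule.subset_span ⟨l, rfl⟩⟩)

variable [Fintype I] [DecidableEq I] {G : SimpleGraph I} [DecidableRel G.Adj] {c : ℕ}

theorem iSupIndep_weightSpace {V : Type*} [AddCommGroup V] [Module K V] {g : Gen I → Module.End K V}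
    (hw : Holds (WeightRel G c g)) : iSupIndep (weightSpace g) := by
  intro l
  rw [Submodule.disjoint_def]
  rintro _ ⟨u, rfl⟩ hv
  have h1 : (⨆ m, ⨆ (_ : m ≠ l), weightSpace g m) ≤ LinearMap.ker (g (.one l)) :=
    iSup₂_le fun m hm => by
      rintro _ ⟨v, rfl⟩
      exact LinearMap.congr_fun (hw _ _ (.orth l m hm.symm)) v
  have h2 : g (.one l) (g (.one l) u) = 0 := h1 hv
  rwa [← Module.End.mul_apply, hw _ _ (.idem l)] at h2

/-- Every generator s satisfies 1_l s = s for some l, so left multiplication by s lands in one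
weight space. Hence the sum of the weight spaces is stable under the algebra; it contains all 1_l,
so it is the whole ideal. The full algebra would not do, as its unit need not be a finite sum of
weight vectors. -/
theorem isWeightModule_regular (hw : Holds (WeightRel G c g)) (hgen : Algebra.adjoin K (Set.range g) = ⊤) :
    IsWeightModule (regularRep (K := K) g ∘ g) := by
  refine DirectSum.isInternal_submodule_of_iSupIndep_of_iSup_eq_top
    (iSupIndep_weightSpace (holds_weightRel fun x y h => by rw [hw x y h])) ?_
  set P := ⨆ l, weightSpace (regularRep (K := K) g ∘ g) l with hP
  have hmem : ∀ (l : AffWeight I) (v : regular g), g (.one l) * (v : A) = v → v ∈ P := fun l v hv =>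
    Submodule.mem_iSup_of_mem (p := weightSpace (regularRep (K := K) g ∘ g)) l ⟨v, Subtype.ext hv⟩
  have hstep : ∀ a ∈ Algebra.adjoin K (Set.range g), ∀ v ∈ P, a • v ∈ P := by
    intro a ha
    induction ha using Algebra.adjoin_induction with
    | mem x hx =>
      obtain ⟨s, rfl⟩ := hx
      obtain ⟨l, hl⟩ := one_mul_gen hw s
      exact fun v _ => hmem l _ (by rw [Submodule.coe_smul, smul_eq_mul, ← mul_assoc, hl])
    | algebraMap r =>
      intro v hv
      rw [algebraMap_smul]
      exact P.smul_mem r hv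
    | add x y _ _ hx hy => intro v hv; rw [add_smul]; exact P.add_mem (hx v hv) (hy v hv)
    | mul x y _ _ hx hy => intro v hv; rw [mul_smul]; exact hx _ (hy v hv)
  rw [eq_top_iff]
  rintro ⟨v, hv⟩ -
  induction hv using Submodule.span_induction with
  | mem x hx => obtain ⟨l, rfl⟩ := hx; exact hmem l _ (hw _ _ (.idem l))
  | zero => exact P.zero_mem
  | add x y hx hy h1 h2 => exact P.add_mem h1 h2
  | smul a x hx h1 => exact hstep a (hgen ▸ Algebra.mem_top) _ h1

end Regular

/-! ### Comparison of the two presentations -/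

section Main

variable {I : Type*} [Fintype I] [DecidableEq I] {G : SimpleGraph I} [DecidableRel G.Adj]
variable {K : Type*} [Field K] {q : K} {c : ℕ}

theorem adjoin_gen (r : FreeAlgebra K (Gen I) → FreeAlgebra K (Gen I) → Prop) :
    Algebra.adjoin K (Set.range (Presented.gen r)) = ⊤ := by
  have h1 : Set.range (Presented.gen r) = RingQuot.mkAlgHom K r '' Set.range (FreeAlgebra.ι K) := by
    rw [← Set.range_comp]; rfl
  rw [h1, ← AlgHom.map_adjoin, FreeAlgebra.adjoin_range_ι, Algebra.map_top, AlgHom.range_eq_top]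
  exact RingQuot.mkAlgHom_surjective K r

/-- The full relations hold on the weight module `regular`; a relation supported at 1_l can be read
off in the algebra by evaluating there. -/
theorem holds_fullRel_reduced [CharZero K] (hq0 : q ≠ 0) (hq : ∀ n : ℕ, 0 < n → q ^ n ≠ 1)
    (h : Generic q (q ^ c)) : Holds (FullRel G q c (Presented.gen (reducedRels G q c))) := by
  set g := Presented.gen (reducedRels G q c) with hg
  have hB : Holds (BaseRel G q c g) := holds_baseRel (f := RingQuot.mkAlgHom K (reducedRels G q c))
    fun x y hxy => RingQuot.mkAlgHom_rel K (ReducedRel.base x y hxy)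
  have hS : Holds (SerreEqRel G q c g) := holds_serreEqRel (f := RingQuot.mkAlgHom K (reducedRels G q c))
    fun x y hxy => RingQuot.mkAlgHom_rel K (ReducedRel.serre x y hxy)
  have hF : Holds (FullRel G q c (regularRep (K := K) g ∘ g)) :=
    holds_fullRel hq0 hq (holds_baseRel fun x y hxy => by rw [hB x y hxy])
      (holds_serreEqRel fun x y hxy => by rw [hS x y hxy])
      (isWeightModule_regular (fun x y hxy => hB x y (.weight x y hxy)) (adjoin_gen _)) h
  intro x y hxy
  rcases hxy.eq_or_mul_one hB with h1 | ⟨l, hx, hy⟩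
  · exact h1
  · rw [← hx, ← hy]
    exact mul_one_eq_of_regularRep (K := K) (hF _ _ hxy.map) l

/-- The two presentations define the same algebra. -/
theorem exists_presented_equiv [CharZero K] (hq0 : q ≠ 0) (hq : ∀ n : ℕ, 0 < n → q ^ n ≠ 1)
    (h : Generic q (q ^ c)) :
    ∃ φ : Presented (reducedRels G q c) ≃ₐ[K] Presented (fullRels G q c),
      ∀ s : Gen I, φ (Presented.gen _ s) = Presented.gen _ s := by
  let φ : Presented (reducedRels G q c) →ₐ[K] Presented (fullRels G q c) :=
    RingQuot.liftAlgHom K ⟨RingQuot.mkAlgHom K (fullRels G q c), fun x y hxy =>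
      eq_of_reducedRel (fun x y hxy => RingQuot.mkAlgHom_rel K hxy) hxy⟩
  let θ : Presented (fullRels G q c) →ₐ[K] Presented (reducedRels G q c) :=
    RingQuot.liftAlgHom K ⟨RingQuot.mkAlgHom K (reducedRels G q c), fun x y hxy =>
      holds_fullRel_reduced hq0 hq h _ _ (FullRel.map hxy)⟩
  have hφ : ∀ s, φ (Presented.gen _ s) = Presented.gen _ s := fun s => RingQuot.liftAlgHom_mkAlgHom_apply _ _ _ _
  have hθ : ∀ s, θ (Presented.gen _ s) = Presented.gen _ s := fun s => RingQuot.liftAlgHom_mkAlgHom_apply _ _ _ _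
  refine ⟨AlgEquiv.ofAlgHom φ θ ?_ ?_, hφ⟩
  · refine RingQuot.ringQuot_ext' K _ _ (FreeAlgebra.hom_ext (funext fun s => ?_))
    exact (congrArg φ (hθ s)).trans (hφ s)
  · refine RingQuot.ringQuot_ext' K _ _ (FreeAlgebra.hom_ext (funext fun s => ?_))
    exact (congrArg θ (hφ s)).trans (hθ s)

end Main
end QAff

namespace QAff

open PowerSeries

/-! ### Exponentials and logarithms of power series -/

section Exp

variable {K : Type*} [Field K] [CharZero K]

theorem map_expSeries {A B : Type*} [Ring A] [Algebra K A] [Ring B] [Algebra K B] (f : A →ₐ[K] B)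
    (H : PowerSeries A) (n : ℕ) :
    coeff n (expSeries K (PowerSeries.map (f : A →+* B) H)) = f (coeff n (expSeries K H)) := by
  simp only [expSeries, coeff_mk, map_sum, map_smul, ← map_pow, coeff_map, AlgHom.coe_toRingHom]

variable {S : Type*} [CommRing S] [Algebra K S]

theorem coeff_pow_eq_zero {H : PowerSeries S} (h0 : constantCoeff H = 0) {n k : ℕ} (hk : n < k) :
    coeff n (H ^ k) = 0 :=
  X_pow_dvd_iff.1 (pow_dvd_pow_of_dvd (X_dvd_iff.2 h0) k) n hk

/-- Powers of H beyond the n-th do not contribute to the n-th coefficient, so one bound can serve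
several coefficients at once. -/
theorem coeff_expSeries {H : PowerSeries S} (h0 : constantCoeff H = 0) {n N : ℕ} (hN : n < N) :
    coeff n (expSeries K H) = ∑ k ∈ Finset.range N, ((k.factorial : K)⁻¹) • coeff n (H ^ k) := by
  rw [expSeries, coeff_mk]
  refine Finset.sum_subset (Finset.range_subset_range.2 hN) fun k _ hk => ?_
  rw [coeff_pow_eq_zero h0 (by simpa using hk), smul_zero]

theorem constantCoeff_expSeries (H : PowerSeries S) : constantCoeff (expSeries K H) = 1 := by
  rw [← coeff_zero_eq_constantCoeff_apply, expSeries, coeff_mk]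
  simp

theorem derivative_expSeries {H : PowerSeries S} (h0 : constantCoeff H = 0) :
    derivative S (expSeries K H) = expSeries K H * derivative S H := by
  ext n
  rw [coeff_derivative, coeff_expSeries (K := K) h0 (N := n + 2) (by omega), Finset.sum_range_succ',
    add_mul, Finset.sum_mul, coeff_mul]
  have h1 : ∀ p ∈ Finset.HasAntidiagonal.antidiagonal n, coeff p.1 (expSeries K H) * coeff p.2 (derivative S H) =
      ∑ k ∈ Finset.range (n + 1), ((k.factorial : K)⁻¹) • (coeff p.1 (H ^ k) * coeff p.2 (derivative S H)) :=
    fun p hp => by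
      have h2 := Finset.HasAntidiagonal.mem_antidiagonal.1 hp
      rw [coeff_expSeries (K := K) h0 (N := n + 1) (by omega), Finset.sum_mul]
      simp only [smul_mul_assoc]
  rw [Finset.sum_congr rfl h1, Finset.sum_comm]
  simp only [← Finset.smul_sum, ← coeff_mul]
  have h3 : coeff (n + 1) (H ^ 0) = 0 := by rw [pow_zero, coeff_one, if_neg n.succ_ne_zero]
  rw [h3, smul_zero, zero_mul, add_zero]
  refine Finset.sum_congr rfl fun k _ => ?_
  have h4 := congrArg (coeff n) (derivative_pow (R := S) H (k + 1))
  rw [coeff_derivative, Nat.add_sub_cancel, mul_assoc, ← map_natCast (C (R := S)), coeff_C_mul] at h4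
  rw [smul_mul_assoc, h4, Nat.factorial_succ, Nat.cast_mul, mul_inv, ← nsmul_eq_mul, ← Nat.cast_smul_eq_nsmul K,
    smul_smul]
  congr 1
  have h5 : ((k + 1 : ℕ) : K) ≠ 0 := Nat.cast_ne_zero.2 k.succ_ne_zero
  field_simp

theorem expSeries_neg_mul {H : PowerSeries S} (h0 : constantCoeff H = 0) :
    expSeries K (-H) * expSeries K H = 1 := by
  have := Currents.isAddTorsionFree K S
  refine derivative.ext ?_ (by rw [map_mul, constantCoeff_expSeries, constantCoeff_expSeries, map_one, one_mul])
  rw [Derivation.leibniz, derivative_expSeries h0, derivative_expSeries (by rw [map_neg, h0, neg_zero]),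
    derivative_one, map_neg, smul_eq_mul, smul_eq_mul]
  ring

/-- The product A·exp(-H) has zero derivative and constant term 1. This uniqueness of the solution
of A' = AH' yields both the addition formula and the logarithm. -/
theorem eq_expSeries {A H : PowerSeries S} (h0 : constantCoeff H = 0) (hA : constantCoeff A = 1)
    (hd : derivative S A = A * derivative S H) : A = expSeries K H := by
  have := Currents.isAddTorsionFree K S
  have h1 : A * expSeries K (-H) = 1 := by
    refine derivative.ext ?_ (by rw [map_mul, constantCoeff_expSeries, hA, map_one, one_mul])
    rw [Derivation.leibniz, hd, derivative_expSeries (by rw [map_neg, h0, neg_zero]),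
      derivative_one, map_neg, smul_eq_mul, smul_eq_mul]
    ring
  rw [← mul_one A, ← expSeries_neg_mul (K := K) h0, ← mul_assoc, h1, one_mul]

theorem expSeries_add {G H : PowerSeries S} (hG : constantCoeff G = 0) (hH : constantCoeff H = 0) :
    expSeries K (G + H) = expSeries K G * expSeries K H := by
  refine (eq_expSeries (by rw [map_add, hG, hH, add_zero]) ?_ ?_).symm
  · rw [map_mul, constantCoeff_expSeries, constantCoeff_expSeries, one_mul]
  · rw [Derivation.leibniz, derivative_expSeries hG, derivative_expSeries hH, map_add, smul_eq_mul, smul_eq_mul]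
    ring

theorem coeff_rescale_algebraMap (x : K) (H : PowerSeries S) (n : ℕ) :
    coeff n (rescale (algebraMap K S x) H) = x ^ n • coeff n H := by
  rw [coeff_rescale, ← map_pow, ← Algebra.smul_def]

theorem expSeries_rescale (x : K) (H : PowerSeries S) :
    expSeries K (rescale (algebraMap K S x) H) = rescale (algebraMap K S x) (expSeries K H) := by
  ext n
  rw [coeff_rescale_algebraMap]
  simp only [expSeries, coeff_mk, ← map_pow, coeff_rescale_algebraMap, Finset.smul_sum]
  exact Finset.sum_congr rfl fun k _ => smul_comm _ _ _

/-- H integrates the logarithmic derivative A'/A = BA'. The span condition records that its n-th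
coefficient is homogeneous of degree n in the coefficients of A and B. -/
theorem exists_log {A B : PowerSeries S} (hA : constantCoeff A = 1) (hAB : B * A = 1) :
    ∃ H : PowerSeries S, constantCoeff H = 0 ∧ expSeries K H = A ∧ expSeries K (-H) = B ∧
      ∀ n, coeff n H ∈ Submodule.span K {x | ∃ k ≤ n, x = coeff k B * coeff (n - k) A} := by
  -- At n = 0 the inverse of 0 is 0, which gives H its zero constant term.
  let H : PowerSeries S := mk fun n => (n : K)⁻¹ • coeff (n - 1) (B * derivative S A)
  have h0 : constantCoeff H = 0 := by
    rw [← coeff_zero_eq_constantCoeff_apply, coeff_mk, Nat.cast_zero, inv_zero, zero_smul]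
  have hd : derivative S H = B * derivative S A := by
    ext n
    have h5 : ((n + 1 : ℕ) : K) ≠ 0 := Nat.cast_ne_zero.2 n.succ_ne_zero
    rw [coeff_derivative, coeff_mk, Nat.add_sub_cancel, ← Nat.cast_succ, mul_comm, ← nsmul_eq_mul,
      ← Nat.cast_smul_eq_nsmul K, smul_smul, mul_inv_cancel₀ h5, one_smul]
  have h1 : A = expSeries K H := eq_expSeries h0 hA (by rw [hd, ← mul_assoc, mul_comm A, hAB, one_mul])
  have h2 : ∀ n, coeff n H ∈ Submodule.span K {x | ∃ k ≤ n, x = coeff k B * coeff (n - k) A} := fun n => by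
    rcases n with - | n
    · rw [coeff_zero_eq_constantCoeff_apply, h0]; exact Submodule.zero_mem _
    rw [coeff_mk, Nat.add_sub_cancel, coeff_mul]
    refine Submodule.smul_mem _ _ (Submodule.sum_mem _ fun p hp => ?_)
    have h3 := Finset.HasAntidiagonal.mem_antidiagonal.1 hp
    rw [coeff_derivative, ← Nat.cast_succ, mul_comm (coeff _ A), ← nsmul_eq_mul, mul_smul_comm,
      ← Nat.cast_smul_eq_nsmul K]
    exact Submodule.smul_mem _ _ (Submodule.subset_span ⟨p.1, by omega, by rw [show n + 1 - p.1 = p.2 + 1 by omega]⟩)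
  refine ⟨H, h0, h1.symm, ?_, h2⟩
  calc expSeries K (-H) = expSeries K (-H) * expSeries K H * B := by
        rw [mul_assoc, ← h1, mul_comm A, hAB, mul_one]
    _ = B := by rw [expSeries_neg_mul h0, one_mul]

/-- The Drinfeld generators which belong to a pair of mutually inverse series. -/
theorem exists_vertex_log {q : K} (hq0 : q ≠ 0) (hq : ∀ n : ℕ, 0 < n → q ^ n ≠ 1) {a b w : ℕ → S}
    (a0 : a 0 = 1) (b0 : b 0 = 1)
    (hab : ∀ n, 0 < n → ∑ k ∈ Finset.range (n + 1), (-1 : K) ^ k • (b k * a (n - k)) = 0)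
    (hw : ∀ n, w n = ∑ m ∈ Finset.range (n + 1), ((-q) ^ m * qint q m) • (b (n - m) * a m)) :
    ∃ h : ℕ → S,
      (∀ n, coeff n (expSeries K (mk fun n => if n = 0 then 0 else (qint q n)⁻¹ • h n)) = a n) ∧
      (∀ n, coeff n (expSeries K (mk fun n => if n = 0 then 0 else (-(qint q n)⁻¹) • h n)) =
        (-1 : K) ^ n • b n) ∧
      (∀ n, 0 < n → coeff n (expSeries K (mk fun n => if n = 0 then 0 else (q - q⁻¹) • h n)) =
        (((-q) ^ n)⁻¹ * (q - q⁻¹)) • w n) ∧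
      ∀ n, h n ∈ Submodule.span K {x | ∃ k ≤ n, x = b k * a (n - k)} := by
  have hκ := q_sub_inv_ne hq0 hq
  have hn0 : ∀ n : ℕ, n ≠ 0 → qint q n ≠ 0 := fun n hn => qint_ne_zero hq0 hq (by omega)
  obtain ⟨H, h0, hA, hB, hsp⟩ := exists_log (K := K) (A := mk a) (B := mk fun n => (-1 : K) ^ n • b n)
    (by rw [← coeff_zero_eq_constantCoeff_apply, coeff_mk, a0]) (by
      ext n
      rw [coeff_mul, Finset.Nat.sum_antidiagonal_eq_sum_range_succ_mk, coeff_one]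
      simp only [coeff_mk, smul_mul_assoc]
      split_ifs with hn
      · subst hn; simp [a0, b0]
      · exact hab n (Nat.pos_of_ne_zero hn))
  have hc : ∀ n, n = 0 → coeff n H = 0 := fun n hn => by rw [hn, coeff_zero_eq_constantCoeff_apply, h0]
  have e1 : (mk fun n => if n = 0 then 0 else (qint q n)⁻¹ • qint q n • coeff n H) = H := by
    ext n
    rw [coeff_mk]
    split_ifs with hn
    · rw [hc n hn]
    · rw [smul_smul, inv_mul_cancel₀ (hn0 n hn), one_smul]
  have e2 : (mk fun n => if n = 0 then 0 else (-(qint q n)⁻¹) • qint q n • coeff n H) = -H := by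
    ext n
    rw [coeff_mk, map_neg]
    split_ifs with hn
    · rw [hc n hn, neg_zero]
    · rw [smul_smul, neg_mul, inv_mul_cancel₀ (hn0 n hn), neg_smul, one_smul]
  -- The numbers h_n/[n] have to be the coefficients of the logarithm H.
  refine ⟨fun n => qint q n • coeff n H, fun n => by rw [e1, hA, coeff_mk], fun n => by rw [e2, hB, coeff_mk],
    fun n hn => ?_, fun n => ?_⟩
  swap
  · refine Submodule.smul_mem _ _ (Submodule.span_le.2 ?_ (hsp n))
    rintro _ ⟨k, hk, rfl⟩
    rw [coeff_mk, coeff_mk, smul_mul_assoc]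
    exact Submodule.smul_mem _ _ (Submodule.subset_span ⟨k, hk, rfl⟩)
  -- As (q - q⁻¹)[n] = qⁿ - q⁻ⁿ, the series is H(qz) - H(q⁻¹z), that is, H(q²z) - H(z) with z
  -- replaced by q⁻¹z.
  have e3 : (mk fun n => if n = 0 then 0 else (q - q⁻¹) • qint q n • coeff n H) =
      rescale (algebraMap K S q⁻¹) (-H + rescale (algebraMap K S (q ^ 2)) H) := by
    ext n
    rw [coeff_mk, coeff_rescale_algebraMap, map_add, coeff_rescale_algebraMap, map_neg]
    split_ifs with hn
    · rw [hc n hn]; simp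
    · rw [smul_smul, smul_add, smul_smul, smul_neg, ← neg_smul, ← add_smul, qint, mul_div_cancel₀ _ hκ]
      congr 1
      rw [zpow_neg, zpow_natCast, inv_pow, ← pow_mul, two_mul, pow_add]
      have := pow_ne_zero n hq0
      field_simp
      ring
  -- Subtracting the vanishing sum of the (-1)^k b_k a_(n-k) turns the coefficient q^(2m) into
  -- q^(2m) - 1 = q^m(q - q⁻¹)[m], where m = n - k, as in the definition of w_n.
  rw [e3, expSeries_rescale, coeff_rescale_algebraMap,
    expSeries_add (by rw [map_neg, h0, neg_zero])
      (by rw [← coeff_zero_eq_constantCoeff_apply, coeff_rescale_algebraMap, hc 0 rfl, smul_zero]),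
    expSeries_rescale, hA, hB, hw, coeff_mul, Finset.Nat.sum_antidiagonal_eq_sum_range_succ_mk,
    ← sub_zero (Finset.sum _ _), ← hab n hn, ← Finset.sum_sub_distrib, ← Finset.sum_range_reflect
      (fun m => ((-q) ^ m * qint q m) • (b (n - m) * a m)), Finset.smul_sum, Finset.smul_sum]
  refine Finset.sum_congr rfl fun k hk => ?_
  have hkn : k ≤ n := Finset.mem_range_succ_iff.1 hk
  obtain ⟨m, rfl⟩ := Nat.exists_eq_add_of_le hkn
  simp only [coeff_rescale_algebraMap, coeff_mk, show k + m + 1 - 1 - k = m by omega,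
    show k + m - k = m by omega, show k + m - m = k by omega, smul_mul_smul_comm]
  rw [← sub_smul, smul_smul, smul_smul]
  congr 1
  rw [qint, zpow_neg, zpow_natCast, mul_assoc, mul_left_comm (q - q⁻¹), mul_div_cancel₀ _ hκ, neg_pow q, neg_pow q m,
    inv_pow, pow_add, pow_add, ← pow_mul, two_mul, pow_add]
  have h1 := pow_ne_zero k hq0
  have h2 := pow_ne_zero m hq0
  have h3 : (-1 : K) ^ k * (-1) ^ k = 1 := by rw [← mul_pow, neg_mul_neg, one_mul, one_pow]
  have h4 : (-1 : K) ^ k ≠ 0 := left_ne_zero_of_mul_eq_one h3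
  have h5 : (-1 : K) ^ m ≠ 0 := pow_ne_zero _ (neg_ne_zero.2 one_ne_zero)
  field_simp
  linear_combination (q ^ m * q ^ m - 1) * h3

end Exp
end QAff

namespace QAff

/-! ### Drinfeld's relations from the relations of currents -/

/-- Drinfeld generators which match given currents; `u` is a square root of `t`. -/
structure Matches {I : Type*} [DecidableEq I] {G : SimpleGraph I} [DecidableRel G.Adj]
    {K : Type*} [Field K] {q t : K} {s : ℤ} {R : Type*} [Ring R] [Algebra K R]
    (X : Currents G q t s R) (u : K) (D : DrinfeldGens I R) : Prop where
  u_sq : u ^ 2 = t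
  qc2 : (D.qc2 : R) = u • 1
  x_pos : ∀ i n, D.x 1 i n = (-(q * u)) ^ n • X.E i (-n)
  x_neg : ∀ i n, D.x (-1) i n = (-(q * u)) ^ n • X.F i (-n)
  psi_pos : ∀ i n, D.psi q 1 i n = (-q) ^ n • X.ψ i (-n)
  psi_neg : ∀ i n, D.psi q (-1) i n = (-q) ^ n • X.φ i (-n)

namespace Matches

variable {I : Type*} [DecidableEq I] {G : SimpleGraph I} [DecidableRel G.Adj]
variable {K : Type*} [Field K] {q t u : K} {s : ℤ} {R : Type*} [Ring R] [Algebra K R]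
variable {X : Currents G q t s R} {D : DrinfeldGens I R}

theorem u0 (h : Generic q t) (hD : Matches X u D) : u ≠ 0 := by
  rintro rfl
  exact h.t0 (by rw [← hD.u_sq, zero_pow two_ne_zero])

theorem qc2_zpow (h : Generic q t) (hD : Matches X u D) (n : ℤ) : ((D.qc2 ^ n : Rˣ) : R) = u ^ n • 1 := by
  have h1 : D.qc2 = Units.map (algebraMap K R).toMonoidHom (Units.mk0 u (hD.u0 h)) :=
    Units.ext (by rw [hD.qc2, Algebra.smul_def, mul_one]; rfl)
  rw [h1, ← map_zpow, Algebra.smul_def, mul_one, Units.coe_map, Units.val_zpow_eq_zpow_val]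
  rfl

theorem qc (h : Generic q t) (hD : Matches X u D) (n : ℤ) : D.qc n = t ^ n • 1 := by
  rw [DrinfeldGens.qc, hD.qc2_zpow h, zpow_mul, ← hD.u_sq, zpow_ofNat]

theorem qcHalf (h : Generic q t) (hD : Matches X u D) (n : ℤ) : D.qcHalf n = u ^ n • 1 :=
  hD.qc2_zpow h n

theorem sc_eq (x : K) : DrinfeldGens.sc R x = x • 1 := Algebra.algebraMap_eq_smul_one x

variable [CharZero K]

theorem psi_psi (h : Generic q t) (hD : Matches X u D) (s : ℤˣ) (i j : I) :
    zw (D.psi q s i) (D.psi q s j) = wz (D.psi q s j) (D.psi q s i) := by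
  funext m n
  rcases Int.units_eq_one_or s with rfl | rfl
  · simp only [zw, wz, hD.psi_pos, smul_mul_smul_comm, X.ψ_comm h i j, mul_comm ((-q) ^ m)]
  · simp only [zw, wz, hD.psi_neg, smul_mul_smul_comm, X.φ_comm h i j, mul_comm ((-q) ^ m)]

theorem psi_minus_plus (h : Generic q t) (hD : Matches X u D) (i j : I) :
    lin 1 (-(DrinfeldGens.sc R (q ^ (cartan G i j)) * D.qc 1))
        (lin 1 (-(DrinfeldGens.sc R (q ^ (-cartan G i j)) * D.qc (-1)))
        (zw (D.psi q (-1) i) (D.psi q 1 j))) =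
      lin 1 (-(DrinfeldGens.sc R (q ^ (-cartan G i j)) * D.qc 1))
        (lin 1 (-(DrinfeldGens.sc R (q ^ (cartan G i j)) * D.qc (-1)))
        (wz (D.psi q 1 j) (D.psi q (-1) i))) := by
  funext m n
  -- The coefficient of a product of two linear factors is a three-term relation; indices are
  -- negated because the currents are series in z⁻¹.
  have h1 := X.φψ_two_step h i j (-m) (-n)
  have h2 := congrArg (fun x => (-q) ^ (m + n) • x) h1
  have ht := h.t0
  have hq0 := h.q0
  have hq0' := neg_ne_zero.2 h.q0
  have ha : q ^ cartan G i j ≠ 0 := zpow_ne_zero _ hq0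
  simp only [lin, zw, wz, hD.psi_pos, hD.psi_neg, sc_eq, hD.qc h, zpow_neg, zpow_one, smul_mul_assoc,
    one_mul, mul_smul_comm, neg_mul, mul_add, mul_neg, zpow_sub₀ hq0']
  simp only [zpow_add₀ hq0', show -(m - 1 - 1) = -m + 1 + 1 by ring, show -(m - 1) = -m + 1 by ring,
    show -(n - 1 - 1) = -n + 1 + 1 by ring, show -(n - 1) = -n + 1 by ring] at h2 ⊢
  have hm := zpow_ne_zero m hq0'
  have hn := zpow_ne_zero n hq0'
  generalize (-q) ^ m = y at *
  generalize (-q) ^ n = z at *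
  generalize q ^ cartan G i j = a at *
  linear_combination (norm := skip) ((-q) ^ 2)⁻¹ • h2
  match_scalars <;> field_simp <;> ring

theorem psi_x (h : Generic q t) (hD : Matches X u D) (s ε : ℤˣ) (i j : I) :
    lin (D.qcHalf ((ε * s : ℤˣ) : ℤ)) (-DrinfeldGens.sc R (q ^ ((ε : ℤ) * cartan G i j)))
        (zw (D.psi q s j) (D.x ε i)) =
      lin (DrinfeldGens.sc R (q ^ ((ε : ℤ) * cartan G i j)) * D.qcHalf ((ε * s : ℤˣ) : ℤ)) (-1)
        (wz (D.x ε i) (D.psi q s j)) := by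
  funext m n
  have hu := hD.u0 h
  have hut := hD.u_sq
  have hq0 := h.q0
  have hq0' := neg_ne_zero.2 h.q0
  have hqu := neg_ne_zero.2 (mul_ne_zero hq0 hu)
  have ha : q ^ cartan G j i ≠ 0 := zpow_ne_zero _ hq0
  rw [cartan_symm]
  have hm := zpow_ne_zero m hq0'
  have hn := zpow_ne_zero n hqu
  have hs : (((-1 * 1 : ℤˣ) : ℤˣ) : ℤ) = -1 ∧ ((1 * -1 : ℤˣ) : ℤ) = -1 ∧ ((-1 * -1 : ℤˣ) : ℤ) = 1 ∧
      ((-1 : ℤˣ) : ℤ) = -1 := by decide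
  rcases Int.units_eq_one_or s with rfl | rfl <;> rcases Int.units_eq_one_or ε with rfl | rfl
  · have h1 := X.ψE h j i (-m) (-n)
    -- The powers of -q and -qu are the normalizations of ψ and x. The remaining factor, in all four
    -- cases, is u^(εs), the value of q^(εsc/2).
    have h2 := congrArg (fun x => (u * (-q) ^ (m - 1) * (-(q * u)) ^ n) • x) h1
    simp only [lin, zw, wz, hD.psi_pos, hD.x_pos, sc_eq, hD.qcHalf h, mul_one, one_mul, neg_neg, Units.val_one, zpow_one, hs,
      smul_mul_assoc, mul_smul_comm, neg_mul, zpow_sub₀ hq0', zpow_sub₀ hqu, show -(m - 1) = -m + 1 by ring,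
      show -(n - 1) = -n + 1 by ring, zpow_neg] at h2 ⊢
    generalize (-q) ^ m = y at *
    generalize (-(q * u)) ^ n = z at *
    generalize q ^ cartan G j i = a at *
    subst hut
    linear_combination (norm := skip) h2
    match_scalars <;> field_simp <;> ring
  · have h1 := X.ψF h j i (-m) (-n)
    have h2 := congrArg (fun x => (u⁻¹ * (-q) ^ (m - 1) * (-(q * u)) ^ n) • x) h1
    simp only [lin, zw, wz, hD.psi_pos, hD.x_neg, sc_eq, hD.qcHalf h, mul_one, one_mul, neg_neg, Units.val_one, zpow_one, hs,
      smul_mul_assoc, mul_smul_comm, neg_mul, zpow_sub₀ hq0', zpow_sub₀ hqu, show -(m - 1) = -m + 1 by ring,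
      show -(n - 1) = -n + 1 by ring, zpow_neg] at h2 ⊢
    generalize (-q) ^ m = y at *
    generalize (-(q * u)) ^ n = z at *
    generalize q ^ cartan G j i = a at *
    subst hut
    linear_combination (norm := skip) h2
    match_scalars <;> field_simp <;> ring
  · have h1 := X.φE_cross h j i (-m) (-n)
    have h2 := congrArg (fun x => (u⁻¹ * (-q) ^ (m - 1) * (-(q * u)) ^ n) • x) h1
    simp only [lin, zw, wz, hD.psi_neg, hD.x_pos, sc_eq, hD.qcHalf h, mul_one, one_mul, neg_neg, Units.val_one, zpow_one, hs,
      smul_mul_assoc, mul_smul_comm, neg_mul, zpow_sub₀ hq0', zpow_sub₀ hqu, show -(m - 1) = -m + 1 by ring,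
      show -(n - 1) = -n + 1 by ring, zpow_neg] at h2 ⊢
    generalize (-q) ^ m = y at *
    generalize (-(q * u)) ^ n = z at *
    generalize q ^ cartan G j i = a at *
    subst hut
    linear_combination (norm := skip) h2
    match_scalars <;> field_simp <;> ring
  · have h1 := X.φF_cross h j i (-m) (-n)
    have h2 := congrArg (fun x => (u * (-q) ^ (m - 1) * (-(q * u)) ^ n) • x) h1
    simp only [lin, zw, wz, hD.psi_neg, hD.x_neg, sc_eq, hD.qcHalf h, mul_one, one_mul, neg_neg, Units.val_one, zpow_one, hs,
      smul_mul_assoc, mul_smul_comm, neg_mul, zpow_sub₀ hq0', zpow_sub₀ hqu, show -(m - 1) = -m + 1 by ring,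
      show -(n - 1) = -n + 1 by ring, zpow_neg] at h2 ⊢
    generalize (-q) ^ m = y at *
    generalize (-(q * u)) ^ n = z at *
    generalize q ^ cartan G j i = a at *
    subst hut
    linear_combination (norm := skip) h2
    match_scalars <;> field_simp <;> ring

theorem x_plus_minus (h : Generic q t) (hD : Matches X u D) (i j : I) :
    zw (D.x 1 i) (D.x (-1) j) - wz (D.x (-1) j) (D.x 1 i) =
      if i = j then
        (q - q⁻¹)⁻¹ • (deltaWZ (D.qc2 ^ 2) (dilate D.qc2 (D.psi q 1 i))
          - deltaZW (D.qc2 ^ 2) (dilate D.qc2 (D.psi q (-1) i)))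
      else 0 := by
  funext m n
  have hq0' := neg_ne_zero.2 h.q0
  have hqu := neg_ne_zero.2 (mul_ne_zero h.q0 (hD.u0 h))
  simp only [Pi.sub_apply, zw, wz, hD.x_pos, hD.x_neg, smul_mul_smul_comm]
  split_ifs with hij
  · subst hij
    have h1 := X.EF i (-m) (-n)
    have hz : ∀ k : ℤ, (D.qc2 ^ 2) ^ k = D.qc2 ^ (2 * k) := fun k => by rw [zpow_mul, zpow_ofNat]
    simp only [Pi.smul_apply, Pi.sub_apply, deltaWZ, deltaZW, dilate, hD.psi_pos, hD.psi_neg, hz, hD.qc2_zpow h,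
      smul_mul_assoc, one_mul, smul_smul]
    rw [mul_comm ((-(q * u)) ^ n), ← smul_sub, h1, ← zpow_add₀ hqu, neg_add, zpow_mul, zpow_mul, zpow_ofNat,
      hD.u_sq, ← neg_mul, mul_zpow]
    module
  · rw [X.EF_ne i j hij, mul_comm, sub_self]
    rfl

theorem x_x_same (h : Generic q t) (hD : Matches X u D) (ε : ℤˣ) (i : I) :
    lin 1 (-DrinfeldGens.sc R (q ^ (2 * (ε : ℤ)))) (zw (D.x ε i) (D.x ε i)) =
      lin (DrinfeldGens.sc R (q ^ (2 * (ε : ℤ)))) (-1) (wz (D.x ε i) (D.x ε i)) := by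
  funext m n
  have hu := hD.u0 h
  have hq0 := h.q0
  have hqu := neg_ne_zero.2 (mul_ne_zero hq0 hu)
  rcases Int.units_eq_one_or ε with rfl | rfl
  · have h1 := X.quadE_eq_zero h i i (-m) (-n)
    simp only [Currents.quadE, cartan_self] at h1
    have h2 := congrArg (fun x => ((-(q * u)) ^ (m - 1) * (-(q * u)) ^ n) • x) h1
    simp only [lin, zw, wz, hD.x_pos, sc_eq, one_mul, Units.val_one, Units.val_neg, mul_one, mul_neg, neg_neg, smul_zero,
      smul_mul_assoc, mul_smul_comm, neg_mul, zpow_sub₀ hqu, show -(m - 1) = -m + 1 by ring,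
      show -(n - 1) = -n + 1 by ring, zpow_neg, zpow_one, zpow_ofNat, inv_inv] at h2 ⊢
    generalize (-(q * u)) ^ m = y at *
    generalize (-(q * u)) ^ n = z at *
    linear_combination (norm := skip) h2
    match_scalars <;> field_simp <;> ring
  · have h1 := X.quadF h i i (-m) (-n)
    simp only [cartan_self] at h1
    have h2 := congrArg (fun x => ((-(q * u)) ^ (m - 1) * (-(q * u)) ^ n) • x) h1
    simp only [lin, zw, wz, hD.x_neg, sc_eq, one_mul, Units.val_one, Units.val_neg, mul_one, mul_neg, neg_neg, smul_zero,
      smul_mul_assoc, mul_smul_comm, neg_mul, zpow_sub₀ hqu, show -(m - 1) = -m + 1 by ring,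
      show -(n - 1) = -n + 1 by ring, zpow_neg, zpow_one, zpow_ofNat, inv_inv] at h2 ⊢
    generalize (-(q * u)) ^ m = y at *
    generalize (-(q * u)) ^ n = z at *
    linear_combination (norm := skip) h2
    match_scalars <;> field_simp <;> ring

theorem x_x_adj (h : Generic q t) (hD : Matches X u D) (ε : ℤˣ) (i j : I) (hij : cartan G i j = -1) :
    lin 1 (-DrinfeldGens.sc R (q ^ (-(ε : ℤ)))) (zw (D.x ε i) (D.x ε j)) =
      lin (DrinfeldGens.sc R (q ^ (-(ε : ℤ)))) (-1) (wz (D.x ε j) (D.x ε i)) := by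
  funext m n
  have hu := hD.u0 h
  have hq0 := h.q0
  have hqu := neg_ne_zero.2 (mul_ne_zero hq0 hu)
  rw [cartan_symm] at hij
  rcases Int.units_eq_one_or ε with rfl | rfl
  · have h1 := X.quadE_eq_zero h i j (-m) (-n)
    simp only [Currents.quadE, hij] at h1
    have h2 := congrArg (fun x => ((-(q * u)) ^ (m - 1) * (-(q * u)) ^ n) • x) h1
    simp only [lin, zw, wz, hD.x_pos, sc_eq, one_mul, Units.val_one, Units.val_neg, mul_one, mul_neg, neg_neg, smul_zero,
      smul_mul_assoc, mul_smul_comm, neg_mul, zpow_sub₀ hqu, show -(m - 1) = -m + 1 by ring,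
      show -(n - 1) = -n + 1 by ring, zpow_neg, zpow_one, zpow_ofNat, inv_inv] at h2 ⊢
    generalize (-(q * u)) ^ m = y at *
    generalize (-(q * u)) ^ n = z at *
    linear_combination (norm := skip) h2
    match_scalars <;> field_simp <;> ring
  · have h1 := X.quadF h i j (-m) (-n)
    simp only [hij] at h1
    have h2 := congrArg (fun x => ((-(q * u)) ^ (m - 1) * (-(q * u)) ^ n) • x) h1
    simp only [lin, zw, wz, hD.x_neg, sc_eq, one_mul, Units.val_one, Units.val_neg, mul_one, mul_neg, neg_neg, smul_zero,
      smul_mul_assoc, mul_smul_comm, neg_mul, zpow_sub₀ hqu, show -(m - 1) = -m + 1 by ring,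
      show -(n - 1) = -n + 1 by ring, zpow_neg, zpow_one, zpow_ofNat, inv_inv] at h2 ⊢
    generalize (-(q * u)) ^ m = y at *
    generalize (-(q * u)) ^ n = z at *
    linear_combination (norm := skip) h2
    match_scalars <;> field_simp <;> ring
end Matches
end QAff

namespace QAff

namespace Matches

variable {I : Type*} [DecidableEq I] {G : SimpleGraph I} [DecidableRel G.Adj]
variable {K : Type*} [Field K] {q t u : K} {s : ℤ} {R : Type*} [Ring R] [Algebra K R]
variable {X : Currents G q t s R} {D : DrinfeldGens I R}

theorem qbinom_zero {n : ℕ} (hn : qfact q n ≠ 0) : qbinom q n 0 = 1 := by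
  rw [qbinom, Nat.sub_zero, show qfact q 0 = 1 by simp [qfact], one_mul, div_self hn]

theorem qbinom_self {n : ℕ} (hn : qfact q n ≠ 0) : qbinom q n n = 1 := by
  rw [qbinom, Nat.sub_self, show qfact q 0 = 1 by simp [qfact], mul_one, div_self hn]

variable [CharZero K]

/-- For joined vertices N = 2 and this is the polarized Serre relation; otherwise N = 1 and it says
that the two currents commute. -/
theorem serre (h : Generic q t) (hD : Matches X u D) (ε : ℤˣ) (i j : I) (hC : cartan G i j ≤ 0) (N : ℕ)
    (hN : (N : ℤ) = 1 - cartan G i j) (m : Fin N → ℤ) (n : ℤ) :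
    ∑ σ : Equiv.Perm (Fin N), ∑ s ∈ Finset.range (N + 1),
      ((-1) ^ s * qbinom q N s) •
        (((List.ofFn fun k => D.x ε i (m (σ k))).take s).prod * D.x ε j n *
          ((List.ofFn fun k => D.x ε i (m (σ k))).drop s).prod) = 0 := by
  have hκ := q_sub_inv_ne h.q0 h.q_pow
  have hij : i ≠ j := by rintro rfl; rw [cartan_self] at hC; omega
  have f1 : qfact q 1 = 1 := by simp [qfact, qint_one hκ]
  by_cases hadj : G.Adj i j
  · rw [cartan_adj G hadj] at hN
    obtain rfl : N = 2 := by omega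
    have f2 : qfact q 2 = q + q⁻¹ := by
      rw [qfact, Finset.prod_range_succ, Finset.prod_range_one, Nat.cast_zero, zero_add, qint_one hκ, one_mul,
        Nat.cast_one, one_add_one_eq_two, qint_two h.q0 hκ]
    have f3 : qfact q 2 ≠ 0 := by
      rw [f2, ← qint_two h.q0 hκ]; exact qint_ne_zero h.q0 h.q_pow two_ne_zero
    have b1 : qbinom q 2 1 = q + q⁻¹ := by rw [qbinom, f1, f2, mul_one, div_one]
    rw [sum_perm_fin_two]
    simp only [Finset.sum_range_succ, Finset.sum_range_zero, zero_add, qbinom_zero f3, qbinom_self f3, b1,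
      List.ofFn_succ, List.ofFn_zero, List.take, List.drop, List.prod_cons, List.prod_nil, Equiv.Perm.one_apply,
      Equiv.swap_apply_left, Fin.succ_zero_eq_one, Equiv.swap_apply_right, mul_one, one_mul, pow_zero, one_smul]
    rcases Int.units_eq_one_or ε with rfl | rfl
    · have h1 := X.serreE h hadj (-m 0) (-m 1) (-n)
      simp only [hD.x_pos, smul_mul_assoc, mul_smul_comm, ← mul_assoc]
      linear_combination (norm := module) ((-(q * u)) ^ m 0 * (-(q * u)) ^ m 1 * (-(q * u)) ^ n) • h1
    · have h1 := X.serreF h hadj (-m 0) (-m 1) (-n)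
      simp only [hD.x_neg, smul_mul_assoc, mul_smul_comm, ← mul_assoc]
      linear_combination (norm := module) ((-(q * u)) ^ m 0 * (-(q * u)) ^ m 1 * (-(q * u)) ^ n) • h1
  · rw [cartan_far G hij hadj] at hN
    obtain rfl : N = 1 := by omega
    have f3 : qfact q 1 ≠ 0 := by rw [f1]; exact one_ne_zero
    rw [Fintype.sum_unique]
    simp only [Finset.sum_range_succ, Finset.sum_range_zero, zero_add, qbinom_zero f3, qbinom_self f3,
      List.ofFn_succ, List.ofFn_zero, List.take, List.drop, List.prod_cons, List.prod_nil,
      mul_one, one_mul, pow_zero, one_smul, pow_one, neg_one_smul]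
    rcases Int.units_eq_one_or ε with rfl | rfl
    · simp only [hD.x_pos, smul_mul_smul_comm, X.EE_far i j hij hadj]
      rw [mul_comm, add_neg_cancel]
    · simp only [hD.x_neg, smul_mul_smul_comm, X.FF_far i j hij hadj]
      rw [mul_comm, add_neg_cancel]

end Matches

/-! ### Logarithms inside a commutative subalgebra -/

section Transfer

open PowerSeries

variable {K : Type*} [Field K] [CharZero K] {R : Type*} [Ring R] [Algebra K R]

theorem map_mk {A B : Type*} [Ring A] [Ring B] (f : A →+* B) (a : ℕ → A) :
    PowerSeries.map f (mk a) = mk fun n => f (a n) := by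
  ext n; rw [coeff_map, coeff_mk, coeff_mk]

/-- The logarithm was constructed over commutative rings. Everything takes place in the commutative
subalgebra S, and the inclusion of S commutes with `expSeries`. -/
theorem exists_vertex_log_of_commute {q : K} (hq0 : q ≠ 0) (hq : ∀ n : ℕ, 0 < n → q ^ n ≠ 1)
    (S : Subalgebra K R) (hS : ∀ x ∈ S, ∀ y ∈ S, x * y = y * x) {a b w : ℕ → R}
    (ha : ∀ n, a n ∈ S) (hb : ∀ n, b n ∈ S) (a0 : a 0 = 1) (b0 : b 0 = 1)
    (hab : ∀ n, 0 < n → ∑ k ∈ Finset.range (n + 1), (-1 : K) ^ k • (b k * a (n - k)) = 0)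
    (hw : ∀ n, w n = ∑ m ∈ Finset.range (n + 1), ((-q) ^ m * qint q m) • (b (n - m) * a m)) :
    ∃ h : ℕ → R,
      (∀ n, coeff n (expSeries K (mk fun n => if n = 0 then 0 else (qint q n)⁻¹ • h n)) = a n) ∧
      (∀ n, coeff n (expSeries K (mk fun n => if n = 0 then 0 else (-(qint q n)⁻¹) • h n)) =
        (-1 : K) ^ n • b n) ∧
      (∀ n, 0 < n → coeff n (expSeries K (mk fun n => if n = 0 then 0 else (q - q⁻¹) • h n)) =
        (((-q) ^ n)⁻¹ * (q - q⁻¹)) • w n) ∧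
      ∀ n, h n ∈ Submodule.span K {x | ∃ k ≤ n, x = b k * a (n - k)} := by
  have : IsMulCommutative S := ⟨⟨fun x y => Subtype.ext (hS _ x.2 _ y.2)⟩⟩
  open scoped IsMulCommutative in
  let a' : ℕ → S := fun n => ⟨a n, ha n⟩
  let b' : ℕ → S := fun n => ⟨b n, hb n⟩
  let w' : ℕ → S := fun n => ∑ m ∈ Finset.range (n + 1), ((-q) ^ m * qint q m) • (b' (n - m) * a' m)
  have hw' : ∀ n, (w' n : R) = w n := fun n => by
    rw [hw, ← Subalgebra.coe_val, map_sum]; rfl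
  obtain ⟨h, h1, h2, h3, h4⟩ := exists_vertex_log hq0 hq (a := a') (b := b') (w := w') (Subtype.ext a0)
    (Subtype.ext b0) (fun n hn => Subtype.ext (by
      rw [← Subalgebra.coe_val, map_sum, map_zero]; exact hab n hn)) (fun n => rfl)
  have hmap : ∀ (x : ℕ → K) n, coeff n (expSeries K (mk fun n => if n = 0 then 0 else x n • (h n : R))) =
      ((coeff n (expSeries K (mk fun n => if n = 0 then 0 else x n • h n)) : S) : R) := fun x n => by
    have := map_expSeries (K := K) S.val (mk fun n => if n = 0 then 0 else x n • h n) n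
    rw [map_mk] at this
    refine Eq.trans ?_ this
    congr 3; funext n
    split_ifs
    · exact (map_zero S.val).symm
    · exact (map_smul S.val _ _).symm
  refine ⟨fun n => h n, fun n => ?_, fun n => ?_, fun n hn => ?_, fun n => ?_⟩
  · rw [hmap, h1]
  · rw [hmap (fun n => -(qint q n)⁻¹), h2]; rfl
  · rw [hmap (fun n => q - q⁻¹), h3 n hn, ← hw']; rfl
  · have h5 := Submodule.mem_map_of_mem (f := S.val.toLinearMap) (h4 n)
    rw [Submodule.map_span] at h5
    refine Submodule.span_mono ?_ h5
    rintro _ ⟨_, ⟨k, hk, rfl⟩, rfl⟩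
    exact ⟨k, hk, rfl⟩

end Transfer
end QAff

namespace QAff

open PowerSeries

/-! ### Drinfeld generators on a weight module -/

section Drinfeld

variable {I : Type*} [Fintype I] [DecidableEq I] {G : SimpleGraph I} [DecidableRel G.Adj]
variable {K : Type*} [Field K] {q : K} {c : ℕ}
variable {V : Type*} [AddCommGroup V] [Module K V] {g : Gen I → Module.End K V}

theorem qint_inv (n : ℤ) : qint q⁻¹ n = qint q n := by
  rw [qint, qint, inv_inv, inv_zpow, ← zpow_neg, inv_zpow, zpow_neg, inv_inv, ← neg_sub, ← neg_sub q, neg_div_neg_eq]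

/-- The h_{i,n} are only known as coefficients of a logarithm. That they lie in the span of products
Q^(1ᵏ)Q⁽ⁿ⁻ᵏ⁾, all of weight ncδ, gives their commutation with diagonal operators. -/
theorem diag_mul_of_mem_span_Q (hw : Holds (WeightRel G c g)) (hW : IsWeightModule g) (i : I) {n : ℕ}
    {x : AffWeight I → K} {a : K} (hx : ∀ l, x (l + ((n : ℤ) * (c : ℤ)) • delta I) = a * x l)
    {y : Module.End K V}
    (hy : y ∈ Submodule.span K {y | ∃ k ≤ n, y = (opQ1 c g i k).tot hW * (opQ c g i (n - k)).tot hW}) :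
    diag hW x * y = a • (y * diag hW x) := by
  induction hy using Submodule.span_induction with
  | mem y hy =>
    obtain ⟨k, hk, rfl⟩ := hy
    have h1 := (opQ1_isHom hw i k).mul (opQ_isHom hw i (n - k))
    have h2 := opQ1_mul_opQ_deg (c := c) (g := g) (Nat.sub_le n k) i
    rw [Nat.sub_sub_self hk] at h2
    rw [← (opQ1_isHom hw i k).tot_mul hW (opQ_isHom hw i _)]
    exact h1.diag_mul_tot hW x fun l => by rw [h2, hx]
  | zero => rw [mul_zero, zero_mul, smul_zero]
  | add y z _ _ hy hz => rw [mul_add, add_mul, smul_add, hy, hz]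
  | smul b y _ hy => rw [mul_smul_comm, smul_mul_assoc, hy, smul_comm]

theorem diag_mul_of_mem_span_P (hw : Holds (WeightRel G c g)) (hW : IsWeightModule g) (i : I) {n : ℕ}
    {x : AffWeight I → K} {a : K} (hx : ∀ l, x (l + -(((n : ℤ) * (c : ℤ)) • delta I)) = a * x l)
    {y : Module.End K V}
    (hy : y ∈ Submodule.span K {y | ∃ k ≤ n, y = (opP1 c g i k).tot hW * (opP c g i (n - k)).tot hW}) :
    diag hW x * y = a • (y * diag hW x) := by
  induction hy using Submodule.span_induction with
  | mem y hy =>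
    obtain ⟨k, hk, rfl⟩ := hy
    have h1 := (opP1_isHom hw i k).mul (opP_isHom hw i (n - k))
    have h2 := opP1_mul_opP_deg (c := c) (g := g) (Nat.sub_le n k) i
    rw [Nat.sub_sub_self hk] at h2
    rw [← (opP1_isHom hw i k).tot_mul hW (opP_isHom hw i _)]
    exact h1.diag_mul_tot hW x fun l => by rw [h2, hx]
  | zero => rw [mul_zero, zero_mul, smul_zero]
  | add y z _ _ hy hz => rw [mul_add, add_mul, smul_add, hy, hz]
  | smul b y _ hy => rw [mul_smul_comm, smul_mul_assoc, hy, smul_comm]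

/-- The diagonal operator with nonzero eigenvalues `q ^ x l`. -/
noncomputable def diagUnit (hq0 : q ≠ 0) (hW : IsWeightModule g) (x : AffWeight I → ℤ) : (Module.End K V)ˣ where
  val := diag hW fun l => q ^ x l
  inv := diag hW fun l => q ^ (-x l)
  val_inv := by
    rw [diag_mul, ← diag_one hW]; congr 1; funext l
    rw [← zpow_add₀ hq0, add_neg_cancel, zpow_zero]
  inv_val := by
    rw [diag_mul, ← diag_one hW]; congr 1; funext l
    rw [← zpow_add₀ hq0, neg_add_cancel, zpow_zero]

/-- The Drinfeld generators on a weight module, for given `h_{i,n}` and `h_{i,-n}` (`n > 0`). -/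
noncomputable def drinfeldGens {p : K} (c : ℕ) (hq0 : q ≠ 0) (hp0 : p ≠ 0) (hW : IsWeightModule g)
    (G : SimpleGraph I) [DecidableRel G.Adj] (hQ hP : I → ℕ → Module.End K V) :
    DrinfeldGens I (Module.End K V) where
  e i r := ((-(q * p ^ c)) ^ r)⁻¹ • (opE G c g i r).tot hW
  f i r := ((-(q * p ^ c)) ^ r)⁻¹ • (opF G c g i r).tot hW
  -- The value at m = 0 plays no role.
  h i m := if 0 < m then hQ i m.toNat else hP i (-m).toNat
  qh y := diag hW fun l => q ^ (∑ i, y i * pair l i)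
  qd := diagUnit hq0 hW fun l => l.2.2 / (c : ℤ)
  qc2 := Units.map (algebraMap K (Module.End K V)).toMonoidHom (Units.mk0 (p ^ c) (pow_ne_zero c hp0))

section

variable {p : K} (hq0 : q ≠ 0) (hp0 : p ≠ 0) (hW : IsWeightModule g) (hQ hP : I → ℕ → Module.End K V)

theorem drinfeldGens_h_pos (i : I) {n : ℕ} (hn : n ≠ 0) :
    (drinfeldGens c hq0 hp0 hW G hQ hP).h i n = hQ i n := by
  change (if 0 < (n : ℤ) then _ else _) = _
  rw [if_pos (by omega), Int.toNat_natCast]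

theorem drinfeldGens_h_neg (i : I) (n : ℕ) :
    (drinfeldGens c hq0 hp0 hW G hQ hP).h i (-n) = hP i n := by
  change (if 0 < -(n : ℤ) then _ else _) = _
  rw [if_neg (by omega), neg_neg, Int.toNat_natCast]

theorem hSeries_pos (i : I) : (drinfeldGens c hq0 hp0 hW G hQ hP).hSeries q 1 i =
    mk fun n => if n = 0 then 0 else (q - q⁻¹) • hQ i n := by
  ext1 n
  rw [DrinfeldGens.hSeries, coeff_mk, coeff_mk]
  split_ifs with hn
  · rfl
  · rw [Units.val_one, one_mul, drinfeldGens_h_pos _ _ _ _ _ _ hn, Int.cast_one, one_mul]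

/-- Written in terms of q⁻¹, because on the P side the logarithm is taken with q inverted. -/
theorem hSeries_neg (i : I) : (drinfeldGens c hq0 hp0 hW G hQ hP).hSeries q (-1) i =
    mk fun n => if n = 0 then 0 else (q⁻¹ - q⁻¹⁻¹) • hP i n := by
  ext1 n
  rw [DrinfeldGens.hSeries, coeff_mk, coeff_mk]
  split_ifs with hn
  · rfl
  · rw [Units.val_neg, Units.val_one, neg_one_mul, drinfeldGens_h_neg, Int.cast_neg, Int.cast_one, neg_one_mul,
      neg_sub, inv_inv]

theorem halfVertexSeries_Q (i : I) : halfVertexSeries q (drinfeldGens c hq0 hp0 hW G hQ hP) 1 1 i =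
    mk fun n => if n = 0 then 0 else (qint q n)⁻¹ • hQ i n := by
  ext1 n
  rw [halfVertexSeries, coeff_mk, coeff_mk]
  split_ifs with hn
  · rfl
  · rw [Units.val_one, one_mul, drinfeldGens_h_pos _ _ _ _ _ _ hn, Int.cast_one, one_mul]

theorem halfVertexSeries_Q1 (i : I) : halfVertexSeries q (drinfeldGens c hq0 hp0 hW G hQ hP) 1 (-1) i =
    mk fun n => if n = 0 then 0 else (-(qint q n)⁻¹) • hQ i n := by
  ext1 n
  rw [halfVertexSeries, coeff_mk, coeff_mk]
  split_ifs with hn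
  · rfl
  · rw [Units.val_neg, Units.val_one, one_mul, drinfeldGens_h_pos _ _ _ _ _ _ hn, Int.cast_neg, Int.cast_one,
      neg_one_mul]

theorem halfVertexSeries_P (i : I) : halfVertexSeries q (drinfeldGens c hq0 hp0 hW G hQ hP) (-1) 1 i =
    mk fun n => if n = 0 then 0 else (qint q⁻¹ n)⁻¹ • hP i n := by
  ext1 n
  rw [halfVertexSeries, coeff_mk, coeff_mk]
  split_ifs with hn
  · rfl
  · rw [Units.val_neg, Units.val_one, neg_one_mul, drinfeldGens_h_neg, Int.cast_one, one_mul, qint_inv]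

theorem halfVertexSeries_P1 (i : I) : halfVertexSeries q (drinfeldGens c hq0 hp0 hW G hQ hP) (-1) (-1) i =
    mk fun n => if n = 0 then 0 else (-(qint q⁻¹ n)⁻¹) • hP i n := by
  ext1 n
  rw [halfVertexSeries, coeff_mk, coeff_mk]
  split_ifs with hn
  · rfl
  · rw [Units.val_neg, Units.val_one, neg_one_mul, drinfeldGens_h_neg, Int.cast_neg, Int.cast_one, neg_one_mul,
      qint_inv]

theorem drinfeldGens_qh_single (i : I) : (drinfeldGens c hq0 hp0 hW G hQ hP).qh (Pi.single i 1) = kOp q hW i := by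
  change diag hW _ = diag hW _
  congr 1; funext l
  rw [Finset.sum_eq_single i (fun j _ hj => by rw [Pi.single_eq_of_ne hj, zero_mul]) (by simp),
    Pi.single_eq_same, one_mul]

theorem drinfeldGens_qh_single_neg (i : I) :
    (drinfeldGens c hq0 hp0 hW G hQ hP).qh (Pi.single i (-1)) = kInv q hW i := by
  change diag hW _ = diag hW _
  congr 1; funext l
  rw [Finset.sum_eq_single i (fun j _ hj => by rw [Pi.single_eq_of_ne hj, zero_mul]) (by simp),
    Pi.single_eq_same, neg_one_mul]

end

theorem coeff_zero_expSeries {A : Type*} [Ring A] [Algebra K A] (H : PowerSeries A) :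
    coeff 0 (expSeries K H) = 1 := by
  rw [expSeries, coeff_mk]
  simp

/-- The Drinfeld generators, their relations, and the correspondence, on a weight module. -/
theorem exists_drinfeldGens [CharZero K] {p : K} (hp : p ^ 2 = q) (hq0 : q ≠ 0)
    (hq : ∀ n : ℕ, 0 < n → q ^ n ≠ 1) (hc : 0 < c) (hB : Holds (BaseRel G q c g))
    (hS : Holds (SerreEqRel G q c g)) (hW : IsWeightModule g) (hg : Generic q (q ^ c)) :
    ∃ D : DrinfeldGens I (Module.End K V), Corresponds q p c g D ∧ D.Relations G q := by
  have hw := hB.weight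
  have hh := hB.heis
  have hκ := q_sub_inv_ne hq0 hq
  have hp0 : p ≠ 0 := by rintro rfl; exact hq0 (by rw [← hp, zero_pow two_ne_zero])
  have hu0 : -(q * p ^ c) ≠ 0 := neg_ne_zero.2 (mul_ne_zero hq0 (pow_ne_zero c hp0))
  have hc' : (c : ℤ) ≠ 0 := by exact_mod_cast hc.ne'
  choose hQ hQ1 hQ2 hQ3 hQ4 using fun i => exists_vertex_log_of_commute hq0 hq (algQ q c hW)
    (fun x hx y hy => algQ_comm hq0 hq hB hS hW hg hx hy)
    (fun n => (opQ_mem_algQ hw hh hW hq0 hq i n).1) (fun n => (opQ_mem_algQ hw hh hW hq0 hq i n).2)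
    (tot_opQ_zero hw hh hW i) (tot_opQ1_zero hw hh hW i) (fun n hn => tot_Q_inv hw hh hW i hn)
    (w := fun n => (opQb q c g i n).tot hW) (fun n => tot_opQb hw hW i n)
  -- The P side is the Q side for q⁻¹: (-q)⁻ᵐ = (-q⁻¹)ᵐ, and [m] is unchanged when q is inverted.
  choose hP hP1 hP2 hP3 hP4 using fun i => exists_vertex_log_of_commute (inv_ne_zero hq0)
    (fun n hn => by rw [inv_pow, ne_eq, inv_eq_one]; exact hq n hn) (algP q c hW)
    (fun x hx y hy => algP_comm hq0 hq hB hS hW hg hx hy)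
    (fun n => (opP_mem_algP hw hh hW hq0 hq i n).1) (fun n => (opP_mem_algP hw hh hW hq0 hq i n).2)
    (tot_opP_zero hw hh hW i) (tot_opP1_zero hw hh hW i) (fun n hn => tot_P_inv hw hh hW i hn)
    (w := fun n => (opPb q c g i n).tot hW) (fun n => by
      rw [tot_opPb hw hW i n]
      refine Finset.sum_congr rfl fun m _ => ?_
      rw [qint_inv, zpow_neg, zpow_natCast, ← inv_pow, inv_neg])
  set D := drinfeldGens c hq0 hp0 hW G hQ hP with hD
  set X := realize hq0 hκ hB hW hS with hX
  have hu : (p ^ c) ^ 2 = q ^ c := by rw [← pow_mul, mul_comm, pow_mul, hp]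
  have hM : Matches X (p ^ c) D := by
    refine ⟨hu, (Algebra.algebraMap_eq_smul_one (p ^ c)), fun i n => ?_, fun i n => ?_, fun i n => ?_, fun i n => ?_⟩
    · change (if (1 : ℤˣ) = 1 then D.e i (-n) else D.f i (-n)) = _
      rw [if_pos rfl]
      change ((-(q * p ^ c)) ^ (-n))⁻¹ • _ = _ • (opE G c g i (-n)).tot hW
      rw [zpow_neg, inv_inv]
    · change (if (-1 : ℤˣ) = 1 then D.e i (-n) else D.f i (-n)) = _
      rw [if_neg (by decide)]
      change ((-(q * p ^ c)) ^ (-n))⁻¹ • _ = _ • (opF G c g i (-n)).tot hW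
      rw [zpow_neg, inv_inv]
    · change _ = _ • psiOp q c hW i (-n)
      rw [DrinfeldGens.psi, Units.val_one, one_mul, drinfeldGens_qh_single, hSeries_pos]
      rcases lt_trichotomy n 0 with hn | rfl | hn
      · obtain ⟨N, hN⟩ := Int.eq_ofNat_of_zero_le (a := -n) (by omega)
        obtain rfl : n = -(N : ℤ) := by omega
        rw [if_pos (by omega), neg_neg, psiOp_pos hW i (by omega), Int.toNat_natCast, hQ3 i N (by omega),
          mul_smul_comm, smul_smul, zpow_neg, zpow_natCast]
      · rw [neg_zero, if_pos le_rfl, psiOp_zero, Int.toNat_zero, coeff_zero_expSeries, mul_one, zpow_zero, one_smul]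
      · rw [if_neg (by omega), psiOp, if_pos (by omega), smul_zero]
    · change _ = _ • phiOp q c hW i (-n)
      rw [DrinfeldGens.psi, Units.val_neg, Units.val_one, neg_one_mul, neg_neg, drinfeldGens_qh_single_neg,
        hSeries_neg]
      rcases lt_trichotomy n 0 with hn | rfl | hn
      · rw [if_neg (by omega), phiOp, if_pos (by omega), smul_zero]
      · rw [neg_zero, if_pos le_rfl, phiOp_zero, Int.toNat_zero, coeff_zero_expSeries, mul_one, zpow_zero, one_smul]
      · obtain ⟨N, rfl⟩ := Int.eq_ofNat_of_zero_le hn.le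
        rw [if_pos (by omega), phiOp_neg hW i (by omega), neg_neg, Int.toNat_natCast, hP3 i N (by omega),
          mul_smul_comm, smul_smul, zpow_natCast, inv_inv, ← inv_neg, inv_pow, inv_inv, neg_sub]
  have hcen : ∀ y : Module.End K V, Commute (D.qc2 : Module.End K V) y := fun y => Algebra.commutes (p ^ c) y
  have hconj : ∀ {y : Module.End K V} {a : K}, (D.qd : Module.End K V) * y = a • (y * D.qd) →
      (D.qd : Module.End K V) * y * ((D.qd⁻¹ : (Module.End K V)ˣ) : Module.End K V) = a • y := fun hy => by
    rw [hy, smul_mul_assoc, mul_assoc, Units.mul_inv, mul_one]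
  -- All generators change the coefficient of δ by multiples of c, and adding mc raises ⌊k/c⌋ by
  -- exactly m, so the rounding does no harm.
  have hfloor : ∀ (k m : ℤ), q ^ ((k + m * (c : ℤ)) / (c : ℤ)) = q ^ m * q ^ (k / (c : ℤ)) := fun k m => by
    rw [Int.add_mul_ediv_right _ _ hc', add_comm, zpow_add₀ hq0]
  have hhc : ∀ (i : I) (m : ℤ), m ≠ 0 → ∀ (x : AffWeight I → K) (a : K),
      (∀ l, x (l + (m * (c : ℤ)) • delta I) = a * x l) → diag hW x * D.h i m = a • (D.h i m * diag hW x) :=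
    fun i m hm x a hx => by
      rcases lt_or_gt_of_ne hm with hm | hm
      · obtain ⟨N, hN⟩ := Int.eq_ofNat_of_zero_le (a := -m) (by omega)
        obtain rfl : m = -(N : ℤ) := by omega
        rw [hD, drinfeldGens_h_neg]
        exact diag_mul_of_mem_span_P hw hW i (fun l => by rw [← hx, neg_mul, neg_smul]) (hP4 i N)
      · obtain ⟨N, rfl⟩ := Int.eq_ofNat_of_zero_le hm.le
        rw [hD, drinfeldGens_h_pos _ _ _ _ _ _ (by omega)]
        exact diag_mul_of_mem_span_Q hw hW i hx (hQ4 i N)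
  have hpow : ∀ r : ℤ, (-q) ^ r * p ^ (r * (c : ℤ)) = (-(q * p ^ c)) ^ r := fun r => by
    rw [← neg_mul, mul_zpow, mul_comm r, zpow_mul, zpow_natCast]
  refine ⟨D, ⟨fun i r l => ?_, fun i r l => ?_, fun i n l => ?_, fun i n l => ?_, fun i n l => ?_, fun i n l => ?_,
    fun y l => diag_mul_one hW _ l, fun l => diag_mul_one hW _ l, Algebra.algebraMap_eq_smul_one (p ^ c)⟩, ?_⟩
  · change _ = _ • ((_ • (opE G c g i r).tot hW) * _)
    rw [hpow, smul_mul_assoc, smul_smul, mul_inv_cancel₀ (zpow_ne_zero r hu0), one_smul,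
      (opE_isHom hw i r).tot_mul_one hW]
    rfl
  · change _ = _ • ((_ • (opF G c g i r).tot hW) * _)
    rw [hpow, smul_mul_assoc, smul_smul, mul_inv_cancel₀ (zpow_ne_zero r hu0), one_smul,
      (opF_isHom hw i r).tot_mul_one hW]
    rfl
  · rw [halfVertexSeries_Q, hQ1, (opQ_isHom hw i n).tot_mul_one hW]; rfl
  · rw [halfVertexSeries_Q1, hQ2, smul_mul_assoc, (opQ1_isHom hw i n).tot_mul_one hW]; rfl
  · rw [halfVertexSeries_P, hP1, (opP_isHom hw i n).tot_mul_one hW]; rfl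
  · rw [halfVertexSeries_P1, hP2, smul_mul_assoc, (opP1_isHom hw i n).tot_mul_one hW]; rfl
  exact
    { central_e := fun i r => hcen _
      central_f := fun i r => hcen _
      central_h := fun i m _ => hcen _
      central_qh := fun y => hcen _
      central_qd := hcen _
      qh_zero := by
        change diag hW _ = 1
        rw [← diag_one hW]; congr 1; funext l; simp
      qh_add := fun y y' => by
        change diag hW _ * diag hW _ = diag hW _
        rw [diag_mul]; congr 1; funext l
        rw [← zpow_add₀ hq0, ← Finset.sum_add_distrib]
        simp only [Pi.add_apply, add_mul]
      qh_h := fun y i m hm => by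
        have h1 := hhc i m hm (fun l => q ^ (∑ i, y i * pair l i)) 1 fun l => by simp [pair, delta]
        rwa [one_smul] at h1
      psi_psi := hM.psi_psi hg
      psi_minus_plus := hM.psi_minus_plus hg
      qd_qh := fun y => diag_comm hW _ _
      qd_h := fun i m hm => hconj (hhc i m hm _ _ fun l => by simpa [delta] using hfloor l.2.2 m)
      qd_e := fun i r => hconj (by
        change diag hW _ * (_ • (opE G c g i r).tot hW) = _ • ((_ • (opE G c g i r).tot hW) * diag hW _)
        rw [mul_smul_comm, smul_mul_assoc, smul_comm (q ^ r), (opE_isHom hw i r).diag_mul_tot hW (a := q ^ r)]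
        exact fun l => by simpa [delta, opE, simpleRoot] using hfloor l.2.2 r)
      qd_f := fun i r => hconj (by
        change diag hW _ * (_ • (opF G c g i r).tot hW) = _ • ((_ • (opF G c g i r).tot hW) * diag hW _)
        rw [mul_smul_comm, smul_mul_assoc, smul_comm (q ^ r), (opF_isHom hw i r).diag_mul_tot hW (a := q ^ r)]
        exact fun l => by simpa [delta, opF, simpleRoot] using hfloor l.2.2 r)
      psi_x := hM.psi_x hg
      x_plus_minus := hM.x_plus_minus hg
      x_x_same := hM.x_x_same hg
      x_x_adj := hM.x_x_adj hg
      serre := fun ε i j hC N hN m n => hM.serre hg ε i j hC N hN m n }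

end Drinfeld
end QAff

/-! ### The theorem -/

theorem theorem2p1 {I : Type*} [Fintype I] [DecidableEq I]
    (G : SimpleGraph I) [DecidableRel G.Adj] (hG : QAff.FiniteType G)
    {K : Type*} [Field K] [CharZero K]
    (q : K) (hq0 : q ≠ 0) (hq : ∀ n : ℕ, 0 < n → q ^ n ≠ 1) (c : ℕ) (hc : 0 < c) :
    -- all relations of the idempotented algebra hold in the algebra with the reduced relations
    (∀ x y, QAff.FullRel G q c (QAff.Presented.gen (QAff.reducedRels G q c)) x y → x = y) ∧
    -- so that the reduced relations present the idempotented algebra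
    (∃ φ : QAff.Presented (QAff.reducedRels G q c) ≃ₐ[K] QAff.Presented (QAff.fullRels G q c),
      ∀ s : QAff.Gen I, φ (QAff.Presented.gen _ s) = QAff.Presented.gen _ s) ∧
    -- on every weight module over the algebra with the reduced relations, there are Drinfeld generators
    -- that correspond to the given ones, and they satisfy the relations of the Drinfeld realization
    (∀ p : K, p ^ 2 = q →
      ∀ (V : Type*) [AddCommGroup V] [Module K V]
        (ρ : QAff.Presented (QAff.reducedRels G q c) →ₐ[K] Module.End K V),
        QAff.IsWeightModule (fun s => ρ (QAff.Presented.gen _ s)) →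
        ∃ D : QAff.DrinfeldGens I (Module.End K V),
          QAff.Corresponds q p c (fun s => ρ (QAff.Presented.gen _ s)) D ∧ D.Relations G q) ∧
    -- on integrable modules the Serre relation follows from the other reduced relations
    (∀ (V : Type*) [AddCommGroup V] [Module K V]
      (ρ : QAff.Presented (QAff.baseRels G q c) →ₐ[K] Module.End K V),
      QAff.IsWeightModule (fun s => ρ (QAff.Presented.gen _ s)) →
      QAff.IsIntegrable G (fun s => ρ (QAff.Presented.gen _ s)) →
      ∀ x y, QAff.SerreEqRel G q c (fun s => ρ (QAff.Presented.gen _ s)) x y → x = y) := by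
  -- For t = q^c the condition t² ≠ 1 is q^(2c) ≠ 1, which uses c > 0.
  have hgen : QAff.Generic q (q ^ c) := ⟨hq0, pow_ne_zero c hq0, hq, by
    rw [← pow_mul]; exact hq _ (by omega)⟩
  refine ⟨QAff.holds_fullRel_reduced hq0 hq hgen, QAff.exists_presented_equiv hq0 hq hgen, ?_, ?_⟩
  · intro p hp V _ _ ρ hW
    let f := ρ.comp (RingQuot.mkAlgHom K (QAff.reducedRels G q c))
    have h1 : ∀ x y, QAff.ReducedRel G q c (FreeAlgebra.ι K) x y → f x = f y := fun x y hxy =>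
      congrArg ρ (RingQuot.mkAlgHom_rel K hxy)
    exact QAff.exists_drinfeldGens hp hq0 hq hc
      (QAff.holds_baseRel (f := f) fun x y hxy => h1 x y (.base x y hxy))
      (QAff.holds_serreEqRel (f := f) fun x y hxy => h1 x y (.serre x y hxy)) hW hgen
  · intro V _ _ ρ hW hI
    let f := ρ.comp (RingQuot.mkAlgHom K (QAff.baseRels G q c))
    exact QAff.serreEq_of_isIntegrable hq0 hq
      (QAff.holds_baseRel (f := f) fun x y hxy => congrArg ρ (RingQuot.mkAlgHom_rel K hxy)) hW hI
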